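/- **Conventions.** Graphs are finite and simple. A *complex* is a finite set of members with a boundary relation $\tau\prec\sigma$. For a colouring $c$ of the members put $\mathcal B(\sigma)=\{\tau:\tau\prec\sigma\}$, $\mathcal C(\sigma)=\{\tau:\sigma\prec\tau\}$ and define the multisets $c_{\mathcal B}(\sigma)=\{\!\!\{c_\tau:\tau\in\mathcal B(\sigma)\}\!\!\}$, $c_{\mathcal C}(\sigma)=\{\!\!\{c_\tau:\tau\in\mathcal C(\sigma)\}\!\!\}$, $c_\uparrow(\sigma)=\{\!\!\{(c_\tau,c_\delta):\delta\in\mathcal C(\sigma)\cap\mathcal C(\tau)\}\!\!\}$, $c_\downarrow(\sigma)=\{\!\!\{(c_\tau,c_\delta):\delta\in\mathcal B(\sigma)\cap\mathcal B(\tau)\}\!\!\}$ (over all pairs $(\tau,\delta)$ of members with the stated property). A colour refinement starts with one colour for all members and updates all colours simultaneously by an injective function $\mathrm{Hash}$. It *distinguishes* two complexes if, run in parallel on both until no further round separates two equally coloured members (of the same or of different complexes), the resulting colour histograms differ. **PWL.** Let $p\in\mathbb N\cup\{\infty\}$. The members of the path complex $P_p(G)$ are the simple paths $v_0\dots v_d$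 of $G$ with $0\le d\le p$, a sequence and its reverse being identified; $\tau\prec\sigma$ if $\tau$ arises from $\sigma$ by deleting one vertex of the sequence and is itself a path of $G$. For $p=\infty$ all simple paths of $G$ are members. PWL in dimension $p$ is the refinement of $P_p(G)$ with the update $c^{t+1}_\sigma=\mathrm{Hash}(c^t_\sigma,c^t_{\mathcal B}(\sigma),c^t_\uparrow(\sigma))$. **CWL($k$-IC) with maximum dimension 2.** The cells are the vertices and edges of $G$ and one 2-cell for each induced cycle of $G$ of size at most $k$; a vertex is on the boundary of the edges containing it, an edge on the boundary of the 2-cells whose cycle contains it. The update is $d^{t+1}_\sigma=\mathrm{Hash}(d^t_\sigma,d^t_{\mathcal B}(\sigma),d^t_{\mathcal C}(\sigma),d^t_\downarrow(\sigma),d^t_\uparrow(\sigma))$. **Theorem.** Let $k\ge 3$ and $k\le p\le\infty$. PWL in dimension $p$ (in particular, for $p=\infty$, PWL on the complex of all simple paths) is at least as powerful as CWL($k$-IC) with maximum dimension 2 at distinguishing non-isomorphic graphs: for all finite simple graphs $G,H$, if CWL($k$-IC) distinguishes $G$ and $H$, then PWL in dimension $p$ distinguishes $G$ and $H$. This holds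 for any injective hash functions and initial colours used in the two tests. -/

import Mathlib

namespace PathWL

/-! ## Colour refinement on a finite complex

A complex is given by the finite type `M` of its members and the boundary relation `r`,
where `r τ σ` means `τ ≺ σ`, that is, `τ` lies on the boundary of `σ`. -/

section Refinement

/-- The multiset of the colours of the members satisfying `P`. -/
noncomputable def colorsOf {ι C : Type*} [Finite ι] (P : ι → Prop) (c : ι → C) : Multiset C :=
  ((Set.toFinite {x | P x}).toFinset).val.map c

/-- `c_B(σ)`: the colours of the boundary members `τ ≺ σ`. -/
noncomputable def boundaryColors {M C : Type*} [Finite M] (r : M → M → Prop) (c : M → C)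
    (σ : M) : Multiset C :=
  colorsOf (fun τ => r τ σ) c

/-- `c_C(σ)`: the colours of the co-boundary members `σ ≺ τ`. -/
noncomputable def coboundaryColors {M C : Type*} [Finite M] (r : M → M → Prop) (c : M → C)
    (σ : M) : Multiset C :=
  colorsOf (fun τ => r σ τ) c

/-- `c_↑(σ)`: the pairs `(c τ, c δ)` with `τ` an upper neighbour of `σ` and `δ` a common
co-boundary member of `σ` and `τ`. (That `τ` is an upper neighbour means exactly that such a
`δ` exists.) -/
noncomputable def upperColors {M C : Type*} [Finite M] (r : M → M → Prop) (c : M → C)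
    (σ : M) : Multiset (C × C) :=
  colorsOf (fun q : M × M => r σ q.2 ∧ r q.1 q.2) (fun q => (c q.1, c q.2))

/-- `c_↓(σ)`: the pairs `(c τ, c δ)` with `τ` a lower neighbour of `σ` and `δ` a common
boundary member of `σ` and `τ`. -/
noncomputable def lowerColors {M C : Type*} [Finite M] (r : M → M → Prop) (c : M → C)
    (σ : M) : Multiset (C × C) :=
  colorsOf (fun q : M × M => r q.2 σ ∧ r q.2 q.1) (fun q => (c q.1, c q.2))

/-- Colour refinement with the update rule `Hash(c_σ, c_B(σ), c_↑(σ))`, started from the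
constant colouring `c₀`. -/
noncomputable def refineBU {M C : Type*} [Finite M]
    (hash : C × Multiset C × Multiset (C × C) → C) (c₀ : C) (r : M → M → Prop) : ℕ → M → C
  | 0 => fun _ => c₀
  | t + 1 => fun σ =>
      hash (refineBU hash c₀ r t σ,
        boundaryColors r (refineBU hash c₀ r t) σ,
        upperColors r (refineBU hash c₀ r t) σ)

/-- Colour refinement with the full update rule
`Hash(c_σ, c_B(σ), c_C(σ), c_↓(σ), c_↑(σ))`, started from the constant colouring `c₀`. -/
noncomputable def refineFull {M C : Type*} [Finite M]
    (hash : C × Multiset C × Multiset C × Multiset (C × C) × Multiset (C × C) → C) (c₀ : C)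
    (r : M → M → Prop) : ℕ → M → C
  | 0 => fun _ => c₀
  | t + 1 => fun σ =>
      hash (refineFull hash c₀ r t σ,
        boundaryColors r (refineFull hash c₀ r t) σ,
        coboundaryColors r (refineFull hash c₀ r t) σ,
        lowerColors r (refineFull hash c₀ r t) σ,
        upperColors r (refineFull hash c₀ r t) σ)

/-- The colour histogram of a colouring. -/
noncomputable def histogram {M C : Type*} [Finite M] (c : M → C) : Multiset C :=
  colorsOf (fun _ => True) c

/-- The refinements `a` and `b`, run in parallel on two complexes, are stable at round `T`:
the next round separates no two members, of the same or of different complexes, that have the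
same colour at round `T`. -/
def StableAt {M N C : Type*} (a : ℕ → M → C) (b : ℕ → N → C) (T : ℕ) : Prop :=
  ∀ x y : M ⊕ N, Sum.elim (a T) (b T) x = Sum.elim (a T) (b T) y →
    Sum.elim (a (T + 1)) (b (T + 1)) x = Sum.elim (a (T + 1)) (b (T + 1)) y

/-- The test distinguishes two complexes: their stable colour histograms differ. -/
def Distinguishes {M N C : Type*} [Finite M] [Finite N] (a : ℕ → M → C) (b : ℕ → N → C) :
    Prop :=
  ∃ T, StableAt a b T ∧ histogram (a T) ≠ histogram (b T)

end Refinement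

/-! ## The path complex of a graph -/

section Paths

/-- The vertex sequence `l` is a simple path of `G`. -/
def IsSimplePath {V : Type*} (G : SimpleGraph V) (l : List V) : Prop :=
  l ≠ [] ∧ l.Nodup ∧ l.IsChain G.Adj

/-- Vertex sequences of simple paths of `G` of dimension at most `p`; a `d`-dimensional path
has `d + 1` vertices, and `p = ⊤` imposes no bound. -/
def PathSeq {V : Type*} (G : SimpleGraph V) (p : ℕ∞) : Type _ :=
  {l : List V // IsSimplePath G l ∧ (l.length : ℕ∞) ≤ p + 1}

/-- A sequence and its reverse are identified. -/
def pathSetoid {V : Type*} (G : SimpleGraph V) (p : ℕ∞) : Setoid (PathSeq G p) where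
  r a b := a.1 = b.1 ∨ a.1 = b.1.reverse
  iseqv :=
    { refl := fun _ => Or.inl rfl
      symm := by
        rintro a b (h | h)
        · exact Or.inl h.symm
        · exact Or.inr (by rw [h, List.reverse_reverse])
      trans := by
        rintro a b c (h | h) (h' | h')
        · exact Or.inl (h.trans h')
        · exact Or.inr (h.trans h')
        · exact Or.inr (by rw [h, h'])
        · exact Or.inl (by rw [h, h', List.reverse_reverse]) }

/-- The members of the path complex of `G` of highest dimension `p`: simple paths of dimension
at most `p`, up to reversal. -/
def ElemPath {V : Type*} (G : SimpleGraph V) (p : ℕ∞) : Type _ :=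
  Quotient (pathSetoid G p)

instance {V : Type*} [Finite V] (G : SimpleGraph V) (p : ℕ∞) : Finite (PathSeq G p) := by
  classical
  have := Fintype.ofFinite V
  refine Finite.of_injective
    (fun a : PathSeq G p => (⟨a.1, a.2.1.2.1⟩ : {l : List V // l.Nodup})) ?_
  intro a b h
  exact Subtype.ext (Subtype.mk.inj h)

instance {V : Type*} [Finite V] (G : SimpleGraph V) (p : ℕ∞) : Finite (ElemPath G p) :=
  inferInstanceAs (Finite (Quotient (pathSetoid G p)))

/-- `σ ≺ τ`: the path `σ` arises from the path `τ` by deleting one vertex of the sequence.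
Deleting an inner vertex counts only if the result is again a path of the graph. -/
def pathBoundary {V : Type*} (G : SimpleGraph V) (p : ℕ∞) (σ τ : ElemPath G p) : Prop :=
  ∃ a b : PathSeq G p, Quotient.mk (pathSetoid G p) a = σ ∧ Quotient.mk (pathSetoid G p) b = τ ∧
    ∃ i < b.1.length, a.1 = b.1.eraseIdx i

/-- The PWL colouring of the path complex of `G` of highest dimension `p`. -/
noncomputable def pwlColoring {V C : Type*} [Finite V]
    (hash : C × Multiset C × Multiset (C × C) → C) (c₀ : C) (G : SimpleGraph V) (p : ℕ∞) :
    ℕ → ElemPath G p → C :=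
  refineBU hash c₀ (pathBoundary G p)

end Paths

/-! ## The cell complex of a graph with 2-cells at the induced cycles of size at most `k` -/

section Cells

/-- `s` is the vertex set of an induced cycle of `G`. -/
def IsInducedCycle {V : Type*} (G : SimpleGraph V) (s : Finset V) : Prop :=
  3 ≤ s.card ∧ Nonempty (SimpleGraph.cycleGraph s.card ≃g G.induce (s : Set V))

/-- The cells: vertices, edges, and one 2-cell for each induced cycle of size at most `k`
(an induced cycle is determined by its vertex set). -/
abbrev Cell {V : Type*} (G : SimpleGraph V) (k : ℕ) : Type _ :=
  V ⊕ G.edgeSet ⊕ {s : Finset V // IsInducedCycle G s ∧ s.card ≤ k}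

/-- `σ ≺ τ`: a vertex on the boundary of an edge, or an edge on the boundary of a 2-cell. -/
def cellBoundary {V : Type*} (G : SimpleGraph V) (k : ℕ) : Cell G k → Cell G k → Prop
  | .inl v, .inr (.inl e) => v ∈ (e : Sym2 V)
  | .inr (.inl e), .inr (.inr s) => ∀ v ∈ (e : Sym2 V), v ∈ s.1
  | _, _ => False

/-- The colouring of the cells by CWL(`k`-IC) with maximum dimension 2. -/
noncomputable def cwlColoring {V C : Type*} [Finite V]
    (hash : C × Multiset C × Multiset C × Multiset (C × C) × Multiset (C × C) → C) (c₀ : C)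
    (G : SimpleGraph V) (k : ℕ) : ℕ → Cell G k → C :=
  refineFull hash c₀ (cellBoundary G k)

end Cells

end PathWL

/-!
Both tests are run on the disjoint union of the two graphs, of which each graph is a union of
components. It suffices that a stable PWL colouring of the path complex of a graph determines
an equitable colouring of its cells (`cellCol`, `cellCol_equitable`), that is, one in which the colour
of a cell determines the colours of its boundary and of its co-boundary. Every round of CWL is then
a function of this colouring (`refineFull_eq_of_equitable`), and equal histograms of paths on two
unions of components give equal histograms of cells (`colorsOf_cellsIn`). Vertices and edges are
coloured as paths with one and two vertices, a 2-cell by the multiset of its edge colours.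

A stable PWL colouring is itself equitable: the colour of a path determines its boundary colours by
injectivity of the hash function, and its co-boundary colours because the upper colours list every
co-boundary member `δ` as often as `δ` has boundary members, a number that the colour of `δ`
determines. What has to be shown is that the colour of an edge determines, for each multiset `χ`,
the number of induced cycles with at most `k` vertices and edge colours `χ` that contain the edge
(`numCycles_edge_eq`). Triangles are read off from the paths with three vertices and three boundary
members (`card_triangles`). For longer cycles only paths without chords between vertices at
distance two are used: they are the paths of dimension at least one with exactly two boundary
members, and induced paths are among them.

The difficulty is that the colour of an induced path does not show at once whether its two ends are
adjacent.
Comparing the boundaries of two equally coloured paths downwards gives, for each window size, that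
the words spelled by the colours of their windows are equal up to reversal, or else are alternating
words of odd length exchanged with each other, `a b … b a` and `b a … a b` (`symAgr_or_sw`). In the
first case a count at the two ends of the path detects a closing edge: a neighbour of an end that is
not on the path and not adjacent to the vertex next to this end gives an extension of the path.
These neighbours, with the other end if there is a closing edge, can be expressed through extensions
of windows with two and three vertices, so that they are determined by the words
(`Re_telescope`, `Re_add_Re_of_J`, `closing_of_not_mixed`). If the words are exchanged, the same
count shows how the closing edges of the two paths differ (`closing_of_mixed`), and each extension
continues the alternating word (`Mixed.win_rext`). This rigidity shows that only few closing
extensions have exchanged words: they lie at opposite ends of the two paths (`Aligned`), and either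
they close on both paths, or at one end none of them closes. Hence the colour of a path determines
the number of vertices that close it to an induced cycle with edge colours `χ` (`numClosing_eq`).

An induced cycle with `m` vertices that contains an induced path with fewer than `m - 1` vertices
contains exactly two extensions of this path (`two_mul_numCycles`). Descending from paths with
`m - 1` vertices, where `numClosing_eq` applies, down to edges gives the count of cycles at an edge
(`numCycles_eq`). The histogram of 2-cells follows by counting pairs of a 2-cell and an edge of it
(`colorsOf_cycles_in`).
-/

namespace PathWL

/-! ### Colour multisets and refinements -/

section ColorsOf

variable {ι κ C D : Type*} [Finite ι] [Finite κ]

lemma colorsOf_eq [Fintype ι] (P : ι → Prop) [DecidablePred P] (c : ι → C) :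
    colorsOf P c = (Finset.univ.filter P).val.map c := by
  unfold colorsOf
  congr 2
  ext x
  simp

lemma colorsOf_eq_sum [Fintype ι] (P : ι → Prop) [DecidablePred P] (c : ι → C) :
    colorsOf P c = ∑ x, if P x then {c x} else 0 := by
  rw [colorsOf_eq, ← Finset.sum_filter, Finset.sum]
  exact (Multiset.sum_map_singleton _).symm.trans (by rw [Multiset.map_map]; rfl)

lemma map_colorsOf (P : ι → Prop) (c : ι → C) (f : C → D) :
    (colorsOf P c).map f = colorsOf P (fun x => f (c x)) := by
  simp [colorsOf, Multiset.map_map]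

lemma count_colorsOf [DecidableEq C] [Fintype ι] (P : ι → Prop) [DecidablePred P] (c : ι → C)
    (a : C) : (colorsOf P c).count a = ∑ x, if P x ∧ c x = a then 1 else 0 := by
  rw [colorsOf_eq_sum, Multiset.count_sum']
  refine Finset.sum_congr rfl fun x _ => ?_
  by_cases h : P x <;> simp [h, Multiset.count_singleton, eq_comm]

lemma card_colorsOf [Fintype ι] (P : ι → Prop) [DecidablePred P] (c : ι → C) :
    (colorsOf P c).card = ∑ x, if P x then 1 else 0 := by
  rw [colorsOf_eq, Multiset.card_map, Finset.card_val, Finset.card_filter]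

lemma mem_colorsOf (P : ι → Prop) (c : ι → C) (a : C) :
    a ∈ colorsOf P c ↔ ∃ x, P x ∧ c x = a := by
  simp [colorsOf]

lemma colorsOf_congr {P Q : ι → Prop} {c d : ι → C} (h : ∀ x, P x ↔ Q x)
    (hc : ∀ x, P x → c x = d x) : colorsOf P c = colorsOf Q d := by
  obtain rfl : P = Q := funext fun x => propext (h x)
  exact Multiset.map_congr rfl fun x hx => hc x (by simpa using hx)

/-- If a condition holds only on the range of an injection, then its colour multiset can be
computed on the source of the injection. -/
lemma colorsOf_comp {φ : ι → κ} (hφ : Function.Injective φ) {Q : κ → Prop}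
    (hQ : ∀ y, Q y → y ∈ Set.range φ) (c : κ → C) :
    colorsOf Q c = colorsOf (fun x => Q (φ x)) (fun x => c (φ x)) := by
  classical
  have := Fintype.ofFinite ι
  have := Fintype.ofFinite κ
  have h : Finset.univ.filter Q = (Finset.univ.filter fun x => Q (φ x)).map ⟨φ, hφ⟩ := by
    ext y
    simp only [Finset.mem_filter, Finset.mem_univ, true_and, Finset.mem_map,
      Function.Embedding.coeFn_mk]
    constructor
    · intro hy
      obtain ⟨x, rfl⟩ := hQ y hy
      exact ⟨x, hy, rfl⟩
    · rintro ⟨x, hx, rfl⟩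
      exact hx
  rw [colorsOf_eq, colorsOf_eq, h, Finset.map_val, Multiset.map_map]
  rfl

/-- A colour multiset over pairs, sorted by the second entry. -/
lemma colorsOf_prod (P : κ → Prop) (R : ι → κ → Prop) (c : ι → κ → C) :
    colorsOf (fun q : ι × κ => P q.2 ∧ R q.1 q.2) (fun q => c q.1 q.2) =
      (colorsOf P fun y => colorsOf (fun x => R x y) fun x => c x y).sum := by
  classical
  have := Fintype.ofFinite ι
  have := Fintype.ofFinite κ
  rw [colorsOf_eq P, colorsOf_eq_sum, Fintype.sum_prod_type_right]
  change _ = ∑ y ∈ Finset.univ.filter P, _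
  rw [Finset.sum_filter]
  refine Finset.sum_congr rfl fun y _ => ?_
  by_cases h : P y
  · simp [h, colorsOf_eq_sum]
  · simp [h]

end ColorsOf

section Refine

lemma exists_factor {A X Y : Type*} {f : A → X} {d : A → Y} (h : ∀ x y, f x = f y → d x = d y) :
    ∃ g : X → Option Y, ∀ x, g (f x) = some (d x) := by
  classical
  refine ⟨fun a => if ha : ∃ x, f x = a then some (d ha.choose) else none, fun x => ?_⟩
  have ha : ∃ y, f y = f x := ⟨x, rfl⟩
  simp only [dif_pos ha, h _ _ ha.choose_spec]

variable {M N C : Type*} [Finite M] [Finite N]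

/-- Refinements do not change when the complex is enlarged by members that are not related to
the old ones. -/
lemma refineBU_comp (hash : C × Multiset C × Multiset (C × C) → C) (c₀ : C)
    {r : M → M → Prop} {r' : N → N → Prop} {φ : M → N} (hφ : Function.Injective φ)
    (hr : ∀ a b, r' (φ a) (φ b) ↔ r a b)
    (hd : ∀ x b, r' x (φ b) → x ∈ Set.range φ) (hu : ∀ a x, r' (φ a) x → x ∈ Set.range φ)
    (t : ℕ) (x : M) : refineBU hash c₀ r' t (φ x) = refineBU hash c₀ r t x := by
  induction t generalizing x with
  | zero => rfl
  | succ t ih =>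
    simp only [refineBU]
    congr 3
    · exact ih x
    · unfold boundaryColors
      rw [colorsOf_comp hφ fun y hy => hd y x hy]
      exact colorsOf_congr (fun y => hr y x) fun y _ => ih y
    · unfold upperColors
      rw [colorsOf_comp (φ := Prod.map φ φ) (hφ.prodMap hφ)]
      · exact colorsOf_congr (fun y => and_congr (hr _ _) (hr _ _))
          fun y _ => Prod.ext (ih _) (ih _)
      · rintro ⟨y, z⟩ ⟨h1, h2⟩
        obtain ⟨z, rfl⟩ := hu _ _ h1
        obtain ⟨y, rfl⟩ := hd _ _ h2
        exact ⟨(y, z), rfl⟩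

/-- The analogue of `refineBU_comp` for the full update rule. -/
lemma refineFull_comp
    (hash : C × Multiset C × Multiset C × Multiset (C × C) × Multiset (C × C) → C) (c₀ : C)
    {r : M → M → Prop} {r' : N → N → Prop} {φ : M → N} (hφ : Function.Injective φ)
    (hr : ∀ a b, r' (φ a) (φ b) ↔ r a b)
    (hd : ∀ x b, r' x (φ b) → x ∈ Set.range φ) (hu : ∀ a x, r' (φ a) x → x ∈ Set.range φ)
    (t : ℕ) (x : M) : refineFull hash c₀ r' t (φ x) = refineFull hash c₀ r t x := by
  induction t generalizing x with
  | zero => rfl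
  | succ t ih =>
    simp only [refineFull]
    congr 5
    · exact ih x
    · unfold boundaryColors
      rw [colorsOf_comp hφ fun y hy => hd y x hy]
      exact colorsOf_congr (fun y => hr y x) fun y _ => ih y
    · unfold coboundaryColors
      rw [colorsOf_comp hφ fun y hy => hu x y hy]
      exact colorsOf_congr (fun y => hr x y) fun y _ => ih y
    · unfold lowerColors
      rw [colorsOf_comp (φ := Prod.map φ φ) (hφ.prodMap hφ)]
      · exact colorsOf_congr (fun y => and_congr (hr _ _) (hr _ _))
          fun y _ => Prod.ext (ih _) (ih _)
      · rintro ⟨y, z⟩ ⟨h1, h2⟩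
        obtain ⟨z, rfl⟩ := hd _ _ h1
        obtain ⟨y, rfl⟩ := hu _ _ h2
        exact ⟨(y, z), rfl⟩
    · unfold upperColors
      rw [colorsOf_comp (φ := Prod.map φ φ) (hφ.prodMap hφ)]
      · exact colorsOf_congr (fun y => and_congr (hr _ _) (hr _ _))
          fun y _ => Prod.ext (ih _) (ih _)
      · rintro ⟨y, z⟩ ⟨h1, h2⟩
        obtain ⟨z, rfl⟩ := hu _ _ h1
        obtain ⟨y, rfl⟩ := hd _ _ h2
        exact ⟨(y, z), rfl⟩

/-- A refinement with an injective hash function becomes stable. -/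
lemma exists_stable {hash : C × Multiset C × Multiset (C × C) → C}
    (hh : Function.Injective hash) (c₀ : C) (r : M → M → Prop) :
    ∃ T, ∀ x y, refineBU hash c₀ r T x = refineBU hash c₀ r T y →
      refineBU hash c₀ r (T + 1) x = refineBU hash c₀ r (T + 1) y := by
  let E : ℕ → Set (M × M) := fun t => {q | refineBU hash c₀ r t q.1 = refineBU hash c₀ r t q.2}
  have hE : ∀ t, E (t + 1) ⊆ E t := by
    rintro t ⟨x, y⟩ h
    exact congrArg Prod.fst (hh h)
  obtain ⟨T, hT⟩ : ∃ T, ∀ t, (E T).ncard ≤ (E t).ncard :=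
    ⟨Function.argmin (fun t => (E t).ncard),
      fun t => Function.argmin_le (fun t => (E t).ncard) t⟩
  refine ⟨T, fun x y h => ?_⟩
  have : E (T + 1) = E T := Set.eq_of_subset_of_ncard_le (hE T) (hT _) (Set.toFinite _)
  exact this.ge (show (x, y) ∈ E T from h)

/-- The upper colours determine the co-boundary colours if a colour determines the number of
boundary members: each co-boundary member `δ` occurs in `c_↑` as often as it has boundary
members. -/
lemma coboundaryColors_eq_of_upperColors {r : M → M → Prop} {c : M → C}
    (hc : ∀ x y, c x = c y → (boundaryColors r c x).card = (boundaryColors r c y).card)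
    {x y : M} (h : upperColors r c x = upperColors r c y) :
    coboundaryColors r c x = coboundaryColors r c y := by
  classical
  have := Fintype.ofFinite M
  ext a
  by_cases ha : ∃ d, c d = a
  · obtain ⟨d, rfl⟩ := ha
    have key : ∀ z, ((upperColors r c z).map Prod.snd).count (c d) =
        (coboundaryColors r c z).count (c d) * (boundaryColors r c d).card := by
      intro z
      unfold upperColors coboundaryColors
      rw [map_colorsOf, count_colorsOf, count_colorsOf, Fintype.sum_prod_type_right,
        Finset.sum_mul]
      refine Finset.sum_congr rfl fun e _ => ?_
      by_cases h1 : r z e ∧ c e = c d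
      · rw [← hc _ _ h1.2]
        simp [h1, boundaryColors, card_colorsOf]
      · rw [if_neg h1, zero_mul]
        exact Finset.sum_eq_zero fun u _ => if_neg fun h2 => h1 ⟨h2.1.1, h2.2⟩
    by_cases hb : (boundaryColors r c d).card = 0
    · have hz : ∀ z, (coboundaryColors r c z).count (c d) = 0 := by
        intro z
        rw [Multiset.count_eq_zero]
        intro hm
        obtain ⟨e, he, hcd⟩ := (mem_colorsOf _ _ _).1 hm
        rw [← hc _ _ hcd, Multiset.card_eq_zero] at hb
        have : c z ∈ boundaryColors r c e := (mem_colorsOf _ _ _).2 ⟨z, he, rfl⟩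
        simp [hb] at this
      rw [hz, hz]
    · have := key x
      rw [h, key y] at this
      exact (Nat.eq_of_mul_eq_mul_right (Nat.pos_of_ne_zero hb) this).symm
  · have hz : ∀ z, (coboundaryColors r c z).count a = 0 := by
      intro z
      rw [Multiset.count_eq_zero]
      intro hm
      obtain ⟨e, -, hcd⟩ := (mem_colorsOf _ _ _).1 hm
      exact ha ⟨e, hcd⟩
    rw [hz, hz]

/-- An equitable colouring is at least as fine as every round of the full refinement. -/
lemma refineFull_eq_of_equitable
    (hash : C × Multiset C × Multiset C × Multiset (C × C) × Multiset (C × C) → C) (c₀ : C)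
    {r : M → M → Prop} {X : Type*} {f : M → X}
    (hB : ∀ x y, f x = f y → boundaryColors r f x = boundaryColors r f y)
    (hC : ∀ x y, f x = f y → coboundaryColors r f x = coboundaryColors r f y) (t : ℕ) :
    ∃ g : X → C, ∀ x, refineFull hash c₀ r t x = g (f x) := by
  classical
  obtain ⟨gB, hgB⟩ := exists_factor hB
  obtain ⟨gC, hgC⟩ := exists_factor hC
  induction t with
  | zero => exact ⟨fun _ => c₀, fun _ => rfl⟩
  | succ t ih =>
    obtain ⟨g, hg⟩ := ih
    have hg' : refineFull hash c₀ r t = fun x => g (f x) := funext hg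
    have hlow : ∀ x, lowerColors r (fun x => g (f x)) x =
        ((boundaryColors r f x).map fun a =>
          ((gC a).getD 0).map fun b => (g b, g a)).sum := by
      intro x
      refine (colorsOf_prod (fun d => r d x) (fun y d => r d y)
        fun y d => (g (f y), g (f d))).trans ?_
      unfold boundaryColors
      rw [map_colorsOf]
      congr 1
      refine colorsOf_congr (fun _ => Iff.rfl) fun d _ => ?_
      rw [hgC, Option.getD_some, coboundaryColors, map_colorsOf]
    have hup : ∀ x, upperColors r (fun x => g (f x)) x =
        ((coboundaryColors r f x).map fun a =>
          ((gB a).getD 0).map fun b => (g b, g a)).sum := by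
      intro x
      refine (colorsOf_prod (fun d => r x d) (fun y d => r y d)
        fun y d => (g (f y), g (f d))).trans ?_
      unfold coboundaryColors
      rw [map_colorsOf]
      congr 1
      refine colorsOf_congr (fun _ => Iff.rfl) fun d _ => ?_
      rw [hgB, Option.getD_some, boundaryColors, map_colorsOf]
    obtain ⟨G, hG⟩ := exists_factor (f := f) (d := refineFull hash c₀ r (t + 1)) (by
      intro x y h
      simp only [refineFull]
      rw [hg']
      simp only [hlow, hup, hB x y h, hC x y h, h]
      have hb : ∀ z, boundaryColors r (fun x => g (f x)) z = (boundaryColors r f z).map g :=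
        fun z => (map_colorsOf _ _ _).symm
      have hc : ∀ z, coboundaryColors r (fun x => g (f x)) z = (coboundaryColors r f z).map g :=
        fun z => (map_colorsOf _ _ _).symm
      rw [hb, hb, hc, hc, hB x y h, hC x y h])
    exact ⟨fun a => (G a).getD c₀, fun x => by simp [hG]⟩

end Refine

/-! ### Paths without short chords and their windows -/

section Words

variable {U C : Type*}

/-- The sequence `v`, started at index `i`. -/
def sh (v : ℕ → U) (i : ℕ) : ℕ → U := fun t => v (i + t)

/-- The list of the first `n` terms of `v`. -/
def seg (v : ℕ → U) (n : ℕ) : List U := (List.range n).map v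

/-- The first `n` terms of `v` in reverse order. -/
def rv (v : ℕ → U) (n : ℕ) : ℕ → U := fun t => v (n - 1 - t)

/-- The first `n` terms of `v`, followed by `w`. -/
def rext (v : ℕ → U) (n : ℕ) (w : U) : ℕ → U := fun t => if t < n then v t else w

/-- The vertex `w`, followed by `v`. -/
def lext (w : U) (v : ℕ → U) : ℕ → U
  | 0 => w
  | t + 1 => v t

lemma sh_zero (v : ℕ → U) : sh v 0 = v := by
  funext t; simp [sh]

lemma sh_sh (v : ℕ → U) (i j : ℕ) : sh (sh v i) j = sh v (i + j) := by
  funext t; simp [sh, add_assoc]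

lemma sh_lext (w : U) (v : ℕ → U) : sh (lext w v) 1 = v := by
  funext t; simp [sh, lext, Nat.add_comm 1 t]

lemma seg_congr {v v' : ℕ → U} {n : ℕ} (h : ∀ t < n, v t = v' t) : seg v n = seg v' n :=
  List.map_congr_left fun t ht => h t (List.mem_range.1 ht)

lemma seg_eq_iff {v v' : ℕ → U} {n : ℕ} : seg v n = seg v' n ↔ ∀ t < n, v t = v' t := by
  simp [seg]

lemma length_seg (v : ℕ → U) (n : ℕ) : (seg v n).length = n := by simp [seg]

lemma seg_rv (v : ℕ → U) (n : ℕ) : seg (rv v n) n = (seg v n).reverse := by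
  apply List.ext_getElem
  · simp [seg]
  · intro i h1 h2
    simp [seg, rv]

lemma rv_rv {v : ℕ → U} {n t : ℕ} (h : t < n) : rv (rv v n) n t = v t := by
  simp only [rv]
  congr 1
  omega

lemma sh_rv {v : ℕ → U} {n i j t : ℕ} (h : i + j ≤ n) (ht : t < j) :
    sh (rv v n) i t = rv (sh v (n - j - i)) j t := by
  simp only [rv, sh]
  congr 1
  omega

variable (G : SimpleGraph U)

/-- The first `n` terms of `v` form a simple path of `G` in which no vertex is adjacent to the
second next one, so that deleting an inner vertex never leaves a path. -/
structure NP (v : ℕ → U) (n : ℕ) : Prop where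
  inj : ∀ i j, i < j → j < n → v i ≠ v j
  adj : ∀ i, i + 1 < n → G.Adj (v i) (v (i + 1))
  nadj : ∀ i, i + 2 < n → ¬ G.Adj (v i) (v (i + 2))

variable {G}

lemma NP.congr {v v' : ℕ → U} {n : ℕ} (h : NP G v n) (hv : ∀ t < n, v t = v' t) : NP G v' n where
  inj i j hi hj := by
    rw [← hv i (by omega), ← hv j (by omega)]; exact h.inj i j hi hj
  adj i hi := by
    rw [← hv i (by omega), ← hv (i + 1) (by omega)]; exact h.adj i hi
  nadj i hi := by
    rw [← hv i (by omega), ← hv (i + 2) (by omega)]; exact h.nadj i hi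

lemma NP.sh {v : ℕ → U} {n i j : ℕ} (h : NP G v n) (hij : i + j ≤ n) : NP G (sh v i) j where
  inj a b ha hb := h.inj _ _ (by omega) (by omega)
  adj a ha := h.adj (i + a) (by omega)
  nadj a ha := h.nadj (i + a) (by omega)

lemma NP.mono {v : ℕ → U} {n j : ℕ} (h : NP G v n) (hj : j ≤ n) : NP G v j := by
  have := h.sh (i := 0) (j := j) (by omega)
  rwa [sh_zero] at this

lemma NP.rv {v : ℕ → U} {n : ℕ} (h : NP G v n) : NP G (rv v n) n where
  inj a b ha hb := (h.inj _ _ (by omega) (by omega)).symm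
  adj a ha := by
    have := (h.adj (n - 1 - (a + 1)) (by omega)).symm
    rwa [show n - 1 - (a + 1) + 1 = n - 1 - a by omega] at this
  nadj a ha h' := by
    have := h.nadj (n - 1 - (a + 2)) (by omega)
    rw [show n - 1 - (a + 2) + 2 = n - 1 - a by omega] at this
    exact this h'.symm

lemma NP_rv_iff {v : ℕ → U} {n : ℕ} : NP G (rv v n) n ↔ NP G v n :=
  ⟨fun h => h.rv.congr fun _ => rv_rv, NP.rv⟩

lemma rext_of_lt {v : ℕ → U} {n t : ℕ} (w : U) (h : t < n) : rext v n w t = v t := if_pos h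

lemma rext_self (v : ℕ → U) (n : ℕ) (w : U) : rext v n w n = w := if_neg (lt_irrefl n)

lemma NP_rext_iff {v : ℕ → U} {n : ℕ} {w : U} (hn : 2 ≤ n) :
    NP G (rext v n w) (n + 1) ↔ NP G v n ∧ G.Adj (v (n - 1)) w ∧ ¬ G.Adj (v (n - 2)) w ∧
      ∀ i < n, v i ≠ w := by
  obtain ⟨m, rfl⟩ : ∃ m, n = m + 2 := ⟨n - 2, by omega⟩
  constructor
  · intro h
    refine ⟨(h.mono (by omega : m + 2 ≤ _)).congr fun t ht => rext_of_lt w ht, ?_, ?_, ?_⟩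
    · have := h.adj (m + 1) (by omega)
      rwa [rext_of_lt w (by omega), rext_self] at this
    · have := h.nadj m (by omega)
      rwa [rext_of_lt w (by omega), rext_self] at this
    · intro i hi
      have := h.inj i (m + 2) hi (by omega)
      rwa [rext_of_lt w (by omega), rext_self] at this
  · rintro ⟨h, h1, h2, h3⟩
    refine ⟨fun i j hi hj => ?_, fun i hi => ?_, fun i hi => ?_⟩
    · rw [rext_of_lt w (by omega : i < m + 2)]
      rcases Nat.lt_succ_iff_lt_or_eq.1 hj with hj | rfl
      · rw [rext_of_lt w hj]; exact h.inj i j hi hj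
      · rw [rext_self]; exact h3 i hi
    · rw [rext_of_lt w (by omega : i < m + 2)]
      rcases Nat.lt_succ_iff_lt_or_eq.1 hi with hj | hj
      · rw [rext_of_lt w hj]; exact h.adj i hj
      · obtain rfl : i = m + 1 := by omega
        rw [rext_self]; exact h1
    · rw [rext_of_lt w (by omega : i < m + 2)]
      rcases Nat.lt_succ_iff_lt_or_eq.1 hi with hj | hj
      · rw [rext_of_lt w hj]; exact h.nadj i hj
      · obtain rfl : i = m := by omega
        rw [rext_self]; exact h2

lemma rv_lext {v : ℕ → U} {n t : ℕ} (w : U) (ht : t < n + 1) :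
    rv (lext w v) (n + 1) t = rext (rv v n) n w t := by
  by_cases h : t < n
  · rw [rext_of_lt w h]
    simp only [rv]
    rw [show n + 1 - 1 - t = (n - 1 - t) + 1 by omega]
    rfl
  · obtain rfl : t = n := by omega
    rw [rext_self]
    simp [rv, lext]

lemma NP_lext_iff {v : ℕ → U} {n : ℕ} {w : U} (hn : 2 ≤ n) :
    NP G (lext w v) (n + 1) ↔ NP G v n ∧ G.Adj (v 0) w ∧ ¬ G.Adj (v 1) w ∧
      ∀ i < n, v i ≠ w := by
  rw [← NP_rv_iff]
  have : NP G (rv (lext w v) (n + 1)) (n + 1) ↔ NP G (rext (rv v n) n w) (n + 1) :=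
    ⟨fun h => h.congr fun t => rv_lext w, fun h => h.congr fun t ht => (rv_lext w ht).symm⟩
  rw [this, NP_rext_iff hn, NP_rv_iff]
  simp only [rv]
  rw [show n - 1 - (n - 1) = 0 by omega, show n - 1 - (n - 2) = 1 by omega]
  refine and_congr_right fun _ => and_congr_right fun _ => and_congr_right fun _ => ?_
  exact ⟨fun h i hi => by
    have := h (n - 1 - i) (by omega)
    rwa [show n - 1 - (n - 1 - i) = i by omega] at this, fun h i hi => h _ (by omega)⟩

/-! ### Colourings of paths and the words of their windows -/

/-- The extension of the first `n` terms of `v` by one vertex, on the right for `true` and on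
the left for `false`. -/
def ext (v : ℕ → U) (n : ℕ) (q : Bool × U) : ℕ → U :=
  if q.1 then rext v n q.2 else lext q.2 v

open scoped Classical in
/-- The one-vertex extensions of `v` to a path without short chords. -/
noncomputable def exts [Fintype U] (G : SimpleGraph U) (v : ℕ → U) (n : ℕ) :
    Finset (Bool × U) :=
  Finset.univ.filter fun q => NP G (ext v n q) (n + 1)

/-- The properties of a stable PWL colouring that matter here, for paths without short chords
with up to `k + 1` vertices: the colour determines the colours of the two boundary paths and the
colours of the co-boundary members that are again without short chords. -/
structure IsPathColoring [Fintype U] (G : SimpleGraph U) (k : ℕ) (col : List U → C) : Prop where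
  rev : ∀ l, col l.reverse = col l
  down : ∀ n v v', 1 ≤ n → n ≤ k → NP G v (n + 1) → NP G v' (n + 1) →
    col (seg v (n + 1)) = col (seg v' (n + 1)) →
    s(col (seg v n), col (seg (sh v 1) n)) = s(col (seg v' n), col (seg (sh v' 1) n))
  up : ∀ n v v', 2 ≤ n → n ≤ k → NP G v n → NP G v' n → col (seg v n) = col (seg v' n) →
    (exts G v n).val.map (fun q => col (seg (ext v n q) (n + 1))) =
      (exts G v' n).val.map (fun q => col (seg (ext v' n q) (n + 1)))

/-- The colour of the window of `j` vertices of `v` that starts at index `i`. -/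
def win (col : List U → C) (v : ℕ → U) (j i : ℕ) : C := col (seg (sh v i) j)

/-- The windows of size `j` of two paths of length `n` have the same colours, in order. -/
def Agr (col : List U → C) (v v' : ℕ → U) (n j : ℕ) : Prop :=
  ∀ i, i + j ≤ n → win col v j i = win col v' j i

/-- The windows of size `j` of two paths of length `n` have the same colours, in order or in
reverse order. -/
def SymAgr (col : List U → C) (v v' : ℕ → U) (n j : ℕ) : Prop :=
  Agr col v v' n j ∨ Agr col v (rv v' n) n j

/-- The word `a b a b …`. -/
def alt {C : Type*} (a b : C) (i : ℕ) : C := if Even i then a else b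

/-- The windows of size `j` of two paths of length `n` spell the words `a b … b a` and
`b a … a b` of the same odd length. -/
def Sw (col : List U → C) (v v' : ℕ → U) (n j : ℕ) : Prop :=
  j + 2 ≤ n ∧ Even (n - j) ∧ ∃ a b, a ≠ b ∧
    ∀ i, i + j ≤ n → win col v j i = alt a b i ∧ win col v' j i = alt b a i

/-- Two words with the same unordered pairs of neighbouring letters are equal, or both
alternate between two letters. -/
lemma eq_or_alt_of_pairs {x y : ℕ → C} {N : ℕ} (hN : 1 ≤ N)
    (h : ∀ i < N, s(x i, x (i + 1)) = s(y i, y (i + 1))) :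
    (∀ i ≤ N, x i = y i) ∨
      ∃ a b, a ≠ b ∧ ∀ i ≤ N, x i = alt a b i ∧ y i = alt b a i := by
  induction N, hN using Nat.le_induction with
  | base =>
    have h0 := h 0 (by omega)
    rw [Sym2.eq_iff] at h0
    by_cases hx : x 0 = y 0
    · left
      intro i hi
      interval_cases i
      · exact hx
      · rcases h0 with h0 | h0
        · exact h0.2
        · exact h0.2.trans (hx.symm.trans h0.1)
    · right
      rcases h0 with h0 | h0
      · exact absurd h0.1 hx
      · refine ⟨x 0, x 1, fun hc => hx (hc.trans h0.2), fun i hi => ?_⟩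
        interval_cases i
        · simp [alt, h0.2]
        · simp [alt, h0.1]
  | succ N hN ih =>
    have hs := h N (by omega)
    rw [Sym2.eq_iff] at hs
    rcases ih fun i hi => h i (by omega) with h1 | ⟨a, b, hab, h1⟩
    · left
      intro i hi
      rcases Nat.le_succ_iff.1 hi with hi | rfl
      · exact h1 i hi
      · rcases hs with hs | hs
        · exact hs.2
        · exact hs.2.trans ((h1 N le_rfl).symm.trans hs.1)
    · right
      refine ⟨a, b, hab, fun i hi => ?_⟩
      rcases Nat.le_succ_iff.1 hi with hi | rfl
      · exact h1 i hi
      · obtain ⟨e1, e2⟩ := h1 N le_rfl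
        rw [e1, e2] at hs
        simp only [alt, Nat.even_add_one] at hs ⊢
        by_cases hp : Even N
        · simp only [hp, if_true, not_true, if_false] at hs ⊢
          rcases hs with hs | hs
          · exact absurd hs.1 hab
          · exact ⟨hs.2, hs.1.symm⟩
        · simp only [hp, if_true, not_false_iff, if_false] at hs ⊢
          rcases hs with hs | hs
          · exact absurd hs.1.symm hab
          · exact ⟨hs.2, hs.1.symm⟩

lemma win_congr {col : List U → C} {v v' : ℕ → U} {n i j : ℕ} (h : ∀ t < n, v t = v' t)
    (hij : i + j ≤ n) : win col v j i = win col v' j i :=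
  congrArg col (seg_congr fun t ht => h _ (by omega))

lemma win_sh (col : List U → C) (v : ℕ → U) (a i j : ℕ) :
    win col (sh v a) j i = win col v j (a + i) := by
  simp [win, sh_sh]

lemma win_zero (col : List U → C) (v : ℕ → U) (j : ℕ) : win col v j 0 = col (seg v j) := by
  simp [win, sh_zero]

lemma win_rv_rv (col : List U → C) (v : ℕ → U) {n i j : ℕ} (h : i + j ≤ n) :
    win col (rv (rv v n) n) j i = win col v j i :=
  win_congr (fun _ => rv_rv) h

lemma SymAgr.rv_right {col : List U → C} {v v' : ℕ → U} {n j : ℕ} (h : SymAgr col v v' n j) :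
    SymAgr col v (rv v' n) n j := by
  rcases h with h | h
  · exact Or.inr fun i hi => (h i hi).trans (win_rv_rv col v' hi).symm
  · exact Or.inl h

lemma Sw.symm {col : List U → C} {v v' : ℕ → U} {n j : ℕ} (h : Sw col v v' n j) :
    Sw col v' v n j := by
  obtain ⟨h1, h2, a, b, hab, h3⟩ := h
  exact ⟨h1, h2, b, a, hab.symm, fun i hi => (h3 i hi).symm⟩

variable [Fintype U] {k : ℕ} {col : List U → C} (hc : IsPathColoring G k col)
include hc

lemma win_rv (v : ℕ → U) {n i j : ℕ} (h : i + j ≤ n) :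
    win col (rv v n) j i = win col v j (n - j - i) := by
  unfold win
  rw [seg_congr fun t ht => sh_rv h ht, seg_rv, hc.rev]

lemma col_rv (v : ℕ → U) (n : ℕ) : col (seg (rv v n) n) = col (seg v n) := by
  rw [seg_rv, hc.rev]

lemma Sw.rv_right {v v' : ℕ → U} {n j : ℕ} (h : Sw col v v' n j) : Sw col v (rv v' n) n j := by
  obtain ⟨h1, h2, a, b, hab, h3⟩ := h
  refine ⟨h1, h2, a, b, hab, fun i hi => ⟨(h3 i hi).1, ?_⟩⟩
  rw [win_rv hc v' hi, (h3 _ (by omega)).2]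
  have : Even (n - j - i) ↔ Even i := by
    rw [Nat.even_sub (by omega)]; simp [h2]
  simp [alt, this]

/-- The colour of a window determines the unordered pair of the colours of the two windows
obtained from it by deleting an end. -/
lemma pair_eq {v v' : ℕ → U} {n n' j i i' : ℕ} (hj : 1 ≤ j) (hjk : j ≤ k) (hv : NP G v n)
    (hv' : NP G v' n') (hi : i + (j + 1) ≤ n) (hi' : i' + (j + 1) ≤ n')
    (h : win col v (j + 1) i = win col v' (j + 1) i') :
    s(win col v j i, win col v j (i + 1)) = s(win col v' j i', win col v' j (i' + 1)) := by
  have := hc.down j (sh v i) (sh v' i') hj hjk (hv.sh hi) (hv'.sh hi') h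
  simpa only [win, sh_sh] using this

/-- Alternating words on the windows of size `j + 1` force all pairs of neighbouring windows of
size `j` to have the same colours. -/
lemma Sw.pair_eq {v v' : ℕ → U} {n j : ℕ} (hj : 1 ≤ j) (hjk : j ≤ k) (hv : NP G v n)
    (hv' : NP G v' n) (h : Sw col v v' n (j + 1)) :
    ∃ α : Sym2 C, ∀ i, i + (j + 1) ≤ n → s(win col v j i, win col v j (i + 1)) = α ∧
      s(win col v' j i, win col v' j (i + 1)) = α := by
  obtain ⟨hn, -, a, b, -, h⟩ := h
  have hpar : ∀ i, i + (j + 1) ≤ n → ∀ i', i' + (j + 1) ≤ n →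
      ((Even i ↔ Even i') → s(win col v j i, win col v j (i + 1)) =
          s(win col v j i', win col v j (i' + 1)) ∧
        s(win col v' j i, win col v' j (i + 1)) =
          s(win col v' j i', win col v' j (i' + 1))) ∧
      (¬ (Even i ↔ Even i') → s(win col v j i, win col v j (i + 1)) =
          s(win col v' j i', win col v' j (i' + 1))) := by
    intro i hi i' hi'
    refine ⟨fun hp => ⟨PathWL.pair_eq hc hj hjk hv hv hi hi' ?_,
      PathWL.pair_eq hc hj hjk hv' hv' hi hi' ?_⟩,
      fun hp => PathWL.pair_eq hc hj hjk hv hv' hi hi' ?_⟩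
    · rw [(h i hi).1, (h i' hi').1]; simp [alt, hp]
    · rw [(h i hi).2, (h i' hi').2]; simp [alt, hp]
    · rw [(h i hi).1, (h i' hi').2]
      by_cases h1 : Even i <;> by_cases h2 : Even i' <;> simp_all [alt]
  set x := win col v j
  set y := win col v' j
  have p0 := (hpar 0 (by omega) 1 (by omega)).2 (by simp)
  have p1 := (hpar 1 (by omega) 0 (by omega)).2 (by simp)
  have p2 := ((hpar 0 (by omega) 2 (by omega)).1 (by simp)).1
  have q2 := ((hpar 0 (by omega) 2 (by omega)).1 (by simp)).2
  have hαβ : s(x 0, x (0 + 1)) = s(x 1, x (1 + 1)) := by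
    simp only [Sym2.eq_iff, Nat.reduceAdd] at *
    grind
  have hα : ∀ i, i + (j + 1) ≤ n → s(x i, x (i + 1)) = s(x 0, x (0 + 1)) := by
    intro i hi
    by_cases hp : Even i
    · exact ((hpar i hi 0 (by omega)).1 (by simp [hp])).1
    · exact ((hpar i hi 1 (by omega)).1 (by simp [hp])).1.trans hαβ.symm
  refine ⟨s(x 0, x (0 + 1)), fun i hi => ⟨hα i hi, ?_⟩⟩
  by_cases hp : Even i
  · rw [((hpar i hi 0 (by omega)).1 (by simp [hp])).2, ← p1, hαβ]
  · rw [((hpar i hi 1 (by omega)).1 (by simp [hp])).2, ← p0]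

/-- Two paths with the same colour have, for each window size, the same words up to reversal, or
else alternating words of odd length that differ by exchanging their two letters. -/
lemma symAgr_or_sw {v v' : ℕ → U} {n : ℕ} (hnk : n ≤ k + 1) (hv : NP G v n) (hv' : NP G v' n)
    (h : col (seg v n) = col (seg v' n)) {j : ℕ} (hj : 1 ≤ j) (hjn : j ≤ n) :
    SymAgr col v v' n j ∨ Sw col v v' n j := by
  induction hjn using Nat.decreasingInduction with
  | self =>
    left; left
    intro i hi
    obtain rfl : i = 0 := by omega
    rwa [win_zero, win_zero]
  | of_succ j hjn ih =>
    -- equal pairs of neighbouring letters suffice, whichever orientation of `v'` is used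
    have step : ∀ u, NP G u n → (∀ i < n - j, s(win col v j i, win col v j (i + 1)) =
        s(win col u j i, win col u j (i + 1))) → SymAgr col v u n j ∨ Sw col v u n j := by
      intro u hu hp
      rcases eq_or_alt_of_pairs (by omega) hp with h1 | ⟨a, b, hab, h1⟩
      · exact Or.inl (Or.inl fun i hi => h1 i (by omega))
      · by_cases he : Even (n - j)
        · by_cases h2 : j + 2 ≤ n
          · exact Or.inr ⟨h2, he, a, b, hab, fun i hi => h1 i (by omega)⟩
          · obtain rfl : n = j + 1 := by omega
            simp at he
        · left; right
          intro i hi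
          rw [win_rv hc u hi, (h1 i (by omega)).1, (h1 (n - j - i) (by omega)).2]
          have : Even (n - j - i) ↔ ¬ Even i := by
            rw [Nat.even_sub (by omega)]
            simp [he]
          by_cases hi : Even i <;> simp [alt, this, hi]
    rcases ih (by omega) with (h1 | h1) | h1
    · exact step v' hv' fun i hi => pair_eq hc hj (by omega) hv hv' (by omega) (by omega)
        (h1 i (by omega))
    · rcases step (rv v' n) hv'.rv fun i hi => pair_eq hc hj (by omega) hv hv'.rv (by omega)
        (by omega) (h1 i (by omega)) with h2 | h2
      · left
        have := h2.rv_right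
        rcases this with h3 | h3
        · exact Or.inl fun i hi => (h3 i hi).trans (win_rv_rv col v' hi)
        · right
          intro i hi
          rw [h3 i hi, win_rv_rv col _ hi]
      · right
        have := h2.rv_right hc
        obtain ⟨e1, e2, a, b, hab, e3⟩ := this
        exact ⟨e1, e2, a, b, hab, fun i hi =>
          ⟨(e3 i hi).1, (win_rv_rv col v' hi).symm.trans (e3 i hi).2⟩⟩
    · obtain ⟨α, hα⟩ := h1.pair_eq hc hj (by omega) hv hv'
      exact step v' hv' fun i hi => (hα i (by omega)).1.trans (hα i (by omega)).2.symm

end Words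

/-! ### Sums over windows and over extensions -/

section Sums

variable {U C : Type*} {G : SimpleGraph U}

lemma sum_alt {A : Type*} [AddCommMonoid A] (a b : A) (h : ℕ) :
    ∑ i ∈ Finset.range (2 * h + 1), alt a b i + b =
      ∑ i ∈ Finset.range (2 * h + 1), alt b a i + a := by
  induction h with
  | zero => simp [alt, add_comm]
  | succ h ih =>
    rw [show 2 * (h + 1) + 1 = 2 * h + 1 + 1 + 1 by ring, Finset.sum_range_succ,
      Finset.sum_range_succ, Finset.sum_range_succ _ (2 * h + 1 + 1),
      Finset.sum_range_succ _ (2 * h + 1)]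
    have e1 : ¬ Even (2 * h + 1) := by simp
    have e2 : Even (2 * h + 1 + 1) := by simp [parity_simps]
    have f : ∀ x y : A, alt x y (2 * h + 1) = y := fun x y => if_neg e1
    have g : ∀ x y : A, alt x y (2 * h + 1 + 1) = x := fun x y => if_pos e2
    rw [f, f, g, g]
    calc _ = (∑ i ∈ Finset.range (2 * h + 1), alt a b i + b) + (a + b) := by
            simp only [add_assoc]
      _ = _ := by rw [ih]; simp only [add_assoc, add_comm, add_left_comm]

/-- The window size for which a path of length `n` has an odd number of windows of two or three
vertices: only for this size can the words of two equally coloured paths be exchanged. -/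
def oddSize (n : ℕ) : ℕ := if Even n then 2 else 3

lemma oddSize_cases (n : ℕ) : oddSize n = 2 ∨ oddSize n = 3 := by
  unfold oddSize; split_ifs <;> simp

lemma even_sub_oddSize {n : ℕ} (hn : 2 ≤ n) : Even (n - oddSize n) := by
  unfold oddSize
  split_ifs with h
  · rw [Nat.even_sub hn]; simp [h]
  · have : 3 ≤ n := by
      by_contra h'
      obtain rfl : n = 2 := by omega
      simp at h
    rw [Nat.even_sub this]
    simp [h, Nat.even_iff]

/-- The words of two paths at the critical window size are exchanged. -/
def Mixed (col : List U → C) (v v' : ℕ → U) (n : ℕ) : Prop := Sw col v v' n (oddSize n)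

/-- The quantity `Φ` of a path with `j` vertices is determined by the colour of the path. -/
def Det {A : Type*} (G : SimpleGraph U) (col : List U → C) (j : ℕ) (Φ : (ℕ → U) → A) : Prop :=
  ∀ u u', NP G u j → NP G u' j → col (seg u j) = col (seg u' j) → Φ u = Φ u'

/-- The colour of the edge between two vertices. -/
def ed (col : List U → C) (a b : U) : C := col [a, b]

lemma win_two (col : List U → C) (v : ℕ → U) (i : ℕ) :
    win col v 2 i = ed col (v i) (v (i + 1)) := by
  simp [win, seg, sh, ed, List.range_succ]

lemma Det.win_eq {A : Type*} {col : List U → C} {j : ℕ} {Φ : (ℕ → U) → A} (hΦ : Det G col j Φ)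
    {v v' : ℕ → U}
    {n n' i i' : ℕ} (hv : NP G v n) (hv' : NP G v' n') (hi : i + j ≤ n) (hi' : i' + j ≤ n')
    (h : win col v j i = win col v' j i') : Φ (sh v i) = Φ (sh v' i') :=
  hΦ _ _ (hv.sh hi) (hv'.sh hi') h

lemma Sw.det_alt {A : Type*} {col : List U → C} {v v' : ℕ → U} {n j : ℕ} (hv : NP G v n)
    (hv' : NP G v' n) (h : Sw col v v' n j) {Φ : (ℕ → U) → A} (hΦ : Det G col j Φ) {i : ℕ} (hi : i + j ≤ n) :
    Φ (sh v i) = alt (Φ (sh v 0)) (Φ (sh v 1)) i ∧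
      Φ (sh v' i) = alt (Φ (sh v 1)) (Φ (sh v 0)) i := by
  obtain ⟨hn, -, a, b, -, h⟩ := h
  have h0 := (h 0 (by omega)).1
  have h1 := (h 1 (by omega)).1
  by_cases hp : Even i
  · simp only [alt, hp, if_true]
    exact ⟨hΦ.win_eq hv hv hi (by omega) (by rw [(h i hi).1, h0]; simp [alt, hp]),
      hΦ.win_eq hv' hv hi (by omega) (by rw [(h i hi).2, h1]; simp [alt, hp])⟩
  · simp only [alt, hp, if_false]
    exact ⟨hΦ.win_eq hv hv hi (by omega) (by rw [(h i hi).1, h1]; simp [alt, hp]),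
      hΦ.win_eq hv' hv hi (by omega) (by rw [(h i hi).2, h0]; simp [alt, hp])⟩

lemma Sw.sum_eq {A : Type*} [AddCommMonoid A] {col : List U → C} {v v' : ℕ → U} {n j : ℕ}
    (hv : NP G v n) (hv' : NP G v' n) (h : Sw col v v' n j) {Φ : (ℕ → U) → A}
    (hΦ : Det G col j Φ) :
    ∑ i ∈ Finset.range (n - j + 1), Φ (sh v i) + Φ (sh v 1) =
      ∑ i ∈ Finset.range (n - j + 1), Φ (sh v' i) + Φ (sh v 0) := by
  obtain ⟨t, ht⟩ := h.2.1
  have hn := h.1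
  have hs := sum_alt (Φ (sh v 0)) (Φ (sh v 1)) t
  rw [show n - j + 1 = 2 * t + 1 by omega]
  convert hs using 2
  · exact Finset.sum_congr rfl fun i hi =>
      (h.det_alt hv hv' hΦ (by rw [Finset.mem_range] at hi; omega)).1
  · exact Finset.sum_congr rfl fun i hi =>
      (h.det_alt hv hv' hΦ (by rw [Finset.mem_range] at hi; omega)).2

lemma Sw.sum_inner_eq {A : Type*} [AddCommMonoid A] {col : List U → C} {v v' : ℕ → U} {n j : ℕ}
    (hv : NP G v n) (hv' : NP G v' n) (h : Sw col v v' n j) {Φ : (ℕ → U) → A}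
    (hΦ : Det G col j Φ) :
    ∑ i ∈ Finset.range (n - j - 1), Φ (sh v (i + 1)) + Φ (sh v 0) =
      ∑ i ∈ Finset.range (n - j - 1), Φ (sh v' (i + 1)) + Φ (sh v 1) := by
  obtain ⟨t, ht⟩ := h.2.1
  have hn := h.1
  have hs := sum_alt (Φ (sh v 1)) (Φ (sh v 0)) (t - 1)
  rw [show n - j - 1 = 2 * (t - 1) + 1 by omega]
  have alt_succ : ∀ x y : A, ∀ i, alt x y (i + 1) = alt y x i := by
    intro x y i
    by_cases hp : Even i <;> simp [alt, hp, Nat.even_add_one]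
  convert hs using 2
  · exact Finset.sum_congr rfl fun i hi => by
      rw [(h.det_alt hv hv' hΦ (by rw [Finset.mem_range] at hi; omega)).1, alt_succ]
  · exact Finset.sum_congr rfl fun i hi => by
      rw [(h.det_alt hv hv' hΦ (by rw [Finset.mem_range] at hi; omega)).2, alt_succ]

/-- The edge colours of a path, those of inner edges counted twice. -/
def E3 (col : List U → C) (v : ℕ → U) (n : ℕ) : Multiset C :=
  ∑ i ∈ Finset.range (n - 2), ({win col v 2 i} + {win col v 2 (i + 1)})

/-- The edge colours of a path. -/
def E2 (col : List U → C) (v : ℕ → U) (n : ℕ) : Multiset C :=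
  ∑ i ∈ Finset.range (n - 1), {win col v 2 i}

lemma two_E2 (col : List U → C) (v : ℕ → U) {n : ℕ} (hn : 2 ≤ n) :
    E2 col v n + E2 col v n = E3 col v n + {win col v 2 0} + {win col v 2 (n - 2)} := by
  obtain ⟨m, rfl⟩ : ∃ m, n = m + 2 := ⟨n - 2, by omega⟩
  unfold E2 E3
  rw [Finset.sum_add_distrib]
  simp only [show m + 2 - 1 = m + 1 by omega, Nat.add_sub_cancel]
  nth_rw 1 [Finset.sum_range_succ]
  rw [Finset.sum_range_succ' _ m]
  simp only [add_assoc, add_comm, add_left_comm]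

lemma NP_lext_iff_rv {v : ℕ → U} {n : ℕ} {w : U} :
    NP G (lext w v) (n + 1) ↔ NP G (rext (rv v n) n w) (n + 1) := by
  rw [← NP_rv_iff]
  exact ⟨fun h => h.congr fun t => rv_lext w, fun h => h.congr fun t ht => (rv_lext w ht).symm⟩

variable [Fintype U]

lemma mem_exts {v : ℕ → U} {n : ℕ} {q : Bool × U} :
    q ∈ exts G v n ↔ NP G (ext v n q) (n + 1) := by
  simp [exts]

open scoped Classical in
/-- The colours of the last two edges, summed over the extensions of a path at its right end. -/
noncomputable def Rx (G : SimpleGraph U) (col : List U → C) (v : ℕ → U) (n : ℕ) : Multiset C :=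
  ∑ w, if NP G (rext v n w) (n + 1) then
    {ed col (v (n - 2)) (v (n - 1))} + {ed col (v (n - 1)) w} else 0

/-- The colours of the two edges at the new end, summed over all extensions of a path. -/
noncomputable def Xe (G : SimpleGraph U) (col : List U → C) (v : ℕ → U) (n : ℕ) : Multiset C :=
  Rx G col v n + Rx G col (rv v n) n

open scoped Classical in
/-- The colours of the edges `uv` and `vw`, summed over the neighbours `w` of `v` other than `u`
that are not adjacent to `u`. -/
noncomputable def Re (G : SimpleGraph U) (col : List U → C) (u v : U) : Multiset C :=
  ∑ w, if G.Adj v w ∧ w ≠ u ∧ ¬ G.Adj u w then {ed col u v} + {ed col v w} else 0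

open scoped Classical in
lemma sum_exts {A : Type*} [AddCommMonoid A] (v : ℕ → U) (n : ℕ) (F : Bool × U → A) :
    ∑ q ∈ exts G v n, F q = (∑ w, if NP G (rext v n w) (n + 1) then F (true, w) else 0) +
      ∑ w, if NP G (lext w v) (n + 1) then F (false, w) else 0 := by
  rw [exts, Finset.sum_filter, Fintype.sum_prod_type, Fintype.sum_bool]
  rfl

/-- The extensions at the right end of a path, and the neighbours of the last vertex `v (n - 1)`
that are not adjacent to `v (n - 2)`: the latter contain also the first vertex if it closes the
path to a cycle, which is the condition `P`. -/
lemma Re_eq_Rx (col : List U → C) {v : ℕ → U} {n : ℕ} (hn : 2 ≤ n) (hv : NP G v n)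
    (P : Prop) [Decidable P]
    (hP : ∀ i < n, i ≠ n - 2 → G.Adj (v (n - 1)) (v i) → ¬ G.Adj (v (n - 2)) (v i) → P ∧ i = 0)
    (hP' : P → 0 ≠ n - 2 ∧ G.Adj (v (n - 1)) (v 0) ∧ ¬ G.Adj (v (n - 2)) (v 0)) :
    Re G col (v (n - 2)) (v (n - 1)) = Rx G col v n +
      if P then {ed col (v (n - 2)) (v (n - 1))} + {ed col (v (n - 1)) (v 0)} else 0 := by
  classical
  have : (if P then {ed col (v (n - 2)) (v (n - 1))} + {ed col (v (n - 1)) (v 0)} else 0 :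
      Multiset C) = ∑ w, if w = v 0 then (if P then
        {ed col (v (n - 2)) (v (n - 1))} + {ed col (v (n - 1)) w} else 0) else 0 := by
    simp
  rw [this, Re, Rx, ← Finset.sum_add_distrib]
  refine Finset.sum_congr rfl fun w _ => ?_
  by_cases h1 : G.Adj (v (n - 1)) w ∧ w ≠ v (n - 2) ∧ ¬ G.Adj (v (n - 2)) w
  · rw [if_pos h1]
    by_cases h2 : ∃ i < n, v i = w
    · obtain ⟨i, hi, rfl⟩ := h2
      have h3 := hP i hi (fun h => h1.2.1 (by rw [h])) h1.1 h1.2.2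
      have h4 : ¬ NP G (rext v n (v i)) (n + 1) := fun h =>
        ((NP_rext_iff hn).1 h).2.2.2 i hi rfl
      rw [if_neg h4, if_pos (by rw [h3.2]), if_pos h3.1, zero_add]
    · push Not at h2
      have h3 : NP G (rext v n w) (n + 1) := (NP_rext_iff hn).2 ⟨hv, h1.1, h1.2.2, h2⟩
      rw [if_pos h3, if_neg (fun h => h2 0 (by omega) h.symm), add_zero]
  · have h3 : ¬ NP G (rext v n w) (n + 1) := fun h =>
      h1 ⟨((NP_rext_iff hn).1 h).2.1, fun h' => ((NP_rext_iff hn).1 h).2.2.2 (n - 2) (by omega)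
        h'.symm, ((NP_rext_iff hn).1 h).2.2.1⟩
    rw [if_neg h1, if_neg h3, zero_add]
    by_cases h4 : w = v 0
    · rw [if_pos h4]
      by_cases hp : P
      · refine absurd ?_ h1
        obtain ⟨p1, p2, p3⟩ := hP' hp
        subst h4
        exact ⟨p2, hv.inj 0 (n - 2) (by omega) (by omega), p3⟩
      · rw [if_neg hp]
    · rw [if_neg h4]

/-- On a path with two or three vertices and without chord every suitable neighbour of an end
gives an extension. -/
lemma Re_add_Re_eq_Xe (col : List U → C) {v : ℕ → U} {n : ℕ} (hn : n = 2 ∨ n = 3)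
    (hv : NP G v n) : Re G col (v (n - 2)) (v (n - 1)) + Re G col (v 1) (v 0) = Xe G col v n := by
  classical
  have key : ∀ u, NP G u n → Re G col (u (n - 2)) (u (n - 1)) = Rx G col u n := by
    intro u hu
    rw [Re_eq_Rx col (by omega) hu False _ (by simp)]
    · simp
    · intro i hi h1 h2 h3
      have h4 : i ≠ n - 1 := fun h => G.loopless.irrefl _ (h ▸ h2)
      obtain ⟨rfl, rfl⟩ : n = 3 ∧ i = 0 := by omega
      exact absurd h2.symm (hu.nadj 0 (by omega))
  rw [Xe, key v hv, ← key _ hv.rv]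
  simp only [rv]
  rw [show n - 1 - (n - 1) = 0 by omega, show n - 1 - (n - 2) = 1 by omega]

open scoped Classical in
lemma Xe_eq_sum_exts (col : List U → C) {v : ℕ → U} {n : ℕ} (hn : 2 ≤ n) :
    Xe G col v n = ∑ q ∈ exts G v n, (if q.1 then
      ({ed col (v (n - 2)) (v (n - 1))} + {ed col (v (n - 1)) q.2} : Multiset C)
      else {ed col (v 1) (v 0)} + {ed col (v 0) q.2}) := by
  rw [sum_exts, Xe, Rx, Rx]
  congr 1
  refine Finset.sum_congr rfl fun w _ => ?_
  simp only [NP_lext_iff_rv, rv]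
  rw [show n - 1 - (n - 1) = 0 by omega, show n - 1 - (n - 2) = 1 by omega]
  rfl

/-- The neighbours at the ends of a path are counted by the extensions of its inner edges and of
its windows of three vertices. -/
lemma Re_telescope (col : List U → C) {v : ℕ → U} {n : ℕ} (hn : 3 ≤ n) (hv : NP G v n) :
    Re G col (v (n - 2)) (v (n - 1)) + Re G col (v 1) (v 0) +
        ∑ i ∈ Finset.range (n - 2 - 1), Xe G col (sh v (i + 1)) 2 =
      ∑ i ∈ Finset.range (n - 3 + 1), Xe G col (sh v i) 3 := by
  obtain ⟨m, rfl⟩ : ∃ m, n = m + 3 := ⟨n - 3, by omega⟩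
  have h2 : ∀ i < m, Xe G col (sh v (i + 1)) 2 =
      Re G col (v (i + 1)) (v (i + 2)) + Re G col (v (i + 2)) (v (i + 1)) := fun i hi =>
    (Re_add_Re_eq_Xe col (Or.inl rfl) (hv.sh (by omega))).symm
  have h3 : ∀ i < m + 1, Xe G col (sh v i) 3 =
      Re G col (v (i + 1)) (v (i + 2)) + Re G col (v (i + 1)) (v i) := fun i hi =>
    (Re_add_Re_eq_Xe col (Or.inr rfl) (hv.sh (by omega))).symm
  simp only [show m + 3 - 2 - 1 = m by omega, Nat.add_sub_cancel]
  rw [Finset.sum_congr rfl fun i hi => h2 i (Finset.mem_range.1 hi),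
    Finset.sum_congr rfl fun i hi => h3 i (Finset.mem_range.1 hi), Finset.sum_add_distrib,
    Finset.sum_add_distrib, Finset.sum_range_succ, Finset.sum_range_succ' (fun i =>
      Re G col (v (i + 1)) (v i))]
  simp only [show m + 3 - 2 = m + 1 by omega, show m + 3 - 1 = m + 2 by omega, zero_add,
    add_assoc, Nat.reduceAdd]
  simp only [add_comm, add_left_comm]

variable {k : ℕ} {col : List U → C} (hc : IsPathColoring G k col)
include hc

lemma ed_comm (a b : U) : ed col a b = ed col b a := by
  simpa [ed] using (hc.rev [a, b]).symm

/-- Sums over the extensions of two equally coloured paths agree if the summands agree for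
equally coloured extensions. -/
lemma sum_exts_eq {A : Type*} [AddCommMonoid A] {v v' : ℕ → U} {n : ℕ} (hn : 2 ≤ n) (hnk : n ≤ k)
    (hv : NP G v n) (hv' : NP G v' n) (h : col (seg v n) = col (seg v' n))
    (F F' : Bool × U → A) (hF : ∀ q ∈ exts G v n, ∀ q' ∈ exts G v' n,
      col (seg (ext v n q) (n + 1)) = col (seg (ext v' n q') (n + 1)) → F q = F' q') :
    ∑ q ∈ exts G v n, F q = ∑ q ∈ exts G v' n, F' q := by
  have h1 := hc.up n v v' hn hnk hv hv' h
  rw [← Multiset.rel_eq, Multiset.rel_map] at h1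
  have h2 : Multiset.Rel (fun q q' => F q = F' q') (exts G v n).val (exts G v' n).val :=
    h1.mono fun q hq q' hq' hcol => hF q hq q' hq' hcol
  rw [← Multiset.rel_map, Multiset.rel_eq] at h2
  exact congrArg Multiset.sum h2

lemma exists_ext {v v' : ℕ → U} {n : ℕ} (hn : 2 ≤ n) (hnk : n ≤ k)
    (hv : NP G v n) (hv' : NP G v' n) (h : col (seg v n) = col (seg v' n)) {q : Bool × U}
    (hq : NP G (ext v n q) (n + 1)) :
    ∃ q', NP G (ext v' n q') (n + 1) ∧
      col (seg (ext v n q) (n + 1)) = col (seg (ext v' n q') (n + 1)) := by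
  have h1 := hc.up n v v' hn hnk hv hv' h
  have h2 := Multiset.mem_map_of_mem (fun q => col (seg (ext v n q) (n + 1)))
    (mem_exts.2 hq : q ∈ (exts G v n).val)
  rw [h1, Multiset.mem_map] at h2
  obtain ⟨q', hq', he⟩ := h2
  exact ⟨q', mem_exts.1 hq', he.symm⟩

lemma symAgr_of_not_mixed {v v' : ℕ → U} {n : ℕ} (hnk : n ≤ k + 1) (hv : NP G v n)
    (hv' : NP G v' n) (h : col (seg v n) = col (seg v' n)) (hm : ¬ Mixed col v v' n) {j : ℕ}
    (hj : j = 2 ∨ j = 3) (hjn : j ≤ n) : SymAgr col v v' n j := by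
  rcases symAgr_or_sw hc hnk hv hv' h (by omega : 1 ≤ j) hjn with h1 | h1
  · exact h1
  · refine absurd ?_ hm
    have : oddSize n = j := by
      have h2 := h1.2.1
      rw [Nat.even_sub hjn] at h2
      unfold oddSize
      rcases hj with rfl | rfl
      · rw [if_pos (h2.2 (by decide))]
      · rw [if_neg fun h3 => absurd (h2.1 h3) (by decide)]
    rw [Mixed, this]
    exact h1

lemma symAgr_of_not_even {v v' : ℕ → U} {n j : ℕ} (hnk : n ≤ k + 1) (hv : NP G v n)
    (hv' : NP G v' n) (h : col (seg v n) = col (seg v' n)) (hj : 1 ≤ j) (hjn : j ≤ n)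
    (he : ¬ Even (n - j)) : SymAgr col v v' n j :=
  (symAgr_or_sw hc hnk hv hv' h hj hjn).resolve_right fun h1 => he h1.2.1

/-- Words that agree up to reversal have the same sums over all windows. -/
lemma SymAgr.sum_eq {A : Type*} [AddCommMonoid A] {v v' : ℕ → U} {n j : ℕ} (hjn : j ≤ n)
    (hv : NP G v n) (hv' : NP G v' n) (h : SymAgr col v v' n j) {Φ : (ℕ → U) → A}
    (hΦ : Det G col j Φ) :
    ∑ i ∈ Finset.range (n - j + 1), Φ (sh v i) = ∑ i ∈ Finset.range (n - j + 1), Φ (sh v' i) := by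
  rcases h with h | h
  · refine Finset.sum_congr rfl fun i hi => ?_
    rw [Finset.mem_range] at hi
    exact hΦ.win_eq hv hv' (by omega) (by omega) (h i (by omega))
  · rw [← Finset.sum_range_reflect]
    refine Finset.sum_congr rfl fun i hi => ?_
    rw [Finset.mem_range] at hi
    refine hΦ.win_eq hv hv' (by omega) (by omega) ?_
    rw [h _ (by omega), win_rv hc v' (by omega)]
    congr 1
    omega

/-- Words that agree up to reversal have the same sums over the inner windows. -/
lemma SymAgr.sum_inner_eq {A : Type*} [AddCommMonoid A] {v v' : ℕ → U} {n j : ℕ}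
    (hv : NP G v n) (hv' : NP G v' n) (h : SymAgr col v v' n j) {Φ : (ℕ → U) → A}
    (hΦ : Det G col j Φ) :
    ∑ i ∈ Finset.range (n - j - 1), Φ (sh v (i + 1)) =
      ∑ i ∈ Finset.range (n - j - 1), Φ (sh v' (i + 1)) := by
  rcases h with h | h
  · refine Finset.sum_congr rfl fun i hi => ?_
    rw [Finset.mem_range] at hi
    exact hΦ.win_eq hv hv' (by omega) (by omega) (h _ (by omega))
  · rw [← Finset.sum_range_reflect]
    refine Finset.sum_congr rfl fun i hi => ?_
    rw [Finset.mem_range] at hi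
    refine hΦ.win_eq hv hv' (by omega) (by omega) ?_
    rw [h _ (by omega), win_rv hc v' (by omega)]
    congr 1
    omega

/-- The colour of a path determines its edge colours, those of inner edges counted twice. -/
lemma det_E3 {n : ℕ} (hk : 3 ≤ k + 1) (hnk : n ≤ k + 1) : Det G col n fun v => E3 col v n := by
  intro v v' hv hv' h
  rcases Nat.lt_or_ge n 3 with hn | hn
  · simp [E3, show n - 2 = 0 by omega]
  have msing : ∀ {a b c d : C}, s(a, b) = s(c, d) → ({a} + {b} : Multiset C) = {c} + {d} := by
    intro a b c d h
    rcases Sym2.eq_iff.1 h with ⟨rfl, rfl⟩ | ⟨rfl, rfl⟩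
    · rfl
    · exact add_comm _ _
  have hΦ : Det G col 3 fun u => ({win col u 2 0} + {win col u 2 1} : Multiset C) := by
    intro u u' hu hu' h
    exact msing (pair_eq hc (j := 2) (i := 0) (i' := 0) (by omega) (by omega) hu hu' le_rfl le_rfl
      (by rwa [win_zero, win_zero]))
  have hE : ∀ u, E3 col u n = ∑ i ∈ Finset.range (n - 3 + 1),
      ({win col (sh u i) 2 0} + {win col (sh u i) 2 1} : Multiset C) := by
    intro u
    rw [E3, show n - 2 = n - 3 + 1 by omega]
    exact Finset.sum_congr rfl fun i _ => by rw [win_sh, win_sh]; rfl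
  rcases symAgr_or_sw hc hnk hv hv' h (by omega : 1 ≤ 3) hn with h1 | h1
  · simp only [hE]
    exact h1.sum_eq hc hn hv hv' hΦ
  · obtain ⟨α, hα⟩ := h1.pair_eq hc (by omega) (by omega) hv hv'
    refine Finset.sum_congr rfl fun i hi => ?_
    rw [Finset.mem_range] at hi
    exact msing ((hα i (by omega)).1.trans (hα i (by omega)).2.symm)

lemma E3_ext {v : ℕ → U} {n : ℕ} (hn : 2 ≤ n) (q : Bool × U) :
    E3 col (ext v n q) (n + 1) = E3 col v n + (if q.1 then
      ({ed col (v (n - 2)) (v (n - 1))} + {ed col (v (n - 1)) q.2} : Multiset C)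
      else {ed col (v 1) (v 0)} + {ed col (v 0) q.2}) := by
  obtain ⟨m, rfl⟩ : ∃ m, n = m + 2 := ⟨n - 2, by omega⟩
  obtain ⟨b, w⟩ := q
  cases b
  · simp only [ext, E3, Bool.false_eq_true, if_false, show m + 2 + 1 - 2 = m + 1 by omega]
    rw [Finset.sum_range_succ']
    refine congrArg₂ (· + ·) ?_ ?_
    · refine Finset.sum_congr rfl fun i _ => ?_
      simp only [win_two]
      rfl
    · simp only [win_two, lext]
      rw [ed_comm hc w, ed_comm hc (v 0) (v 1), add_comm]
  · simp only [ext, E3, if_true, show m + 2 + 1 - 2 = m + 1 by omega, Nat.add_sub_cancel]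
    rw [Finset.sum_range_succ]
    congr 1
    · refine Finset.sum_congr rfl fun i hi => ?_
      rw [Finset.mem_range] at hi
      simp only [win_two]
      rw [rext_of_lt, rext_of_lt, rext_of_lt] <;> omega
    · simp only [win_two]
      rw [rext_of_lt _ (by omega), rext_of_lt _ (by omega), rext_self]
      rfl

/-- The colour of a path determines the edge colours at the new ends of its extensions. -/
lemma det_Xe {n : ℕ} (hn : 2 ≤ n) (hnk : n ≤ k) : Det G col n fun v => Xe G col v n := by
  intro v v' hv hv' h
  simp only [Xe_eq_sum_exts col hn]
  refine sum_exts_eq hc hn hnk hv hv' h _ _ fun q hq q' hq' hqq => ?_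
  have h1 := det_E3 hc (n := n + 1) (by omega) (by omega) _ _ (mem_exts.1 hq) (mem_exts.1 hq') hqq
  simp only [E3_ext hc hn] at h1
  have h2 : E3 col v n = E3 col v' n := det_E3 hc (by omega) (by omega) _ _ hv hv' h
  rw [h2] at h1
  exact add_left_cancel h1

end Sums

/-! ### Closing edges of induced paths -/

section Closing

variable {U C : Type*} {G : SimpleGraph U}

/-- The first `n` terms of `v` are distinct and have no chord, except possibly between the first
and the last one. -/
structure J (G : SimpleGraph U) (v : ℕ → U) (n : ℕ) : Prop where
  inj : ∀ i j, i < j → j < n → v i ≠ v j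
  adj_iff : ∀ i j, i < j → j < n → ¬ (i = 0 ∧ j + 1 = n) → (G.Adj (v i) (v j) ↔ j = i + 1)

/-- The first and the last of the first `n` terms of `v` are adjacent. -/
def Cl (G : SimpleGraph U) (v : ℕ → U) (n : ℕ) : Prop := G.Adj (v 0) (v (n - 1))

/-- The colours of the edges of the closed walk through the first `n` terms of `v`. -/
def cycCol (col : List U → C) (v : ℕ → U) (n : ℕ) : Multiset C :=
  E2 col v n + {ed col (v 0) (v (n - 1))}

lemma J.np {v : ℕ → U} {n : ℕ} (hn : 4 ≤ n) (h : J G v n) : NP G v n where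
  inj := h.inj
  adj i hi := (h.adj_iff i (i + 1) (by omega) hi (by omega)).2 rfl
  nadj i hi h' := by
    have := (h.adj_iff i (i + 2) (by omega) hi (by omega)).1 h'
    omega

lemma J.congr {v v' : ℕ → U} {n : ℕ} (h : J G v n) (hv : ∀ t < n, v t = v' t) : J G v' n where
  inj i j hi hj := by
    rw [← hv i (by omega), ← hv j (by omega)]; exact h.inj i j hi hj
  adj_iff i j hi hj := by
    rw [← hv i (by omega), ← hv j (by omega)]; exact h.adj_iff i j hi hj

lemma J.rv {v : ℕ → U} {n : ℕ} (h : J G v n) : J G (rv v n) n where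
  inj i j hi hj := (h.inj _ _ (by omega) (by omega)).symm
  adj_iff i j hi hj hij := by
    have := h.adj_iff (n - 1 - j) (n - 1 - i) (by omega) (by omega) (by omega)
    simp only [PathWL.rv]
    rw [SimpleGraph.adj_comm, this]
    omega

lemma NP.j_four {v : ℕ → U} (h : NP G v 4) : J G v 4 where
  inj := h.inj
  adj_iff i j hi hj hij := by
    have a0 := h.adj 0 (by omega)
    have a1 := h.adj 1 (by omega)
    have a2 := h.adj 2 (by omega)
    have b0 := h.nadj 0 (by omega)
    have b1 := h.nadj 1 (by omega)
    interval_cases j <;> interval_cases i <;> simp_all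

lemma J.init {v : ℕ → U} {n : ℕ} (h : J G v (n + 1)) : J G v n where
  inj i j hi hj := h.inj i j hi (by omega)
  adj_iff i j hi hj _ := h.adj_iff i j hi (by omega) (by omega)

lemma J.tail {v : ℕ → U} {n : ℕ} (h : J G v (n + 1)) : J G (sh v 1) n where
  inj i j hi hj := h.inj _ _ (by omega) (by omega)
  adj_iff i j hi hj _ := by
    have := h.adj_iff (1 + i) (1 + j) (by omega) (by omega) (by omega)
    simp only [sh]
    rw [this]
    omega

lemma J.not_cl_init {v : ℕ → U} {n : ℕ} (hn : 3 ≤ n) (h : J G v (n + 1)) : ¬ Cl G v n := by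
  intro hc
  have := (h.adj_iff 0 (n - 1) (by omega) (by omega) (by omega)).1 hc
  omega

lemma J.not_cl_tail {v : ℕ → U} {n : ℕ} (hn : 3 ≤ n) (h : J G v (n + 1)) :
    ¬ Cl G (PathWL.sh v 1) n := by
  intro hc
  have := (h.adj_iff 1 (1 + (n - 1)) (by omega) (by omega) (by omega)).1 hc
  omega

lemma J.of_init_tail {v : ℕ → U} {n : ℕ} (hn : 3 ≤ n) (h1 : J G v n)
    (h2 : J G (PathWL.sh v 1) n)
    (c1 : ¬ Cl G v n) (c2 : ¬ Cl G (PathWL.sh v 1) n) (h0 : v 0 ≠ v n) : J G v (n + 1) where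
  inj i j hi hj := by
    by_cases hjn : j < n
    · exact h1.inj i j hi hjn
    by_cases hi0 : i = 0
    · obtain rfl : j = n := by omega
      rwa [hi0]
    · have := h2.inj (i - 1) (j - 1) (by omega) (by omega)
      simp only [PathWL.sh] at this
      rwa [show 1 + (i - 1) = i by omega, show 1 + (j - 1) = j by omega] at this
  adj_iff i j hi hj hij := by
    by_cases hjn : j < n
    · by_cases hs : i = 0 ∧ j + 1 = n
      · obtain ⟨rfl, hs⟩ := hs
        obtain rfl : j = n - 1 := by omega
        exact ⟨fun h => absurd h c1, fun h => by omega⟩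
      · exact h1.adj_iff i j hi hjn hs
    · by_cases hs : i - 1 = 0 ∧ j - 1 + 1 = n
      · refine ⟨fun h => absurd ?_ c2, fun h => by omega⟩
        obtain rfl : i = 1 := by omega
        obtain rfl : j = 1 + (n - 1) := by omega
        exact h
      · have := h2.adj_iff (i - 1) (j - 1) (by omega) (by omega) hs
        simp only [PathWL.sh] at this
        rw [show 1 + (i - 1) = i by omega, show 1 + (j - 1) = j by omega] at this
        rw [this]
        omega

lemma Cl_rv {v : ℕ → U} {n : ℕ} : Cl G (rv v n) n ↔ Cl G v n := by
  simp only [Cl, rv, Nat.sub_self, Nat.sub_zero]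
  exact G.adj_comm _ _

variable [Fintype U] {k : ℕ} {col : List U → C} (hc : IsPathColoring G k col)
include hc

open scoped Classical in
/-- For a path that is induced up to a possible closing edge, the neighbours at its ends are its
extensions and, if there is a closing edge, the two ends themselves. -/
lemma Re_add_Re_of_J {v : ℕ → U} {n : ℕ} (hn : 4 ≤ n) (hv : J G v n) :
    Re G col (v (n - 2)) (v (n - 1)) + Re G col (v 1) (v 0) = Xe G col v n + if Cl G v n then
      {win col v 2 0} + {win col v 2 (n - 2)} +
        ({ed col (v 0) (v (n - 1))} + {ed col (v 0) (v (n - 1))}) else 0 := by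
  have key : ∀ u, J G u n → Re G col (u (n - 2)) (u (n - 1)) = Rx G col u n +
      if Cl G u n then {ed col (u (n - 2)) (u (n - 1))} + {ed col (u (n - 1)) (u 0)} else 0 := by
    intro u hu
    refine Re_eq_Rx col (by omega) (hu.np hn) _ ?_ ?_
    · intro i hi h1 h2 h3
      have h4 : i ≠ n - 1 := fun h => G.loopless.irrefl _ (h ▸ h2)
      by_cases h0 : i = 0
      · exact ⟨(h0 ▸ h2).symm, h0⟩
      · have := (hu.adj_iff i (n - 1) (by omega) (by omega) (by omega)).1 h2.symm
        omega
    · intro h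
      refine ⟨by omega, h.symm, fun h' => ?_⟩
      have := (hu.adj_iff 0 (n - 2) (by omega) (by omega) (by omega)).1 h'.symm
      omega
  have h1 := key v hv
  have h2 := key _ hv.rv
  simp only [Cl_rv] at h2
  simp only [rv, Nat.sub_self, Nat.sub_zero] at h2
  rw [show n - 1 - (n - 2) = 1 by omega] at h2
  rw [h1, h2, Xe]
  simp only [win_two, show n - 2 + 1 = n - 1 by omega, zero_add]
  rw [ed_comm hc (v 1), ed_comm hc (v (n - 1))]
  split_ifs
  · simp only [add_assoc, add_comm, add_left_comm]
  · simp only [add_zero]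

/-- If the words of two equally coloured paths are not exchanged, the colour decides whether
there is a closing edge, and it determines the colours of the cycle. -/
lemma closing_of_not_mixed {v v' : ℕ → U} {n : ℕ} (hn : 4 ≤ n) (hnk : n ≤ k) (hv : J G v n)
    (hv' : J G v' n) (h : col (seg v n) = col (seg v' n)) (hm : ¬ Mixed col v v' n) :
    (Cl G v n ↔ Cl G v' n) ∧ (Cl G v n → cycCol col v n = cycCol col v' n) := by
  have np := hv.np hn
  have np' := hv'.np hn
  have s2 := symAgr_of_not_mixed hc (by omega) np np' h hm (Or.inl rfl) (by omega)
  have s3 := symAgr_of_not_mixed hc (by omega) np np' h hm (Or.inr rfl) (by omega)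
  have t := Re_telescope col (by omega) np
  have t' := Re_telescope col (by omega) np'
  rw [s2.sum_inner_eq hc np np' (det_Xe hc le_rfl (by omega)),
    s3.sum_eq hc (by omega) np np' (det_Xe hc (by omega) (by omega)), ← t'] at t
  have t1 := add_right_cancel t
  have hX : Xe G col v n = Xe G col v' n := det_Xe hc (by omega) hnk _ _ np np' h
  rw [Re_add_Re_of_J hc hn hv, Re_add_Re_of_J hc hn hv', hX] at t1
  have t2 := add_left_cancel t1
  by_cases c : Cl G v n <;> by_cases c' : Cl G v' n
  · refine ⟨iff_of_true c c', fun _ => ?_⟩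
    rw [if_pos c, if_pos c'] at t2
    have hE : E3 col v n = E3 col v' n := det_E3 hc (by omega) (by omega) _ _ np np' h
    have h2 : cycCol col v n + cycCol col v n = cycCol col v' n + cycCol col v' n := by
      unfold cycCol
      rw [add_add_add_comm, add_add_add_comm (E2 col v' n), two_E2 col v (by omega),
        two_E2 col v' (by omega), hE]
      simp only [add_assoc] at t2 ⊢
      rw [t2]
    rw [← two_nsmul, ← two_nsmul] at h2
    exact nsmul_right_injective two_ne_zero h2
  · rw [if_pos c, if_neg c'] at t2
    simpa using congrArg Multiset.card t2
  · rw [if_neg c, if_pos c'] at t2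
    simpa using congrArg Multiset.card t2
  · exact ⟨iff_of_false c c', fun h => absurd h c⟩

open scoped Classical in
/-- If the words of two equally coloured paths are exchanged, then the presence of closing edges
is governed by the number of extensions of the two kinds of windows. -/
lemma closing_of_mixed {v v' : ℕ → U} {n : ℕ} (hn : 4 ≤ n) (hnk : n ≤ k) (hv : J G v n)
    (hv' : J G v' n) (h : col (seg v n) = col (seg v' n)) (hm : Mixed col v v' n) :
    (if Cl G v n then 4 else 0) + (Xe G col (sh v 1) (oddSize n)).card =
      (if Cl G v' n then 4 else 0) + (Xe G col (sh v 0) (oddSize n)).card := by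
  have np := hv.np hn
  have np' := hv'.np hn
  have t := congrArg Multiset.card (Re_telescope col (by omega) np)
  have t' := congrArg Multiset.card (Re_telescope col (by omega) np')
  have hX : Xe G col v n = Xe G col v' n := det_Xe hc (by omega) hnk _ _ np np' h
  rw [Re_add_Re_of_J hc hn hv] at t
  rw [Re_add_Re_of_J hc hn hv', ← hX] at t'
  have d2 := det_Xe hc (n := 2) le_rfl (by omega)
  have d3 := det_Xe hc (n := 3) (by omega) (by omega)
  have hcl : ∀ u : ℕ → U, (if Cl G u n then
      {win col u 2 0} + {win col u 2 (n - 2)} +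
        ({ed col (u 0) (u (n - 1))} + {ed col (u 0) (u (n - 1))}) else 0 : Multiset C).card =
      if Cl G u n then 4 else 0 := by
    intro u
    split_ifs <;> simp
  by_cases he : Even n
  · have ho : oddSize n = 2 := if_pos he
    rw [Mixed, ho] at hm
    have s3 := (symAgr_of_not_even hc (by omega) np np' h (by omega : 1 ≤ 3) (by omega)
      (by rw [Nat.even_sub (by omega)]; simp [he]; decide)).sum_eq hc (by omega) np np' d3
    have s2 := congrArg Multiset.card (hm.sum_inner_eq np np' d2)
    rw [s3] at t
    rw [ho]
    simp only [Multiset.card_add, hcl] at t t' s2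
    omega
  · have ho : oddSize n = 3 := if_neg he
    rw [Mixed, ho] at hm
    have s2 := (symAgr_of_not_even hc (by omega) np np' h (by omega : 1 ≤ 2) (by omega)
      (by rw [Nat.even_sub (by omega)]; simp [he])).sum_inner_eq hc np np' d2
    have s3 := congrArg Multiset.card (hm.sum_eq np np' d3)
    rw [s2] at t
    rw [ho]
    simp only [Multiset.card_add, hcl] at t t' s3
    omega

/-- If the words of two equally coloured paths are exchanged, every extension of the first path on
the right continues its alternating word. -/
lemma Mixed.win_rext {v v' : ℕ → U} {n : ℕ} (hn : 2 ≤ n) (hnk : n ≤ k) (hv : NP G v n)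
    (hv' : NP G v' n) (h : col (seg v n) = col (seg v' n)) (hm : Mixed col v v' n) {w : U}
    (hw : NP G (rext v n w) (n + 1)) :
    win col (rext v n w) (oddSize n) (n + 1 - oddSize n) = win col v (oddSize n) 1 := by
  classical
  obtain ⟨q', hq', hcol⟩ := exists_ext hc hn hnk hv hv' h (q := (true, w)) hw
  have hev := hm.2.1
  have hjn := hm.1
  set j := oddSize n with hj
  have hj1 : 1 ≤ j := by rcases oddSize_cases n with h | h <;> omega
  have hs := symAgr_of_not_even hc (by omega) hw hq' hcol hj1 (by omega) (by
    rw [show n + 1 - j = n - j + 1 by omega, Nat.even_add_one]; simp [hev])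
  have hsum : ∀ f : C → ℕ, ∑ i ∈ Finset.range (n - j + 1), f (win col v j i) +
      f (win col (rext v n w) j (n + 1 - j)) =
      ∑ i ∈ Finset.range (n - j + 1), f (win col v' j i) +
      f (win col (ext v' n q') j (if q'.1 then n + 1 - j else 0)) := by
    intro f
    have h1 := hs.sum_eq hc (by omega) hw hq' (Φ := fun u => f (win col u j 0))
      (fun u u' _ _ hu => by simp only [win_zero, hu])
    simp only [win_sh, add_zero] at h1
    rw [show n + 1 - j + 1 = n - j + 1 + 1 by omega] at h1
    have h2 : ∑ i ∈ Finset.range (n - j + 1 + 1), f (win col (ext v n (true, w)) j i) =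
        ∑ i ∈ Finset.range (n - j + 1), f (win col v j i) +
          f (win col (rext v n w) j (n + 1 - j)) := by
      rw [Finset.sum_range_succ, show n + 1 - j = n - j + 1 by omega]
      refine congrArg₂ (· + ·) (Finset.sum_congr rfl fun i hi => ?_) rfl
      rw [Finset.mem_range] at hi
      exact congrArg f (win_congr (fun t ht => rext_of_lt w ht) (by omega))
    rw [← h2]
    refine h1.trans ?_
    obtain ⟨b, w'⟩ := q'
    cases b
    · rw [Finset.sum_range_succ']
      refine congrArg₂ (· + ·) (Finset.sum_congr rfl fun i hi => ?_) rfl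
      have := win_sh col (lext w' v') 1 i j
      rw [sh_lext] at this
      rw [this, add_comm 1 i]
      rfl
    · rw [Finset.sum_range_succ, if_pos rfl, show n + 1 - j = n - j + 1 by omega]
      refine congrArg₂ (· + ·) (Finset.sum_congr rfl fun i hi => ?_) rfl
      rw [Finset.mem_range] at hi
      exact congrArg f (win_congr (fun t ht => rext_of_lt w' ht) (by omega))
  obtain ⟨-, -, a, b, hab, hl⟩ := hm
  have e1 : win col v j 1 = b := (hl 1 (by omega)).1
  rw [e1]
  obtain ⟨t, ht⟩ := hev
  set c := win col (rext v n w) j (n + 1 - j)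
  set c' := win col (ext v' n q') j (if q'.1 then n + 1 - j else 0)
  -- counting the letters `a` and `b` in the words of the two extensions
  have cnt : ∀ f : C → ℕ, f a + f c = f b + f c' := by
    intro f
    have h1 := hsum f
    have h2 := sum_alt (f a) (f b) t
    have f1 : ∀ x y : C, ∀ i, f (alt x y i) = alt (f x) (f y) i := by
      intro x y i; by_cases hp : Even i <;> simp [alt, hp]
    have s1 : ∑ i ∈ Finset.range (n - j + 1), f (win col v j i) =
        ∑ i ∈ Finset.range (n - j + 1), alt (f a) (f b) i :=
      Finset.sum_congr rfl fun i hi => by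
        rw [(hl i (by rw [Finset.mem_range] at hi; omega)).1, f1]
    have s2 : ∑ i ∈ Finset.range (n - j + 1), f (win col v' j i) =
        ∑ i ∈ Finset.range (n - j + 1), alt (f b) (f a) i :=
      Finset.sum_congr rfl fun i hi => by
        rw [(hl i (by rw [Finset.mem_range] at hi; omega)).2, f1]
    rw [s1, s2, show n - j + 1 = 2 * t + 1 by omega] at h1
    omega
  by_contra hcb
  have := cnt fun x => if x = b then 1 else 0
  simp [hab, hcb] at this
  omega

/-- Exchanged words of the initial parts of two equally coloured paths continue. -/
lemma Mixed.tail {v v' : ℕ → U} {n : ℕ} (hn : 2 ≤ n) (hnk : n ≤ k) (hv : NP G v (n + 1))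
    (hv' : NP G v' (n + 1)) (h : col (seg v n) = col (seg v' n)) (hm : Mixed col v v' n) :
    Mixed col (sh v 1) (sh v' 1) n := by
  have hnp := hv.mono (Nat.le_succ n)
  have hnp' := hv'.mono (Nat.le_succ n)
  have hr : ∀ u : ℕ → U, ∀ t < n + 1, rext u n (u n) t = u t := by
    intro u t ht
    by_cases h : t < n
    · exact rext_of_lt _ h
    · obtain rfl : t = n := by omega
      exact rext_self _ _ _
  have hs : Mixed col v' v n := Sw.symm hm
  have key : ∀ u u' : ℕ → U, NP G u (n + 1) → NP G u' n → Mixed col u u' n →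
      col (seg u n) = col (seg u' n) →
      win col u (oddSize n) (n + 1 - oddSize n) = win col u (oddSize n) 1 := by
    intro u u' hu hu' hm hcol
    have h2 := hm.1
    have h1 := Mixed.win_rext hc hn hnk (hu.mono (Nat.le_succ n)) hu' hcol hm
      (hu.congr fun t ht => (hr u t ht).symm)
    rwa [win_congr (hr u) (by omega)] at h1
  have k1 := key v v' hv hnp' hm h
  have k2 := key v' v hv' hnp hs h.symm
  obtain ⟨h1, h2, a, b, hab, h3⟩ := hm
  have alt_succ : ∀ x y : C, ∀ i, alt x y (i + 1) = alt y x i := by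
    intro x y i
    by_cases hp : Even i <;> simp [alt, hp, Nat.even_add_one]
  refine ⟨h1, h2, b, a, hab.symm, fun i hi => ?_⟩
  rw [win_sh, win_sh, add_comm 1 i]
  by_cases hl : i + 1 + oddSize n ≤ n
  · rw [(h3 _ hl).1, (h3 _ hl).2, alt_succ, alt_succ]
    exact ⟨rfl, rfl⟩
  · obtain rfl : i = n - oddSize n := by omega
    rw [show n - oddSize n + 1 = n + 1 - oddSize n by omega, k1, k2, (h3 1 (by omega)).1,
      (h3 1 (by omega)).2]
    simp [alt, h2]

lemma Mixed.congr_rv {v v' u u' : ℕ → U} {n : ℕ} (h : Mixed col v v' n)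
    (hu : ∀ t < n, u t = PathWL.rv v n t) (hu' : ∀ t < n, u' t = PathWL.rv v' n t) :
    Mixed col u u' n := by
  obtain ⟨h1, h2, a, b, hab, h3⟩ := ((Sw.rv_right hc h).symm.rv_right hc).symm
  refine ⟨h1, h2, a, b, hab, fun i hi => ?_⟩
  rw [win_congr hu hi, win_congr hu' hi]
  exact h3 i hi

lemma Mixed.init {v v' : ℕ → U} {n : ℕ} (hn : 2 ≤ n) (hnk : n ≤ k) (hv : NP G v (n + 1))
    (hv' : NP G v' (n + 1)) (h : col (seg (sh v 1) n) = col (seg (sh v' 1) n))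
    (hm : Mixed col (sh v 1) (sh v' 1) n) : Mixed col v v' n := by
  have hr : ∀ u : ℕ → U, ∀ t < n, rv u (n + 1) t = rv (sh u 1) n t := fun u t ht => by
    simp only [rv, sh]
    congr 1
    omega
  have hr' : ∀ u : ℕ → U, ∀ t < n, u t = rv (sh (rv u (n + 1)) 1) n t := fun u t ht => by
    simp only [rv, sh]
    congr 1
    omega
  refine Mixed.congr_rv hc (Mixed.tail hc hn hnk hv.rv hv'.rv ?_
    (Mixed.congr_rv hc hm (hr v) (hr v'))) (hr' v) (hr' v')
  rw [seg_congr (hr v), seg_congr (hr v'), col_rv hc, col_rv hc, h]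

/-- The colour of a path decides whether it is induced up to a possible closing edge. -/
lemma J.of_col_eq {v v' : ℕ → U} {n : ℕ} (hn : 4 ≤ n) (hnk : n ≤ k) (hv : J G v n)
    (hv' : NP G v' n) (h : col (seg v n) = col (seg v' n)) : J G v' n := by
  classical
  induction n, hn using Nat.le_induction generalizing v v' with
  | base => exact hv'.j_four
  | succ n hn ih =>
    have np := hv.np (by omega)
    -- the case in which the boundary paths correspond in order
    have main : ∀ u, NP G u (n + 1) → col (seg v n) = col (seg u n) →
        col (seg (sh v 1) n) = col (seg (sh u 1) n) → J G u (n + 1) := by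
      intro u hu h1 h2
      have i1 := ih (by omega) hv.init (hu.mono (Nat.le_succ n)) h1
      have i2 := ih (by omega) hv.tail (hu.sh (by omega)) h2
      have c1 := hv.not_cl_init (by omega)
      have c2 := hv.not_cl_tail (by omega)
      -- if the words of one pair are exchanged, so are those of the other, with the letters
      -- interchanged, and the two counts exclude closing edges
      have both : Mixed col v u n → Mixed col (sh v 1) (sh u 1) n → ¬ Cl G u n ∧
          ¬ Cl G (sh u 1) n := by
        intro m1 m2
        have e1 := closing_of_mixed hc hn (by omega) hv.init i1 h1 m1
        have e2 := closing_of_mixed hc hn (by omega) hv.tail i2 h2 m2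
        have hj := m1.1
        obtain ⟨-, -, a, b, -, hl⟩ := m1
        obtain ⟨-, -, a', b', -, hl'⟩ := m2
        have d : Xe G col (sh (sh v 1) 1) (oddSize n) = Xe G col (sh v 0) (oddSize n) := by
          have hd := det_Xe hc (n := oddSize n)
            (by rcases oddSize_cases n with h | h <;> omega) (by omega)
          rw [sh_sh]
          refine hd.win_eq np np (by omega) (by omega) ?_
          have q1 := (hl' 0 (by omega)).2
          have q2 := (hl' 1 (by omega)).1
          have q3 := (hl 1 (by omega)).2
          have q4 := (hl 0 (by omega)).1
          rw [win_sh] at q1 q2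
          rw [q2, q4, show alt a' b' 1 = alt b' a' 0 from rfl, ← q1, q3]
          rfl
        rw [d, sh_sh, if_neg c2] at e2
        rw [if_neg c1] at e1
        simp only [add_zero] at e1 e2
        by_cases d1 : Cl G u n <;> by_cases d2 : Cl G (sh u 1) n <;>
          simp only [d1, d2, if_true, if_false] at e1 e2 <;>
          first | exact ⟨d1, d2⟩ | omega
      refine J.of_init_tail (by omega) i1 i2 ?_ ?_ (hu.inj 0 n (by omega) (by omega))
      all_goals
        by_cases m1 : Mixed col v u n
        · have m2 := m1.tail hc (by omega) (by omega) np hu h1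
          first | exact (both m1 m2).1 | exact (both m1 m2).2
        by_cases m2 : Mixed col (sh v 1) (sh u 1) n
        · exact absurd (m2.init hc (by omega) (by omega) np hu h2) m1
        · have g1 := (closing_of_not_mixed hc hn (by omega) hv.init i1 h1 m1).1
          have g2 := (closing_of_not_mixed hc hn (by omega) hv.tail i2 h2 m2).1
          first | exact fun hh => c1 (g1.2 hh) | exact fun hh => c2 (g2.2 hh)
    have hp := pair_eq hc (j := n) (i := 0) (i' := 0) (by omega) (by omega) np hv' (by omega)
      (by omega) (by rwa [win_zero, win_zero])
    unfold win at hp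
    simp only [sh_zero, zero_add] at hp
    rcases Sym2.eq_iff.1 hp with ⟨p1, p2⟩ | ⟨p1, p2⟩
    · exact main v' hv' p1 p2
    · have r1 : ∀ t < n, PathWL.rv v' (n + 1) t = PathWL.rv (sh v' 1) n t := fun t ht => by
        simp only [PathWL.rv, PathWL.sh]
        congr 1
        omega
      have r2 : ∀ t < n, sh (PathWL.rv v' (n + 1)) 1 t = PathWL.rv v' n t := fun t ht => by
        simp only [PathWL.rv, PathWL.sh]
        congr 1
        omega
      refine (main (PathWL.rv v' (n + 1)) hv'.rv ?_ ?_).rv.congr fun t ht => rv_rv ht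
      · rw [seg_congr r1, col_rv hc]
        exact p1
      · rw [seg_congr r2, col_rv hc]
        exact p2

end Closing

/-! ### Counting the vertices that close a path to an induced cycle -/

section Count

variable {U C : Type*} {G : SimpleGraph U}

/-- The first `n` terms of `v` form an induced path, and the vertex `w` completes it to an induced
cycle. -/
structure Closes (G : SimpleGraph U) (v : ℕ → U) (n : ℕ) (w : U) : Prop where
  inj : ∀ i j, i < j → j < n → v i ≠ v j
  adj_iff : ∀ i j, i < j → j < n → (G.Adj (v i) (v j) ↔ j = i + 1)
  ne : ∀ i < n, v i ≠ w
  adj_new : ∀ i < n, (G.Adj (v i) w ↔ i = 0 ∨ i = n - 1)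

/-- The edge colours of the cycle formed by the first `n` terms of `v` and `w`. -/
def closeCol (col : List U → C) (v : ℕ → U) (n : ℕ) (w : U) : Multiset C :=
  E2 col v n + ({ed col (v (n - 1)) w} + {ed col (v 0) w})

lemma Closes.rv {v : ℕ → U} {n : ℕ} {w : U} (h : Closes G v n w) : Closes G (rv v n) n w where
  inj i j hi hj := (h.inj _ _ (by omega) (by omega)).symm
  adj_iff i j hi hj := by
    have := h.adj_iff (n - 1 - j) (n - 1 - i) (by omega) (by omega)
    simp only [PathWL.rv]
    rw [SimpleGraph.adj_comm, this]
    omega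
  ne i hi := h.ne _ (by omega)
  adj_new i hi := by
    have := h.adj_new (n - 1 - i) (by omega)
    simp only [PathWL.rv]
    rw [this]
    omega

lemma Closes.congr {v v' : ℕ → U} {n : ℕ} {w : U} (h : Closes G v n w)
    (hv : ∀ t < n, v t = v' t) : Closes G v' n w where
  inj i j hi hj := by
    rw [← hv i (by omega), ← hv j (by omega)]; exact h.inj i j hi hj
  adj_iff i j hi hj := by
    rw [← hv i (by omega), ← hv j (by omega)]; exact h.adj_iff i j hi hj
  ne i hi := by
    rw [← hv i (by omega)]; exact h.ne i hi
  adj_new i hi := by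
    rw [← hv i (by omega)]; exact h.adj_new i hi

lemma closes_rv_iff {v : ℕ → U} {n : ℕ} {w : U} : Closes G (rv v n) n w ↔ Closes G v n w :=
  ⟨fun h => h.rv.congr fun _ ht => rv_rv ht, Closes.rv⟩

lemma closes_iff_rext {v : ℕ → U} {n : ℕ} {w : U} (hn : 2 ≤ n) :
    Closes G v n w ↔ J G (rext v n w) (n + 1) ∧ Cl G (rext v n w) (n + 1) := by
  constructor
  · intro h
    refine ⟨⟨fun i j hi hj => ?_, fun i j hi hj hij => ?_⟩, ?_⟩
    · rw [rext_of_lt w (by omega : i < n)]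
      rcases Nat.lt_succ_iff_lt_or_eq.1 hj with hj | rfl
      · rw [rext_of_lt w hj]; exact h.inj i j hi hj
      · rw [rext_self]; exact h.ne i hi
    · rw [rext_of_lt w (by omega : i < n)]
      rcases Nat.lt_succ_iff_lt_or_eq.1 hj with hj | rfl
      · rw [rext_of_lt w hj]; exact h.adj_iff i j hi hj
      · rw [rext_self, h.adj_new i hi]; omega
    · unfold Cl
      rw [rext_of_lt w (by omega), Nat.add_sub_cancel, rext_self]
      exact (h.adj_new 0 (by omega)).2 (Or.inl rfl)
  · rintro ⟨h, hc⟩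
    refine ⟨fun i j hi hj => ?_, fun i j hi hj => ?_, fun i hi => ?_, fun i hi => ?_⟩
    · have := h.inj i j hi (by omega)
      rwa [rext_of_lt w (by omega), rext_of_lt w hj] at this
    · have := h.adj_iff i j hi (by omega) (by omega)
      rwa [rext_of_lt w (by omega), rext_of_lt w hj] at this
    · have := h.inj i n hi (by omega)
      rwa [rext_of_lt w (by omega), rext_self] at this
    · by_cases h0 : i = 0
      · subst h0
        unfold Cl at hc
        rw [rext_of_lt w (by omega), Nat.add_sub_cancel, rext_self] at hc
        exact iff_of_true hc (Or.inl rfl)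
      · have := h.adj_iff i n hi (by omega) (by omega)
        rw [rext_of_lt w (by omega), rext_self] at this
        rw [this]
        omega

lemma closes_iff_ext {v : ℕ → U} {n : ℕ} (hn : 2 ≤ n) (q : Bool × U) :
    Closes G v n q.2 ↔ J G (ext v n q) (n + 1) ∧ Cl G (ext v n q) (n + 1) := by
  obtain ⟨b, w⟩ := q
  cases b
  · change _ ↔ J G (lext w v) (n + 1) ∧ Cl G (lext w v) (n + 1)
    rw [← closes_rv_iff, closes_iff_rext hn, ← Cl_rv (v := lext w v)]
    refine and_congr ⟨fun h => ?_, fun h => h.rv.congr fun t ht => rv_lext w ht⟩ ?_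
    · exact (h.congr fun t ht => (rv_lext w ht).symm).rv.congr fun t ht => rv_rv ht
    · unfold Cl
      rw [rv_lext w (by omega), rv_lext w (by omega)]
  · exact closes_iff_rext hn

lemma Closes.np_ext {v : ℕ → U} {n : ℕ} (hn : 3 ≤ n) {q : Bool × U} (h : Closes G v n q.2) :
    NP G (ext v n q) (n + 1) :=
  ((closes_iff_ext (by omega) q).1 h).1.np (by omega)

variable [Fintype U]

open scoped Classical in
/-- The number of vertices that complete a path to an induced cycle whose edge colours satisfy a
given condition. -/
noncomputable def numClosing (G : SimpleGraph U) (col : List U → C) (v : ℕ → U) (n : ℕ)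
    (Q : Multiset C → Prop) : ℕ :=
  ∑ w, if Closes G v n w ∧ Q (closeCol col v n w) then 1 else 0

open scoped Classical in
lemma sum_exts_closing {v : ℕ → U} {n : ℕ} (hn : 3 ≤ n) (P P' : U → Prop) :
    ∑ q ∈ exts G v n, (if Closes G v n q.2 ∧ (if q.1 then P q.2 else P' q.2) then 1 else 0) =
      (∑ w, if Closes G v n w ∧ P w then 1 else 0) +
        ∑ w, if Closes G v n w ∧ P' w then 1 else 0 := by
  rw [sum_exts]
  have h : ∀ w, Closes G v n w → NP G (rext v n w) (n + 1) ∧ NP G (lext w v) (n + 1) :=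
    fun w hw => ⟨hw.np_ext hn (q := (true, w)), hw.np_ext hn (q := (false, w))⟩
  congr 1
  · refine Finset.sum_congr rfl fun w _ => ?_
    by_cases hw : Closes G v n w
    · simp [hw, h w hw]
    · simp [hw]
  · refine Finset.sum_congr rfl fun w _ => ?_
    by_cases hw : Closes G v n w
    · simp [hw, h w hw]
    · simp [hw]

variable {k : ℕ} {col : List U → C} (hc : IsPathColoring G k col)
include hc

lemma E2_rv (v : ℕ → U) (n : ℕ) : E2 col (rv v n) n = E2 col v n := by
  unfold E2
  rw [← Finset.sum_range_reflect]
  refine Finset.sum_congr rfl fun i hi => ?_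
  rw [Finset.mem_range] at hi
  rw [win_rv hc v (by omega)]
  congr 2
  omega

lemma closeCol_rv (v : ℕ → U) (n : ℕ) (w : U) :
    closeCol col (rv v n) n w = closeCol col v n w := by
  unfold closeCol
  rw [E2_rv hc]
  simp only [rv, Nat.sub_self, Nat.sub_zero]
  rw [add_comm {ed col (v 0) w}]

lemma numClosing_rv (v : ℕ → U) (n : ℕ) (Q : Multiset C → Prop) :
    numClosing G col (rv v n) n Q = numClosing G col v n Q := by
  classical
  refine Finset.sum_congr rfl fun w _ => ?_
  rw [closeCol_rv hc]
  exact if_congr (and_congr_left fun _ => closes_rv_iff) rfl rfl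

lemma cycCol_ext {v : ℕ → U} {n : ℕ} (hn : 1 ≤ n) (q : Bool × U) :
    cycCol col (ext v n q) (n + 1) = closeCol col v n q.2 := by
  obtain ⟨m, rfl⟩ : ∃ m, n = m + 1 := ⟨n - 1, by omega⟩
  obtain ⟨b, w⟩ := q
  cases b
  · change cycCol col (lext w v) (m + 1 + 1) = closeCol col v (m + 1) w
    simp only [cycCol, E2, closeCol, Nat.add_sub_cancel]
    rw [Finset.sum_range_succ', win_two]
    have : ∀ i, win col (lext w v) 2 (i + 1) = win col v 2 i := fun i => by
      rw [win_two, win_two]; rfl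
    simp only [this, lext]
    rw [ed_comm hc w, ed_comm hc w]
    simp only [add_assoc, add_comm]
  · change cycCol col (rext v (m + 1) w) (m + 1 + 1) = closeCol col v (m + 1) w
    simp only [cycCol, E2, closeCol, Nat.add_sub_cancel]
    rw [Finset.sum_range_succ, win_two, rext_of_lt _ (by omega), rext_self,
      rext_of_lt _ (by omega), add_assoc]
    refine congrArg₂ (· + ·) (Finset.sum_congr rfl fun i hi => ?_) rfl
    rw [Finset.mem_range] at hi
    rw [win_congr (fun t ht => rext_of_lt w ht) (by omega)]

/-- Equally coloured extensions whose words are not exchanged agree on closing. -/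
lemma closes_iff_of_not_mixed {v v' : ℕ → U} {n : ℕ} (hn : 3 ≤ n) (hnk : n + 1 ≤ k)
    {q q' : Bool × U} (hq : NP G (ext v n q) (n + 1)) (hq' : NP G (ext v' n q') (n + 1))
    (h : col (seg (ext v n q) (n + 1)) = col (seg (ext v' n q') (n + 1)))
    (hm : ¬ Mixed col (ext v n q) (ext v' n q') (n + 1)) :
    (Closes G v n q.2 ↔ Closes G v' n q'.2) ∧
      (Closes G v n q.2 → closeCol col v n q.2 = closeCol col v' n q'.2) := by
  rw [closes_iff_ext (by omega), closes_iff_ext (by omega), ← cycCol_ext hc (by omega),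
    ← cycCol_ext hc (by omega)]
  by_cases hJ : J G (ext v n q) (n + 1)
  · have hJ' := hJ.of_col_eq hc (by omega) hnk hq' h
    have := closing_of_not_mixed hc (by omega) hnk hJ hJ' h hm
    exact ⟨by simp [hJ, hJ', this.1], fun hh => this.2 hh.2⟩
  · have hJ' : ¬ J G (ext v' n q') (n + 1) := fun hJ' =>
      hJ (hJ'.of_col_eq hc (by omega) hnk hq h.symm)
    exact ⟨by simp [hJ, hJ'], fun hh => absurd hh.1 hJ⟩

open scoped Classical in
/-- A condition on closing extensions that agrees on equally coloured extensions gives the same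
count of closing vertices. -/
lemma sum_closing_eq {v v' : ℕ → U} {n : ℕ} (hn : 3 ≤ n) (hnk : n + 1 ≤ k)
    (hv : NP G v n) (hv' : NP G v' n) (h : col (seg v n) = col (seg v' n)) (P P' S S' : U → Prop)
    (hP : ∀ q q', NP G (ext v n q) (n + 1) → NP G (ext v' n q') (n + 1) →
      col (seg (ext v n q) (n + 1)) = col (seg (ext v' n q') (n + 1)) →
      (Closes G v n q.2 ∧ (if q.1 then P q.2 else P' q.2) ↔
        Closes G v' n q'.2 ∧ (if q'.1 then S q'.2 else S' q'.2))) :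
    (∑ w, if Closes G v n w ∧ P w then 1 else 0) +
        (∑ w, if Closes G v n w ∧ P' w then 1 else 0) =
      (∑ w, if Closes G v' n w ∧ S w then 1 else 0) +
        ∑ w, if Closes G v' n w ∧ S' w then 1 else 0 := by
  rw [← sum_exts_closing hn, ← sum_exts_closing hn]
  exact sum_exts_eq hc (by omega) (by omega) hv hv' h _ _ fun q hq q' hq' hqq =>
    if_congr (hP q q' (mem_exts.1 hq) (mem_exts.1 hq') hqq) rfl rfl

/-- If no words of equally coloured extensions are exchanged, then the closing vertices of two
equally coloured paths can be counted through their extensions, each closing vertex occurring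
twice. -/
lemma numClosing_eq_of_no_mixed {v v' : ℕ → U} {n : ℕ} (hn : 3 ≤ n) (hnk : n + 1 ≤ k)
    (hv : NP G v n) (hv' : NP G v' n) (h : col (seg v n) = col (seg v' n))
    (hno : ∀ q q', NP G (ext v n q) (n + 1) → NP G (ext v' n q') (n + 1) →
      col (seg (ext v n q) (n + 1)) = col (seg (ext v' n q') (n + 1)) →
        ¬ Mixed col (ext v n q) (ext v' n q') (n + 1)) (Q : Multiset C → Prop) :
    numClosing G col v n Q = numClosing G col v' n Q := by
  classical
  have key := sum_closing_eq hc hn hnk hv hv' h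
    (fun w => Q (closeCol col v n w)) (fun w => Q (closeCol col v n w))
    (fun w => Q (closeCol col v' n w)) (fun w => Q (closeCol col v' n w)) (by
    intro q q' hq hq' hqq
    obtain ⟨h1, h2⟩ := closes_iff_of_not_mixed hc hn hnk hq hq' hqq (hno q q' hq hq' hqq)
    simp only [ite_self]
    rw [← h1]
    exact and_congr_right fun hcl => by rw [h2 hcl])
  unfold numClosing
  omega

/-- If the edge words of two equally coloured paths of even length are exchanged, then no vertex
closes the first path. -/
lemma Mixed.not_closes {v v' : ℕ → U} {n : ℕ} (hn : 3 ≤ n) (hnk : n ≤ k) (he : Even n)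
    (hv : NP G v n) (hv' : NP G v' n) (h : col (seg v n) = col (seg v' n))
    (hm : Mixed col v v' n) (w : U) : ¬ Closes G v n w := by
  intro hw
  have hj : oddSize n = 2 := if_pos he
  have hσ := hw.np_ext hn (q := (true, w))
  change NP G (rext v n w) (n + 1) at hσ
  -- an equally coloured right extension of `v'` or of its reverse
  obtain ⟨u, w', hu, hmu, hcol, hucol⟩ : ∃ u w', NP G (rext u n w') (n + 1) ∧ Mixed col v u n ∧
      col (seg (rext v n w) (n + 1)) = col (seg (rext u n w') (n + 1)) ∧
      col (seg v n) = col (seg u n) := by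
    obtain ⟨⟨b, w'⟩, hq', hcol⟩ :=
      exists_ext hc (by omega) hnk hv hv' h (hw.np_ext hn (q := (true, w)))
    cases b
    · refine ⟨rv v' n, w', NP_lext_iff_rv.1 hq', Sw.rv_right hc hm, ?_, ?_⟩
      · refine hcol.trans ?_
        rw [← col_rv hc]
        exact congrArg col (seg_congr fun t ht => rv_lext w' ht)
      · rw [col_rv hc, h]
    · exact ⟨v', w', hq', hm, hcol, h⟩
  set σ := rext v n w with hσd
  set τ := rext u n w' with hτd
  have eσ : ∀ t < n, σ t = v t := fun t ht => rext_of_lt w ht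
  have eτ : ∀ t < n, τ t = u t := fun t ht => rext_of_lt w' ht
  have hc1 : col (seg σ n) = col (seg τ n) := by rw [seg_congr eσ, seg_congr eτ, hucol]
  have hc2 : col (seg (sh σ 1) n) = col (seg (sh τ 1) n) := by
    have := hc.down n σ τ (by omega) hnk hσ hu hcol
    rw [hc1] at this
    exact Sym2.congr_right.1 this
  have hm1 : Mixed col σ τ n := by
    obtain ⟨h1, h2, a, b, hab, h3⟩ := hmu
    refine ⟨h1, h2, a, b, hab, fun i hi => ?_⟩
    rw [win_congr eσ hi, win_congr eτ hi]
    exact h3 i hi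
  have hm2 := Mixed.tail hc (by omega) hnk hσ hu hc1 hm1
  have hn4 : 4 ≤ n := by
    by_contra h'
    obtain rfl : n = 3 := by omega
    exact absurd he (by decide)
  -- the closing edge seen from the path `v 1, …, v (n - 1), w`
  have hext : NP G (rext (sh σ 1) n (v 0)) (n + 1) := by
    refine (NP_rext_iff (by omega)).2 ⟨hσ.sh (by omega), ?_, ?_, ?_⟩
    · simp only [sh, show 1 + (n - 1) = n by omega]
      rw [hσd, rext_self]
      exact ((hw.adj_new 0 (by omega)).2 (Or.inl rfl)).symm
    · simp only [sh, show 1 + (n - 2) = n - 1 by omega]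
      rw [eσ _ (by omega), SimpleGraph.adj_comm, hw.adj_iff 0 (n - 1) (by omega) (by omega)]
      omega
    · intro i hi
      have := hσ.inj 0 (1 + i) (by omega) (by omega)
      rw [eσ 0 (by omega)] at this
      exact this.symm
  have r1 := Mixed.win_rext hc (by omega) hnk (hσ.sh (by omega)) (hu.sh (by omega)) hc2 hm2 hext
  rw [hj, win_two, win_two, show n + 1 - 2 + 1 = n by omega, rext_self,
    rext_of_lt _ (by omega)] at r1
  simp only [sh, show 1 + (n + 1 - 2) = n by omega, Nat.reduceAdd] at r1
  rw [hσd, rext_self, rext_of_lt _ (by omega), rext_of_lt _ (by omega)] at r1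
  -- the closing edge seen from `v`
  have hm3 : Mixed col (rv v n) (rv v' n) n :=
    Mixed.congr_rv hc hm (fun _ _ => rfl) fun _ _ => rfl
  have r2 := Mixed.win_rext hc (by omega) hnk hv.rv hv'.rv (by rw [col_rv hc, col_rv hc, h]) hm3
    (hw.rv.np_ext hn (q := (true, w)))
  rw [hj, win_two, show n + 1 - 2 + 1 = n by omega, rext_self, rext_of_lt _ (by omega),
    win_rv hc v (by omega)] at r2
  simp only [rv, show n - 1 - (n + 1 - 2) = 0 by omega] at r2
  obtain ⟨-, -, a, b, hab, hl⟩ := hm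
  rw [hj] at hl
  rw [(hl (n - 2 - 1) (by omega)).1, ed_comm hc] at r2
  rw [← win_two, (hl 2 (by omega)).1] at r1
  have hodd : ¬ Even (n - 2 - 1) := by
    rw [Nat.even_sub (by omega), Nat.even_sub (by omega)]
    simp [he]
  simp only [alt, hodd, even_two, if_true, if_false] at r1 r2
  exact hab (r1.symm.trans r2)

end Count

section Aligned

variable {U C : Type*} {G : SimpleGraph U}

/-- Two equally coloured paths whose words at the critical window size of their extensions are the
same alternating word, and whose edge words are the same. -/
structure Aligned (G : SimpleGraph U) (col : List U → C) (v v' : ℕ → U) (n : ℕ) (a b : C) :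
    Prop where
  hn : 3 ≤ n
  np : NP G v n
  np' : NP G v' n
  col_eq : col (seg v n) = col (seg v' n)
  ne : a ≠ b
  word : ∀ i, i + oddSize (n + 1) ≤ n → win col v (oddSize (n + 1)) i = alt a b i
  word' : ∀ i, i + oddSize (n + 1) ≤ n → win col v' (oddSize (n + 1)) i = alt a b i
  agr : Agr col v v' n 2

variable {k : ℕ} {col : List U → C} {v v' : ℕ → U} {n : ℕ} {a b : C}

lemma Aligned.symm (h : Aligned G col v v' n a b) : Aligned G col v' v n a b :=
  ⟨h.hn, h.np', h.np, h.col_eq.symm, h.ne, h.word', h.word, fun i hi => (h.agr i hi).symm⟩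

lemma Aligned.size (h : Aligned G col v v' n a b) : oddSize (n + 1) + 1 ≤ n := by
  have := h.hn
  unfold oddSize
  split_ifs with he
  · omega
  · have : n ≠ 3 := by rintro rfl; exact he (by decide)
    omega

lemma Aligned.E2_eq (h : Aligned G col v v' n a b) : E2 col v n = E2 col v' n :=
  Finset.sum_congr rfl fun i hi => by
    rw [Finset.mem_range] at hi
    rw [h.agr i (by omega)]

lemma win_lext_succ (col : List U → C) (w : U) (v : ℕ → U) (j i : ℕ) :
    win col (lext w v) j (i + 1) = win col v j i := by
  have := win_sh col (lext w v) 1 i j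
  rw [sh_lext] at this
  rw [this, add_comm]

/-- Extensions with exchanged words are made at opposite ends, since the given words agree. -/
lemma Aligned.fst_ne_of_mixed (h : Aligned G col v v' n a b) {q q' : Bool × U}
    (hm : Mixed col (ext v n q) (ext v' n q') (n + 1)) : q.1 ≠ q'.1 := by
  obtain ⟨h1, -, x, y, hxy, hl⟩ := hm
  have hs := h.size
  have e0 := h.word 0 (by omega)
  have e0' := h.word' 0 (by omega)
  obtain ⟨c, w⟩ := q
  obtain ⟨c', w'⟩ := q'
  rintro (rfl : c = c')
  cases c
  · obtain ⟨l1, l2⟩ := hl 1 (by omega)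
    change win col (lext w v) _ (0 + 1) = _ at l1
    change win col (lext w' v') _ (0 + 1) = _ at l2
    rw [win_lext_succ, e0] at l1
    rw [win_lext_succ, e0', l1] at l2
    exact hxy.symm l2
  · obtain ⟨l1, l2⟩ := hl 0 (by omega)
    change win col (rext v n w) _ 0 = _ at l1
    change win col (rext v' n w') _ 0 = _ at l2
    rw [win_congr (n := n) (fun t ht => rext_of_lt w ht) (by omega), e0] at l1
    rw [win_congr (n := n) (fun t ht => rext_of_lt w' ht) (by omega), e0', l1] at l2
    exact hxy l2

lemma numClosing_eq_of_total [Fintype U] {χ : Multiset C}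
    (h1 : numClosing G col v n (fun _ => True) = numClosing G col v' n (fun _ => True))
    (h2 : numClosing G col v n (fun χ' => χ' ≠ χ) = numClosing G col v' n (fun χ' => χ' ≠ χ)) :
    numClosing G col v n (fun χ' => χ' = χ) = numClosing G col v' n (fun χ' => χ' = χ) := by
  classical
  have hs : ∀ u : ℕ → U, numClosing G col u n (fun _ => True) =
      numClosing G col u n (fun χ' => χ' = χ) + numClosing G col u n (fun χ' => χ' ≠ χ) := by
    intro u
    rw [numClosing, numClosing, numClosing, ← Finset.sum_add_distrib]
    refine Finset.sum_congr rfl fun w _ => ?_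
    by_cases h1 : Closes G u n w <;> by_cases h2 : closeCol col u n w = χ <;> simp [h1, h2]
  have := hs v
  have := hs v'
  omega

variable [Fintype U] (hc : IsPathColoring G k col)
include hc

/-- Exchanged words force the edge colours to have period two. -/
lemma Mixed.period {v v' : ℕ → U} {n : ℕ} (hn : 4 ≤ n) (hnk : n ≤ k) (hv : NP G v n)
    (hv' : NP G v' n) (hm : Mixed col v v' n) {i : ℕ} (hi : i + 4 ≤ n) :
    win col v 2 (i + 2) = win col v 2 i := by
  rcases oddSize_cases n with ho | ho
  · obtain ⟨-, -, a, b, -, hl⟩ := hm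
    rw [ho] at hl
    rw [(hl _ (by omega)).1, (hl _ (by omega)).1]
    simp [alt, parity_simps]
  · rw [Mixed, ho] at hm
    obtain ⟨α, hα⟩ := hm.pair_eq hc (by omega) (by omega) hv hv'
    have h := (hα i (by omega)).1.trans (hα (i + 1) (by omega)).1.symm
    rw [Sym2.eq_swap] at h
    exact (Sym2.congr_right.1 h).symm

/-- Equally coloured extensions at opposite ends of aligned paths have exchanged words: the
alternating word is shifted by one place in one of them, so that the words of the extensions agree
in neither direction. -/
lemma Aligned.mixed_right_left (h : Aligned G col v v' n a b) (hnk : n ≤ k) {w w' : U}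
    (hq : NP G (rext v n w) (n + 1)) (hq' : NP G (lext w' v') (n + 1))
    (hcol : col (seg (rext v n w) (n + 1)) = col (seg (lext w' v') (n + 1))) :
    Mixed col (rext v n w) (lext w' v') (n + 1) := by
  have hs := h.size
  set j := oddSize (n + 1) with hj
  have hev := even_sub_oddSize (n := n + 1) (by omega)
  rw [← hj] at hev
  have hodd : ¬ Even (n - j) := by
    rw [show n + 1 - j = n - j + 1 by omega, Nat.even_add_one] at hev
    exact hev
  have e : ∀ i, i + j ≤ n → win col (rext v n w) j i = alt a b i := fun i hi => by
    rw [win_congr (n := n) (fun t ht => rext_of_lt w ht) hi, h.word i hi]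
  have e' : ∀ i, i + j ≤ n → win col (lext w' v') j (i + 1) = alt a b i := fun i hi => by
    rw [win_lext_succ, h.word' i hi]
  have hj1 : 1 ≤ j := by rcases oddSize_cases (n + 1) with h | h <;> omega
  refine (symAgr_or_sw hc (by omega) hq hq' hcol hj1 (by omega)).resolve_left ?_
  rintro (hh | hh)
  · have h1 := hh 1 (by omega)
    rw [e 1 (by omega), e' 0 (by omega)] at h1
    exact h.ne h1.symm
  · have h1 := hh 0 (by omega)
    rw [e 0 (by omega), win_rv hc _ (by omega),
      show n + 1 - j - 0 = n - j + 1 by omega, e' _ (by omega)] at h1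
    simp only [alt, hodd, Even.zero, if_true, if_false] at h1
    exact h.ne h1

open scoped Classical in
/-- Whether a right extension of `v` and an equally coloured left extension of `v'` close is
governed by the number of extensions of the windows of `v`. -/
lemma Aligned.closes_right_left (h : Aligned G col v v' n a b) (hnk : n + 1 ≤ k) {w w' : U}
    (hq : NP G (rext v n w) (n + 1)) (hq' : NP G (lext w' v') (n + 1))
    (hcol : col (seg (rext v n w) (n + 1)) = col (seg (lext w' v') (n + 1)))
    (hcl : Closes G v n w ∨ Closes G v' n w') :
    (if Closes G v n w then 4 else 0) + (Xe G col (sh v 1) (oddSize (n + 1))).card =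
      (if Closes G v' n w' then 4 else 0) + (Xe G col (sh v 0) (oddSize (n + 1))).card := by
  have hn := h.hn
  have hs := h.size
  have hm := h.mixed_right_left hc (by omega) hq hq' hcol
  have i1 : Closes G v n w ↔ _ := closes_iff_ext (by omega) (true, w)
  have i2 : Closes G v' n w' ↔ _ := closes_iff_ext (by omega) (false, w')
  have hJ : J G (rext v n w) (n + 1) ∧ J G (lext w' v') (n + 1) := by
    rcases hcl with hcl | hcl
    · have hJ := (i1.1 hcl).1
      exact ⟨hJ, hJ.of_col_eq hc (by omega) hnk hq' hcol⟩
    · have hJ := (i2.1 hcl).1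
      exact ⟨hJ.of_col_eq hc (by omega) hnk hq hcol.symm, hJ⟩
  have e := closing_of_mixed hc (by omega) hnk hJ.1 hJ.2 hcol hm
  have hj : 2 ≤ oddSize (n + 1) := by rcases oddSize_cases (n + 1) with h | h <;> omega
  have hd := det_Xe hc (n := oddSize (n + 1)) hj (by omega)
  have hw : ∀ i, i + oddSize (n + 1) ≤ n → Xe G col (sh (rext v n w) i) (oddSize (n + 1)) =
      Xe G col (sh v i) (oddSize (n + 1)) := fun i hi =>
    hd.win_eq hq h.np (by omega) hi (win_congr (n := n) (fun t ht => rext_of_lt w ht) hi)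
  rw [hw 1 (by omega), hw 0 (by omega)] at e
  have c1 : Closes G v n w ↔ Cl G (rext v n w) (n + 1) := i1.trans (and_iff_right hJ.1)
  have c2 : Closes G v' n w' ↔ Cl G (lext w' v') (n + 1) := i2.trans (and_iff_right hJ.2)
  simp only [c1, c2]
  exact e

lemma Aligned.Xe_eq (h : Aligned G col v v' n a b) (hnk : n + 1 ≤ k) {i : ℕ} (hi : i ≤ 1) :
    Xe G col (sh v' i) (oddSize (n + 1)) = Xe G col (sh v i) (oddSize (n + 1)) := by
  have hs := h.size
  have hj : 2 ≤ oddSize (n + 1) := by rcases oddSize_cases (n + 1) with h | h <;> omega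
  refine (det_Xe hc (n := oddSize (n + 1)) hj (by omega)).win_eq h.np' h.np (by omega) (by omega) ?_
  rw [h.word i (by omega), h.word' i (by omega)]

/-- The number of closing vertices of aligned paths agrees. If the two kinds of windows have
different numbers of extensions, then only the closing extensions at one end are counted: at this
end an extension with exchanged words does not close. -/
lemma Aligned.numClosing_eq (h : Aligned G col v v' n a b) (hnk : n + 1 ≤ k) :
    numClosing G col v n (fun _ => True) = numClosing G col v' n (fun _ => True) := by
  classical
  set α := (Xe G col (sh v 0) (oddSize (n + 1))).card with hα
  set β := (Xe G col (sh v 1) (oddSize (n + 1))).card with hβ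
  have hn := h.hn
  have key := sum_closing_eq hc hn hnk h.np h.np' h.col_eq
    (fun _ => α ≤ β) (fun _ => β ≤ α) (fun _ => α ≤ β) (fun _ => β ≤ α) (by
    rintro ⟨c, w⟩ ⟨c', w'⟩ hq hq' hqq
    by_cases hcc : c = c'
    · subst hcc
      have := (closes_iff_of_not_mixed hc hn hnk hq hq' hqq
        fun hm => h.fst_ne_of_mixed hm rfl).1
      exact and_congr this Iff.rfl
    · cases c <;> cases c'
      · exact absurd rfl hcc
      · have e := h.symm.closes_right_left hc hnk hq' hq hqq.symm
        rw [h.Xe_eq hc hnk zero_le_one, h.Xe_eq hc hnk le_rfl, ← hα, ← hβ] at e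
        simp only [Bool.false_eq_true, if_false, if_true]
        by_cases h1 : Closes G v n w <;> by_cases h2 : Closes G v' n w' <;>
          simp only [h1, h2, or_true, or_false, if_true, if_false, true_and, false_and,
            true_implies, iff_false, false_iff] at e ⊢ <;> omega
      · have e := h.closes_right_left hc hnk hq hq' hqq
        rw [← hα, ← hβ] at e
        simp only [Bool.false_eq_true, if_false, if_true]
        by_cases h1 : Closes G v n w <;> by_cases h2 : Closes G v' n w' <;>
          simp only [h1, h2, or_true, or_false, if_true, if_false, true_and, false_and,
            true_implies, iff_false, false_iff] at e ⊢ <;> omega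
      · exact absurd rfl hcc)
  have hs : ∀ (u : ℕ → U) (p : Prop), (∑ w, if Closes G u n w ∧ p then 1 else 0) =
      if p then numClosing G col u n (fun _ => True) else 0 := by
    intro u p
    by_cases hp : p <;> simp [numClosing, hp]
  simp only [hs] at key
  rcases lt_trichotomy α β with hl | hl | hl
  · simpa [hl.le, hl.not_ge] using key
  · simp only [hl, le_refl, if_true] at key
    omega
  · simpa [hl.le, hl.not_ge] using key

/-- The number of closing vertices of aligned paths with a given condition on the edge colours of
the cycle agrees, provided that the condition excludes the only edge colours for which an
extension with exchanged words can be counted. -/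
lemma Aligned.numClosing_eq_of_not (h : Aligned G col v v' n a b) (hnk : n + 1 ≤ k)
    (Q : Multiset C → Prop)
    (hQ : ¬ Q (E2 col v n + ({win col v 2 (n - 3)} + {win col v 2 1}))) :
    numClosing G col v n Q = numClosing G col v' n Q := by
  classical
  have hn := h.hn
  set r := win col v 2 (n - 3) with hr
  have hr' : win col v' 2 (n - 3) = r := (h.agr _ (by omega)).symm
  have hl' : win col v' 2 1 = win col v 2 1 := (h.agr _ (by omega)).symm
  -- colours of the new edge in an extension with exchanged words
  have right : ∀ u w τ, NP G (rext u n w) (n + 1) → NP G τ (n + 1) →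
      Mixed col (rext u n w) τ (n + 1) → ed col (u (n - 1)) w = win col u 2 (n - 3) := by
    intro u w τ hq hτ hm
    have := Mixed.period hc (by omega) hnk hq hτ hm (i := n - 3) (by omega)
    rw [show n - 3 + 2 = n - 1 by omega, win_two, rext_of_lt _ (by omega),
      show n - 1 + 1 = n by omega, rext_self,
      win_congr (n := n) (fun t ht => rext_of_lt w ht) (by omega)] at this
    exact this
  have left : ∀ u w τ, NP G (lext w u) (n + 1) → NP G τ (n + 1) →
      Mixed col (lext w u) τ (n + 1) → ed col (u 0) w = win col u 2 1 := by
    intro u w τ hq hτ hm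
    have := Mixed.period hc (by omega) hnk hq hτ hm (i := 0) (by omega)
    rw [zero_add, win_lext_succ, win_two (i := 0)] at this
    rw [this, ed_comm hc]
    rfl
  -- closing extensions with exchanged words are not counted
  have vanish : ∀ u u', Aligned G col u u' n a b → win col u 2 (n - 3) = r →
      ¬ Q (E2 col u n + ({r} + {win col u 2 1})) →
      ∀ q q', NP G (ext u n q) (n + 1) → NP G (ext u' n q') (n + 1) →
      Mixed col (ext u n q) (ext u' n q') (n + 1) →
      ¬ (Closes G u n q.2 ∧ if q.1 then Q (closeCol col u n q.2) ∧ ed col (u (n - 1)) q.2 ≠ r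
        else Q (closeCol col u n q.2) ∧ ed col (u (n - 1)) q.2 = r) := by
    rintro u u' hu hur hQu ⟨c, w⟩ q' hq hq' hm ⟨-, h2⟩
    cases c
    · simp only [Bool.false_eq_true, if_false] at h2
      refine hQu ?_
      have := left u w _ hq hq' hm
      rw [closeCol, this, h2.2] at h2
      exact h2.1
    · simp only [if_true] at h2
      exact h2.2 ((right u w _ hq hq' hm).trans hur)
  have key := sum_closing_eq hc hn hnk h.np h.np' h.col_eq
    (fun w => Q (closeCol col v n w) ∧ ed col (v (n - 1)) w ≠ r)
    (fun w => Q (closeCol col v n w) ∧ ed col (v (n - 1)) w = r)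
    (fun w => Q (closeCol col v' n w) ∧ ed col (v' (n - 1)) w ≠ r)
    (fun w => Q (closeCol col v' n w) ∧ ed col (v' (n - 1)) w = r) (by
    intro q q' hq hq' hqq
    by_cases hm : Mixed col (ext v n q) (ext v' n q') (n + 1)
    · exact iff_of_false (vanish v v' h rfl hQ q q' hq hq' hm)
        (vanish v' v h.symm hr' (by rw [← h.E2_eq, hl']; exact hQ) q' q hq' hq (Sw.symm hm))
    · obtain ⟨h1, h2⟩ := closes_iff_of_not_mixed hc hn hnk hq hq' hqq hm
      rw [← h1]
      refine and_congr_right fun hcl => ?_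
      have h2 := h2 hcl
      have hE := det_E3 hc (n := n + 1) (by omega) (by omega) _ _ hq hq' hqq
      have hE' : E3 col v n = E3 col v' n :=
        det_E3 hc (by omega) (by omega) _ _ h.np h.np' h.col_eq
      simp only [E3_ext hc (by omega : 2 ≤ n), hE'] at hE
      have hE := add_left_cancel hE
      have a0 := h.agr 0 (by omega)
      have a1 := h.agr (n - 2) (by omega)
      rw [win_two, win_two] at a0 a1
      simp only [show n - 2 + 1 = n - 1 by omega, zero_add] at a0 a1
      obtain ⟨c, w⟩ := q
      obtain ⟨c', w'⟩ := q'
      have hcc : c = c' := by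
        by_contra hcc
        cases c <;> cases c'
        · exact hcc rfl
        · exact hm (h.symm.mixed_right_left hc (by omega) hq' hq hqq.symm).symm
        · exact hm (h.mixed_right_left hc (by omega) hq hq' hqq)
        · exact hcc rfl
      subst hcc
      have hR : ed col (v (n - 1)) w = ed col (v' (n - 1)) w' := by
        cases c
        · simp only [Bool.false_eq_true, if_false] at hE
          rw [ed_comm hc (v 1), ed_comm hc (v' 1), a0] at hE
          have hL := add_left_cancel hE
          simp only [closeCol, h.E2_eq, hL] at h2
          exact Multiset.singleton_inj.1 (add_right_cancel (add_left_cancel h2))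
        · simp only [if_true] at hE
          rw [a1] at hE
          exact Multiset.singleton_inj.1 (add_left_cancel hE)
      simp only [] at h2
      simp only [h2, hR])
  have hs : ∀ (u : ℕ → U), numClosing G col u n Q =
      (∑ w, if Closes G u n w ∧ Q (closeCol col u n w) ∧ ed col (u (n - 1)) w ≠ r then 1 else 0) +
      (∑ w, if Closes G u n w ∧ Q (closeCol col u n w) ∧ ed col (u (n - 1)) w = r then 1 else 0)
      := by
    intro u
    rw [numClosing, ← Finset.sum_add_distrib]
    refine Finset.sum_congr rfl fun w _ => ?_
    by_cases h1 : Closes G u n w <;> by_cases h2 : Q (closeCol col u n w) <;>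
      by_cases h3 : ed col (u (n - 1)) w = r <;> simp [h1, h2, h3]
  rw [hs, hs]
  convert key

lemma Aligned.numClosing_eq_col (h : Aligned G col v v' n a b) (hnk : n + 1 ≤ k)
    (χ : Multiset C) :
    numClosing G col v n (fun χ' => χ' = χ) = numClosing G col v' n (fun χ' => χ' = χ) := by
  by_cases hχ : χ = E2 col v n + ({win col v 2 (n - 3)} + {win col v 2 1})
  · exact numClosing_eq_of_total (h.numClosing_eq hc hnk)
      (h.numClosing_eq_of_not hc hnk _ fun h' => h' hχ.symm)
  · exact h.numClosing_eq_of_not hc hnk _ fun h' => hχ h'.symm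

end Aligned

section Align

variable {U C : Type*} {G : SimpleGraph U} [Fintype U] {k : ℕ} {col : List U → C}
  (hc : IsPathColoring G k col)
include hc

/-- A path with an extension that spells an alternating word of odd length, read in the direction
in which its own word starts with the first of two given letters, and its edge colours have period
two if those of the extension have. -/
lemma exists_reading {v : ℕ → U} {n j : ℕ} (hjn : j + 1 ≤ n)
    {q : Bool × U} {a b x y : C} (hev : Even (n + 1 - j))
    (hab : a = x ∧ b = y ∨ a = y ∧ b = x)
    (hq : ∀ i, i + j ≤ n + 1 → win col (ext v n q) j i = alt x y i)
    (hp : ∀ i, i + 4 ≤ n + 1 → win col (ext v n q) 2 (i + 2) = win col (ext v n q) 2 i) :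
    ∃ u, (u = v ∨ u = rv v n) ∧ (∀ i, i + j ≤ n → win col u j i = alt a b i) ∧
      ∀ i, i + 4 ≤ n → win col u 2 (i + 2) = win col u 2 i := by
  have alt_succ : ∀ x y : C, ∀ i, alt x y (i + 1) = alt y x i := by
    intro x y i
    by_cases hp : Even i <;> simp [alt, hp, Nat.even_add_one]
  have hw : (∀ i, i + j ≤ n → win col v j i = alt a b i) ∨
      ∀ i, i + j ≤ n → win col v j i = alt b a i := by
    obtain ⟨c, w⟩ := q
    have : ∃ x' y', (a = x' ∧ b = y' ∨ a = y' ∧ b = x') ∧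
        ∀ i, i + j ≤ n → win col v j i = alt x' y' i := by
      cases c
      · refine ⟨y, x, hab.symm, fun i hi => ?_⟩
        rw [← win_lext_succ col w]
        exact (hq (i + 1) (by omega)).trans (alt_succ _ _ _)
      · refine ⟨x, y, hab, fun i hi => ?_⟩
        rw [← win_congr (n := n) (fun t ht => rext_of_lt w ht) hi]
        exact hq i (by omega)
    obtain ⟨x', y', ⟨rfl, rfl⟩ | ⟨rfl, rfl⟩, h⟩ := this
    · exact Or.inl h
    · exact Or.inr h
  have hper : ∀ i, i + 4 ≤ n → win col v 2 (i + 2) = win col v 2 i := by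
    obtain ⟨c, w⟩ := q
    intro i hi
    cases c
    · have := hp (i + 1) (by omega)
      change win col (lext w v) 2 (i + 2 + 1) = win col (lext w v) 2 (i + 1) at this
      rwa [win_lext_succ, win_lext_succ] at this
    · have := hp i (by omega)
      change win col (rext v n w) 2 (i + 2) = win col (rext v n w) 2 i at this
      rwa [win_congr (n := n) (fun t ht => rext_of_lt w ht) (by omega),
        win_congr (n := n) (fun t ht => rext_of_lt w ht) (by omega)] at this
  rcases hw with hw | hw
  · exact ⟨v, Or.inl rfl, hw, hper⟩
  · refine ⟨rv v n, Or.inr rfl, fun i hi => ?_, fun i hi => ?_⟩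
    · rw [win_rv hc v hi, hw _ (by omega)]
      have : Even (n - j - i) ↔ ¬ Even i := by
        rw [show n + 1 - j = n - j + 1 by omega, Nat.even_add_one] at hev
        rw [Nat.even_sub (by omega)]
        simp [hev]
      by_cases hi : Even i <;> simp [alt, this, hi]
    · rw [win_rv hc v (by omega), win_rv hc v (by omega), ← hper (n - 2 - (i + 2)) (by omega)]
      congr 1
      omega

/-- The colour of a path with `n ≥ 3` vertices determines, for each multiset of edge colours, the
number of vertices that complete the path to an induced cycle with these edge colours. -/
lemma numClosing_eq {v v' : ℕ → U} {n : ℕ} (hn : 3 ≤ n) (hnk : n + 1 ≤ k) (hv : NP G v n)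
    (hv' : NP G v' n) (h : col (seg v n) = col (seg v' n)) (χ : Multiset C) :
    numClosing G col v n (fun χ' => χ' = χ) = numClosing G col v' n (fun χ' => χ' = χ) := by
  classical
  by_cases hm : Even n ∧ Mixed col v v' n
  · have h1 := hm.2.not_closes hc hn (by omega) hm.1 hv hv' h
    have h2 := Mixed.not_closes hc hn (by omega) hm.1 hv' hv h.symm (Sw.symm hm.2)
    simp [numClosing, h1, h2]
  by_cases hno : ∀ q q', NP G (ext v n q) (n + 1) → NP G (ext v' n q') (n + 1) →
      col (seg (ext v n q) (n + 1)) = col (seg (ext v' n q') (n + 1)) →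
        ¬ Mixed col (ext v n q) (ext v' n q') (n + 1)
  · exact numClosing_eq_of_no_mixed hc hn hnk hv hv' h hno _
  push Not at hno
  obtain ⟨q, q', hq, hq', hqq, hmix⟩ := hno
  have hp := fun i => Mixed.period hc (by omega) hnk hq hq' hmix (i := i)
  have hp' := fun i => Mixed.period hc (by omega) hnk hq' hq (Sw.symm hmix) (i := i)
  obtain ⟨h1, h2, a, b, hab, h3⟩ := hmix
  obtain ⟨u, hu, huw, -⟩ := exists_reading hc (by omega) h2 (Or.inl ⟨rfl, rfl⟩)
    (fun i hi => (h3 i hi).1) hp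
  obtain ⟨u', hu', huw', hup'⟩ := exists_reading hc (by omega) h2 (Or.inr ⟨rfl, rfl⟩)
    (fun i hi => (h3 i hi).2) hp'
  have hnc : numClosing G col u n (fun χ' => χ' = χ) = numClosing G col v n (fun χ' => χ' = χ) := by
    rcases hu with rfl | rfl
    · rfl
    · exact numClosing_rv hc v n _
  have hnc' : numClosing G col u' n (fun χ' => χ' = χ) =
      numClosing G col v' n (fun χ' => χ' = χ) := by
    rcases hu' with rfl | rfl
    · rfl
    · exact numClosing_rv hc v' n _
  have unp : NP G u n := by rcases hu with rfl | rfl; exacts [hv, hv.rv]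
  have unp' : NP G u' n := by rcases hu' with rfl | rfl; exacts [hv', hv'.rv]
  have huc : col (seg u n) = col (seg u' n) := by
    have e : col (seg u n) = col (seg v n) := by
      rcases hu with rfl | rfl
      exacts [rfl, col_rv hc v n]
    have e' : col (seg u' n) = col (seg v' n) := by
      rcases hu' with rfl | rfl
      exacts [rfl, col_rv hc v' n]
    rw [e, e', h]
  have hagr : Agr col u u' n 2 := by
    by_cases he : Even n
    · have hs : SymAgr col u u' n 2 := by
        refine (symAgr_or_sw hc (by omega) unp unp' huc (by omega) (by omega)).resolve_right
          fun hsw => hm ⟨he, ?_⟩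
        have ho : oddSize n = 2 := if_pos he
        rw [Mixed, ho]
        have t1 : Sw col u v' n 2 := by
          rcases hu' with rfl | rfl
          · exact hsw
          · obtain ⟨s1, s2, a, b, hab, s3⟩ := hsw.rv_right hc
            exact ⟨s1, s2, a, b, hab, fun i hi => by rw [← win_rv_rv col v' hi]; exact s3 i hi⟩
        rcases hu with rfl | rfl
        · exact t1
        · obtain ⟨s1, s2, a, b, hab, s3⟩ := (t1.symm.rv_right hc).symm
          exact ⟨s1, s2, a, b, hab, fun i hi => by rw [← win_rv_rv col v hi]; exact s3 i hi⟩
      -- an edge word of odd length with period two is a palindrome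
      have hpal : ∀ i, i + 2 ≤ n → win col u' 2 i = if Even i then win col u' 2 0
          else win col u' 2 1 := by
        intro i
        induction i using Nat.twoStepInduction with
        | zero => simp
        | one => simp
        | more i ih _ =>
          intro hi
          rw [hup' i (by omega), ih (by omega)]
          simp [parity_simps]
      rcases hs with hs | hs
      · exact hs
      · intro i hi
        rw [hs i hi, win_rv hc u' hi, hpal i hi, hpal _ (by omega)]
        have : Even (n - 2 - i) ↔ Even i := by
          rw [Nat.even_sub (by omega), Nat.even_sub (by omega)]
          simp [he]
        simp [this]
    · have ho : oddSize (n + 1) = 2 := if_pos (by simpa [Nat.even_add_one] using he)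
      rw [ho] at huw huw'
      intro i hi
      rw [huw i hi, huw' i hi]
  have ha : Aligned G col u u' n a b := ⟨hn, unp, unp', huc, hab, huw, huw', hagr⟩
  rw [← hnc, ← hnc']
  exact ha.numClosing_eq_col hc hnk χ

end Align

/-! ### Induced cycles through a path -/

section Cycles

variable {U C : Type*} {G : SimpleGraph U}

open scoped Classical in
/-- The set of the first `n` terms of `v`. -/
noncomputable def verts (v : ℕ → U) (n : ℕ) : Finset U := (Finset.range n).image v

lemma mem_verts {v : ℕ → U} {n : ℕ} {x : U} : x ∈ verts v n ↔ ∃ i < n, v i = x := by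
  simp [verts]

/-- An induced path whose ends are adjacent runs through an induced cycle. -/
lemma J.isInducedCycle {u : ℕ → U} {m : ℕ} (hm : 3 ≤ m) (h : J G u m) (hc : Cl G u m) :
    (verts u m).card = m ∧ IsInducedCycle G (verts u m) := by
  classical
  have hinj : ∀ i j, i < m → j < m → u i = u j → i = j := by
    intro i j hi hj hij
    rcases lt_trichotomy i j with hl | hl | hl
    · exact absurd hij (h.inj i j hl hj)
    · exact hl
    · exact absurd hij.symm (h.inj j i hl hi)
  have hcard : (verts u m).card = m := by
    unfold verts
    rw [Finset.card_image_of_injOn, Finset.card_range]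
    intro i hi j hj hij
    exact hinj i j (by simpa using hi) (by simpa using hj) hij
  refine ⟨hcard, by omega, ?_⟩
  rw [hcard]
  have hadj : ∀ i j, i < j → j < m → (G.Adj (u i) (u j) ↔ j = i + 1 ∨ i = 0 ∧ j + 1 = m) := by
    intro i j hi hj
    by_cases hs : i = 0 ∧ j + 1 = m
    · refine iff_of_true ?_ (Or.inr hs)
      obtain ⟨rfl, hs⟩ := hs
      obtain rfl : j = m - 1 := by omega
      exact hc
    · rw [h.adj_iff i j hi hj hs]
      simp [hs]
  let f : Fin m → (verts u m : Set U) := fun i => ⟨u i, mem_verts.2 ⟨i, i.2, rfl⟩⟩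
  have hf : Function.Bijective f := by
    constructor
    · intro i j hij
      exact Fin.ext (hinj _ _ i.2 j.2 (congrArg Subtype.val hij))
    · rintro ⟨x, hx⟩
      obtain ⟨i, hi, rfl⟩ := mem_verts.1 hx
      exact ⟨⟨i, hi⟩, rfl⟩
  have key : ∀ i j : Fin m, i < j → (G.Adj (u i) (u j) ↔
      (i - j).val = 1 ∨ (j - i).val = 1) := by
    intro i j hij
    rw [hadj i j hij j.2, Fin.coe_sub_iff_lt.2 hij, Fin.sub_val_of_le hij.le]
    have := j.2
    have : (i : ℕ) < j := hij
    omega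
  refine ⟨⟨Equiv.ofBijective f hf, ?_⟩⟩
  intro i j
  change G.Adj (u i) (u j) ↔ _
  rw [SimpleGraph.cycleGraph_adj']
  rcases lt_trichotomy i j with hl | rfl | hl
  · exact key i j hl
  · have : NeZero m := ⟨by omega⟩
    simp
  · rw [SimpleGraph.adj_comm, key j i hl, or_comm]

/-- The vertices of an induced cycle in cyclic order. -/
lemma IsInducedCycle.exists_zmod {s : Finset U} (hs : IsInducedCycle G s) {m : ℕ}
    (hm : s.card = m) : ∃ e : ZMod m → U, Function.Injective e ∧ (∀ x, x ∈ s ↔ ∃ i, e i = x) ∧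
      ∀ i j, G.Adj (e i) (e j) ↔ i - j = 1 ∨ j - i = 1 := by
  obtain ⟨h3, ⟨φ⟩⟩ := hs
  rw [hm] at h3 φ
  obtain ⟨m, rfl⟩ : ∃ m', m = m' + 2 := ⟨m - 2, by omega⟩
  refine ⟨fun i => (φ (show Fin (m + 2) from i) : U), ?_, ?_, ?_⟩
  · intro i j hij
    exact φ.injective (Subtype.ext hij)
  · intro x
    constructor
    · intro hx
      exact ⟨φ.symm ⟨x, hx⟩, by simp⟩
    · rintro ⟨i, rfl⟩
      exact (φ i).2
  · intro i j
    have : G.Adj (φ (show Fin (m + 2) from i) : U) (φ (show Fin (m + 2) from j) : U) ↔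
        (SimpleGraph.cycleGraph (m + 2)).Adj (show Fin (m + 2) from i)
          (show Fin (m + 2) from j) := φ.map_adj_iff
    rw [this, SimpleGraph.cycleGraph_adj]
    rfl

/-- A path without short chords inside an induced cycle follows the cycle. -/
lemma IsInducedCycle.exists_reading {s : Finset U} (hs : IsInducedCycle G s) {v : ℕ → U} {n : ℕ}
    (hn : 2 ≤ n) (hv : NP G v n) (hvs : ∀ t < n, v t ∈ s) :
    ∃ y : ℕ → U, J G y s.card ∧ Cl G y s.card ∧ s = verts y s.card ∧ ∀ t < n, v t = y t := by
  have h3 := hs.1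
  obtain ⟨m, hm⟩ : ∃ m, s.card = m := ⟨_, rfl⟩
  obtain ⟨e, he, hes, hadj⟩ := hs.exists_zmod hm
  rw [hm] at h3 ⊢
  obtain ⟨i0, h0⟩ := (hes _).1 (hvs 0 (by omega))
  obtain ⟨i1, h1⟩ := (hes _).1 (hvs 1 (by omega))
  have h01 := hv.adj 0 (by omega)
  rw [← h0, zero_add, ← h1, hadj] at h01
  obtain ⟨ε, hε, hi1⟩ : ∃ ε : ZMod m, (ε = 1 ∨ ε = -1) ∧ i1 = i0 + ε := by
    rcases h01 with h | h
    · exact ⟨-1, Or.inr rfl, by rw [← h]; ring⟩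
    · exact ⟨1, Or.inl rfl, by rw [← h]; ring⟩
  have hstep : ∀ t, t + 1 < n → v t = e (i0 + ε * t) ∧ v (t + 1) = e (i0 + ε * (t + 1 : ℕ)) := by
    intro t
    induction t with
    | zero => intro _; simp [h0, h1, ← hi1]
    | succ t ih =>
      intro ht
      obtain ⟨e1, e2⟩ := ih (by omega)
      refine ⟨e2, ?_⟩
      obtain ⟨j, hj⟩ := (hes _).1 (hvs (t + 1 + 1) ht)
      have a := hv.adj (t + 1) ht
      have b := hv.inj t (t + 2) (by omega) ht
      rw [← hj, e2, hadj] at a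
      change v t ≠ v (t + 1 + 1) at b
      rw [← hj, e1] at b
      rw [← hj]
      congr 1
      have b' : j ≠ i0 + ε * t := fun h => b (by rw [h])
      push_cast at a ⊢
      rcases hε with rfl | rfl <;> rcases a with a | a
      · exact absurd (by linear_combination -a) b'
      · linear_combination a
      · linear_combination -a
      · exact absurd (by linear_combination a) b'
  have hm1 : NeZero m := ⟨by omega⟩
  have hcast : ∀ a b : ℕ, a < m → b < m → ((a : ZMod m) = b ↔ a = b) := by
    intro a b ha hb
    rw [ZMod.natCast_eq_natCast_iff', Nat.mod_eq_of_lt ha, Nat.mod_eq_of_lt hb]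
  have hεε : ε * ε = 1 := by rcases hε with rfl | rfl <;> ring
  have hcancel : ∀ a b : ZMod m, i0 + ε * a = i0 + ε * b ↔ a = b := by
    intro a b
    constructor
    · intro h
      have := add_left_cancel h
      calc a = ε * (ε * a) := by rw [← mul_assoc, hεε, one_mul]
        _ = b := by rw [this, ← mul_assoc, hεε, one_mul]
    · rintro rfl; rfl
  have hadj' : ∀ a b : ℕ, a < b → b < m → (G.Adj (e (i0 + ε * a)) (e (i0 + ε * b)) ↔
      b = a + 1 ∨ a = 0 ∧ b + 1 = m) := by
    intro a b hab hb
    have e1 : ((b : ZMod m) = ((a + 1 : ℕ) : ZMod m)) ↔ b = a + 1 := hcast _ _ hb (by omega)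
    have e2 : ((a : ZMod m) = ((b + 1 : ℕ) : ZMod m)) ↔ a = 0 ∧ b + 1 = m := by
      by_cases hbm : b + 1 = m
      · rw [hbm, ZMod.natCast_self, ← Nat.cast_zero, hcast a 0 (by omega) (by omega)]
        simp
      · rw [hcast _ _ (by omega) (by omega)]
        omega
    rw [hadj, ← e1, ← e2]
    push_cast
    rcases hε with rfl | rfl
    · rw [or_comm]
      refine or_congr ⟨fun h => ?_, fun h => ?_⟩ ⟨fun h => ?_, fun h => ?_⟩
      all_goals linear_combination h
    · refine or_congr ⟨fun h => ?_, fun h => ?_⟩ ⟨fun h => ?_, fun h => ?_⟩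
      all_goals linear_combination h
  refine ⟨fun t => e (i0 + ε * t), ⟨fun a b hab hb h => ?_, fun a b hab hb hs' => ?_⟩, ?_, ?_, ?_⟩
  · have := (hcast a b (by omega) hb).1 ((hcancel _ _).1 (he h))
    omega
  · rw [hadj' a b hab hb]
    simp [hs']
  · exact (hadj' 0 (m - 1) (by omega) (by omega)).2 (Or.inr ⟨rfl, by omega⟩)
  · ext x
    rw [hes, mem_verts]
    constructor
    · rintro ⟨i, rfl⟩
      refine ⟨(ε * (i - i0)).val, ZMod.val_lt _, ?_⟩
      rw [ZMod.natCast_val, ZMod.cast_id, ← mul_assoc, hεε]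
      congr 1
      ring
    · rintro ⟨i, -, rfl⟩
      exact ⟨_, rfl⟩
  · intro t ht
    rcases Nat.lt_or_ge (t + 1) n with h | h
    · exact (hstep t h).1
    · obtain ⟨t', rfl⟩ : ∃ t', t = t' + 1 := ⟨t - 1, by omega⟩
      exact (hstep t' ht).2

lemma IsInducedCycle.exists_unique_rext {s : Finset U} (hs : IsInducedCycle G s) {v : ℕ → U}
    {n : ℕ} (hn : 2 ≤ n) (hns : n + 2 ≤ s.card) (hv : NP G v n) (hvs : ∀ t < n, v t ∈ s) :
    ∃ w₀ ∈ s, ∀ w ∈ s, NP G (rext v n w) (n + 1) ↔ w = w₀ := by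
  obtain ⟨y, hJ, hC, hsy, hvy⟩ := hs.exists_reading hn hv hvs
  set m := s.card
  refine ⟨y n, by rw [hsy]; exact mem_verts.2 ⟨n, by omega, rfl⟩, fun w hw => ?_⟩
  rw [hsy] at hw
  obtain ⟨j, hj, rfl⟩ := mem_verts.1 hw
  rw [NP_rext_iff hn, hvy (n - 1) (by omega), hvy (n - 2) (by omega)]
  constructor
  · rintro ⟨-, h1, -, h3⟩
    have hjn : n ≤ j := by
      by_contra h
      exact h3 j (by omega) (hvy j (by omega))
    rw [hJ.adj_iff (n - 1) j (by omega) hj (by omega)] at h1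
    rw [h1, show n - 1 + 1 = n by omega]
  · intro h
    have hjn : j = n := by
      rcases lt_trichotomy j n with hl | hl | hl
      · exact absurd h (hJ.inj j n hl (by omega))
      · exact hl
      · exact absurd h.symm (hJ.inj n j hl hj)
    subst hjn
    refine ⟨hv, ?_, ?_, fun i hi => ?_⟩
    · rw [hJ.adj_iff _ _ (by omega) hj (by omega)]; omega
    · rw [hJ.adj_iff _ _ (by omega) hj (by omega)]; omega
    · rw [hvy i hi]; exact hJ.inj i j hi hj

variable [Fintype U]

/-- The colour of an edge. -/
noncomputable def edgeCol (col : List U → C) (e : Sym2 U) : C := col [e.out.1, e.out.2]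

open scoped Classical in
/-- The colours of the edges inside a set of vertices. -/
noncomputable def setCol (G : SimpleGraph U) (col : List U → C) (s : Finset U) : Multiset C :=
  ∑ e : Sym2 U, if e ∈ G.edgeSet ∧ ∀ x ∈ e, x ∈ s then {edgeCol col e} else 0

open scoped Classical in
/-- The number of induced cycles with `m` vertices and given edge colours that contain the first
`n` terms of `v`. -/
noncomputable def numCycles (G : SimpleGraph U) (col : List U → C) (m : ℕ) (χ : Multiset C)
    (v : ℕ → U) (n : ℕ) : ℕ :=
  ∑ s : Finset U, if (IsInducedCycle G s ∧ s.card = m ∧ setCol G col s = χ) ∧ ∀ t < n, v t ∈ s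
    then 1 else 0

/-- An induced cycle contains exactly one extension of a path at either end. -/
lemma two_mul_numCycles (col : List U → C) {m : ℕ} (χ : Multiset C) {v : ℕ → U} {n : ℕ}
    (hn : 2 ≤ n) (hnm : n + 2 ≤ m) (hv : NP G v n) :
    2 * numCycles G col m χ v n =
      ∑ q ∈ exts G v n, numCycles G col m χ (ext v n q) (n + 1) := by
  classical
  unfold numCycles
  rw [Finset.sum_comm, Finset.mul_sum]
  refine Finset.sum_congr rfl fun s _ => ?_
  by_cases hs : IsInducedCycle G s ∧ s.card = m ∧ setCol G col s = χ
  · have hmem : ∀ q : Bool × U, (∀ t < n + 1, ext v n q t ∈ s) ↔ (∀ t < n, v t ∈ s) ∧ q.2 ∈ s := by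
      rintro ⟨b, w⟩
      cases b
      · change (∀ t < n + 1, lext w v t ∈ s) ↔ _
        constructor
        · intro h
          exact ⟨fun t ht => h (t + 1) (by omega), h 0 (by omega)⟩
        · rintro ⟨h1, h2⟩ (_ | t) ht
          · exact h2
          · exact h1 t (by omega)
      · change (∀ t < n + 1, rext v n w t ∈ s) ↔ _
        constructor
        · intro h
          refine ⟨fun t ht => ?_, ?_⟩
          · have := h t (by omega)
            rwa [rext_of_lt w ht] at this
          · have := h n (by omega)
            rwa [rext_self] at this
        · rintro ⟨h1, h2⟩ t ht
          by_cases h : t < n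
          · rw [rext_of_lt w h]; exact h1 t h
          · obtain rfl : t = n := by omega
            rwa [rext_self]
    by_cases hvs : ∀ t < n, v t ∈ s
    · have hone : ∀ u, NP G u n → (∀ t < n, u t ∈ s) →
          (∑ w, if NP G (rext u n w) (n + 1) then (if w ∈ s then 1 else 0) else 0) = 1 := by
        intro u hu hus
        obtain ⟨w₀, hw₀, hw⟩ := hs.1.exists_unique_rext hn (by omega) hu hus
        rw [Finset.sum_eq_single w₀]
        · rw [if_pos ((hw w₀ hw₀).2 rfl), if_pos hw₀]
        · intro w _ hne
          by_cases hws : w ∈ s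
          · rw [if_neg fun h => hne ((hw w hws).1 h)]
          · simp [hws]
        · simp
      rw [if_pos ⟨hs, hvs⟩]
      have : ∀ q : Bool × U, (if (IsInducedCycle G s ∧ s.card = m ∧ setCol G col s = χ) ∧
          ∀ t < n + 1, ext v n q t ∈ s then 1 else 0) = if q.2 ∈ s then 1 else 0 := fun q =>
        if_congr (by rw [hmem q]; exact ⟨fun h => h.2.2, fun h => ⟨hs, hvs, h⟩⟩) rfl rfl
      rw [Finset.sum_congr rfl fun q _ => this q, sum_exts]
      simp only [NP_lext_iff_rv]
      rw [hone v hv hvs, hone _ hv.rv fun t ht => hvs _ (by omega), mul_one]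
    · rw [if_neg fun h => hvs h.2, mul_zero]
      exact (Finset.sum_eq_zero fun q _ => if_neg fun h => hvs ((hmem q).1 h.2).1).symm
  · rw [if_neg fun h => hs h.1, mul_zero]
    exact (Finset.sum_eq_zero fun q _ => if_neg fun h => hs h.1).symm

variable {k : ℕ} {col : List U → C} (hc : IsPathColoring G k col)
include hc

lemma edgeCol_mk (a b : U) : edgeCol col s(a, b) = ed col a b := by
  have h : s((Quot.out s(a, b) : U × U).1, (Quot.out s(a, b) : U × U).2) = s(a, b) :=
    Quot.out_eq (s(a, b) : Sym2 U)
  rcases Sym2.eq_iff.1 h with ⟨h1, h2⟩ | ⟨h1, h2⟩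
  · change col [_, _] = _
    rw [h1, h2]; rfl
  · change col [_, _] = _
    rw [h1, h2]
    exact ed_comm hc b a

lemma J.setCol_verts {u : ℕ → U} {m : ℕ} (hm : 3 ≤ m) (h : J G u m) (hcl : Cl G u m) :
    setCol G col (verts u m) = cycCol col u m := by
  classical
  have hinj : ∀ i j, i < m → j < m → u i = u j → i = j := by
    intro i j hi hj hij
    rcases lt_trichotomy i j with hl | hl | hl
    · exact absurd hij (h.inj i j hl hj)
    · exact hl
    · exact absurd hij.symm (h.inj j i hl hi)
  have hadj : ∀ i, i + 1 < m → G.Adj (u i) (u (i + 1)) := fun i hi =>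
    (h.adj_iff i (i + 1) (by omega) hi (by omega)).2 rfl
  have hset : (Finset.univ.filter fun e : Sym2 U => e ∈ G.edgeSet ∧ ∀ x ∈ e, x ∈ verts u m) =
      insert s(u 0, u (m - 1)) ((Finset.range (m - 1)).image fun i => s(u i, u (i + 1))) := by
    ext e
    induction e with | _ a b
    simp only [Finset.mem_filter, Finset.mem_univ, true_and, SimpleGraph.mem_edgeSet,
      Sym2.mem_iff, forall_eq_or_imp, forall_eq, Finset.mem_insert, Finset.mem_image,
      Finset.mem_range]
    constructor
    · rintro ⟨hab, ha, hb⟩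
      obtain ⟨i, hi, rfl⟩ := mem_verts.1 ha
      obtain ⟨j, hj, rfl⟩ := mem_verts.1 hb
      have main : ∀ i j, i < j → j < m → G.Adj (u i) (u j) → s(u i, u j) = s(u 0, u (m - 1)) ∨
          ∃ l < m - 1, s(u l, u (l + 1)) = s(u i, u j) := by
        intro i j hij hj ha
        by_cases hs : i = 0 ∧ j + 1 = m
        · obtain ⟨rfl, hs⟩ := hs
          obtain rfl : j = m - 1 := by omega
          exact Or.inl rfl
        · obtain rfl := (h.adj_iff i j hij hj hs).1 ha
          exact Or.inr ⟨i, by omega, rfl⟩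
      rcases lt_trichotomy i j with hl | rfl | hl
      · exact main i j hl hj hab
      · exact absurd hab (G.loopless.irrefl _)
      · rw [Sym2.eq_swap]
        exact main j i hl hi hab.symm
    · rintro (he | ⟨l, hl, he⟩)
      · have h1 : G.Adj (u 0) (u (m - 1)) := hcl
        have m1 : u 0 ∈ verts u m := mem_verts.2 ⟨0, by omega, rfl⟩
        have m2 : u (m - 1) ∈ verts u m := mem_verts.2 ⟨m - 1, by omega, rfl⟩
        rcases Sym2.eq_iff.1 he with ⟨rfl, rfl⟩ | ⟨rfl, rfl⟩
        exacts [⟨h1, m1, m2⟩, ⟨h1.symm, m2, m1⟩]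
      · have h1 := hadj l (by omega)
        have m1 : u l ∈ verts u m := mem_verts.2 ⟨l, by omega, rfl⟩
        have m2 : u (l + 1) ∈ verts u m := mem_verts.2 ⟨l + 1, by omega, rfl⟩
        rcases Sym2.eq_iff.1 he with ⟨rfl, rfl⟩ | ⟨rfl, rfl⟩
        exacts [⟨h1, m1, m2⟩, ⟨h1.symm, m2, m1⟩]
  unfold setCol cycCol E2
  rw [← Finset.sum_filter, hset, Finset.sum_insert, Finset.sum_image, edgeCol_mk hc, add_comm]
  · refine congrArg₂ (· + ·) (Finset.sum_congr rfl fun i _ => ?_) rfl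
    rw [edgeCol_mk hc, win_two]
  · intro i hi j hj hij
    simp only [Finset.coe_range, Set.mem_Iio] at hi hj
    rcases Sym2.eq_iff.1 hij with ⟨h1, -⟩ | ⟨h1, h2⟩
    · exact hinj _ _ (by omega) (by omega) h1
    · have := hinj _ _ (by omega) (by omega) h1
      have := hinj _ _ (by omega) (by omega) h2
      omega
  · simp only [Finset.mem_image, Finset.mem_range, not_exists, not_and]
    intro i hi hij
    rcases Sym2.eq_iff.1 hij with ⟨h1, h2⟩ | ⟨h1, h2⟩
    · have := hinj _ _ (by omega) (by omega) h1
      have := hinj _ _ (by omega) (by omega) h2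
      omega
    · have := hinj _ _ (by omega) (by omega) h1
      have := hinj _ _ (by omega) (by omega) h2
      omega

/-- The induced cycles with one vertex more than a given path correspond to the vertices closing
the path. -/
lemma numCycles_eq_numClosing (χ : Multiset C) {v : ℕ → U} {n : ℕ} (hn : 2 ≤ n)
    (hv : NP G v n) :
    numCycles G col (n + 1) χ v n = numClosing G col v n (fun χ' => χ' = χ) := by
  classical
  have hcard : ∀ Q, numClosing G col v n Q =
      (Finset.univ.filter fun w => Closes G v n w ∧ Q (closeCol col v n w)).card := fun Q => by
    rw [Finset.card_filter, numClosing]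
  rw [hcard, numCycles, ← Finset.card_filter]
  symm
  have hcl : ∀ w, Closes G v n w → J G (rext v n w) (n + 1) ∧ Cl G (rext v n w) (n + 1) :=
    fun w => (closes_iff_rext (by omega)).1
  refine Finset.card_bij (fun w _ => verts (rext v n w) (n + 1)) ?_ ?_ ?_
  · intro w hw
    simp only [Finset.mem_filter, Finset.mem_univ, true_and] at hw ⊢
    obtain ⟨hw, hcol⟩ := hw
    obtain ⟨h1, h2⟩ := hcl w hw
    obtain ⟨h3, h4⟩ := h1.isInducedCycle (by omega) h2
    refine ⟨⟨h4, h3, ?_⟩, fun t ht => mem_verts.2 ⟨t, by omega, rext_of_lt w ht⟩⟩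
    rw [h1.setCol_verts hc (by omega) h2, ← hcol]
    exact cycCol_ext hc (by omega) (true, w)
  · intro w hw w' hw' he
    simp only [Finset.mem_filter, Finset.mem_univ, true_and] at hw hw'
    have : w ∈ verts (rext v n w') (n + 1) := by
      rw [← he]
      exact mem_verts.2 ⟨n, by omega, rext_self _ _ _⟩
    obtain ⟨i, hi, hiw⟩ := mem_verts.1 this
    by_cases h : i < n
    · rw [rext_of_lt _ h] at hiw
      exact absurd hiw (hw.1.ne i h)
    · obtain rfl : i = n := by omega
      rw [rext_self] at hiw
      exact hiw.symm
  · intro s hs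
    simp only [Finset.mem_filter, Finset.mem_univ, true_and] at hs
    obtain ⟨⟨h1, h2, h3⟩, h4⟩ := hs
    obtain ⟨y, hJ, hC, hsy, hvy⟩ := h1.exists_reading (by omega) hv h4
    rw [h2] at hJ hC hsy
    have hr : ∀ t < n + 1, y t = rext v n (y n) t := by
      intro t ht
      by_cases h : t < n
      · rw [rext_of_lt _ h, hvy t h]
      · obtain rfl : t = n := by omega
        rw [rext_self]
    have hcl : Closes G v n (y n) := by
      rw [closes_iff_rext (by omega)]
      refine ⟨hJ.congr hr, ?_⟩
      unfold Cl
      rw [← hr _ (by omega), ← hr _ (by omega)]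
      exact hC
    have hs' : verts (rext v n (y n)) (n + 1) = s := by
      rw [hsy]
      exact Finset.image_congr fun t ht => (hr t (by simpa using ht)).symm
    refine ⟨y n, ?_, hs'⟩
    simp only [Finset.mem_filter, Finset.mem_univ, true_and]
    refine ⟨hcl, ?_⟩
    obtain ⟨h6, h7⟩ := (closes_iff_rext (by omega)).1 hcl
    rw [← h3, ← hs', h6.setCol_verts hc (by omega) h7]
    exact (cycCol_ext hc (by omega) (true, y n)).symm

/-- The colour of a path determines the number of longer induced cycles through it with given edge
colours. -/
lemma numCycles_eq {m : ℕ} (hmk : m ≤ k) (χ : Multiset C) {n : ℕ} (hn : 2 ≤ n) (hnm : n + 1 ≤ m)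
    (hm : 4 ≤ m) {v v' : ℕ → U} (hv : NP G v n) (hv' : NP G v' n)
    (h : col (seg v n) = col (seg v' n)) :
    numCycles G col m χ v n = numCycles G col m χ v' n := by
  obtain ⟨d, hd⟩ : ∃ d, n + 1 + d = m := ⟨m - (n + 1), by omega⟩
  induction d generalizing n v v' with
  | zero =>
    obtain rfl : n + 1 = m := by omega
    rw [numCycles_eq_numClosing hc χ (by omega) hv, numCycles_eq_numClosing hc χ (by omega) hv']
    exact numClosing_eq hc (by omega) hmk hv hv' h χ
  | succ d ih =>
    have h1 := two_mul_numCycles col χ hn (by omega : n + 2 ≤ m) hv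
    have h2 := two_mul_numCycles col χ hn (by omega : n + 2 ≤ m) hv'
    have h3 := sum_exts_eq hc hn (by omega) hv hv' h
      (fun q => numCycles G col m χ (ext v n q) (n + 1))
      (fun q => numCycles G col m χ (ext v' n q) (n + 1)) fun q hq q' hq' hqq =>
        ih (by omega) (by omega) (mem_exts.1 hq) (mem_exts.1 hq') hqq (by omega)
    omega

end Cycles

/-! ### The members of the path complex -/

section Members

variable {U C : Type*} {G : SimpleGraph U} {p : ℕ∞}

/-- The member of the path complex given by a simple path. -/
def member (l : List U) (h : IsSimplePath G l ∧ (l.length : ℕ∞) ≤ p + 1) : ElemPath G p :=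
  Quotient.mk (pathSetoid G p) ⟨l, h⟩

open scoped Classical in
/-- A colouring of the path complex as a function of vertex sequences; sequences that are not
members get the colour `c₀`. -/
noncomputable def pathCol (c : ElemPath G p → C) (c₀ : C) (l : List U) : C :=
  if h : IsSimplePath G l ∧ (l.length : ℕ∞) ≤ p + 1 then c (member l h) else c₀

lemma pathCol_eq (c : ElemPath G p → C) (c₀ : C) {l : List U}
    (h : IsSimplePath G l ∧ (l.length : ℕ∞) ≤ p + 1) : pathCol c c₀ l = c (member l h) :=
  dif_pos h

lemma member_eq_iff {l l' : List U} {h : IsSimplePath G l ∧ (l.length : ℕ∞) ≤ p + 1}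
    {h' : IsSimplePath G l' ∧ (l'.length : ℕ∞) ≤ p + 1} :
    member l h = member l' h' ↔ l = l' ∨ l = l'.reverse :=
  Quotient.eq (r := pathSetoid G p)

lemma exists_member (σ : ElemPath G p) : ∃ l h, σ = member l h := by
  induction σ using Quotient.ind with
  | _ a => exact ⟨a.1, a.2, rfl⟩

/-- The sequence `u` without its term at index `i`. -/
def er (u : ℕ → U) (i : ℕ) : ℕ → U := fun t => if t < i then u t else u (t + 1)

lemma eraseIdx_seg (u : ℕ → U) {n i : ℕ} (hi : i ≤ n) :
    (seg u (n + 1)).eraseIdx i = seg (er u i) n := by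
  apply List.ext_getElem
  · rw [List.length_eraseIdx_of_lt (by rw [length_seg]; omega), length_seg, length_seg,
      Nat.add_sub_cancel]
  · intro t h1 h2
    rw [List.getElem_eraseIdx]
    simp only [seg, er, List.getElem_map, List.getElem_range]
    split_ifs <;> rfl

lemma isSimplePath_seg {u : ℕ → U} {n : ℕ} : IsSimplePath G (seg u n) ↔
    0 < n ∧ (∀ i j, i < j → j < n → u i ≠ u j) ∧ ∀ i, i + 1 < n → G.Adj (u i) (u (i + 1)) := by
  unfold IsSimplePath
  refine and_congr ?_ (and_congr ?_ ?_)
  · rw [← List.length_pos_iff, length_seg]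
  · rw [List.nodup_iff_pairwise_ne, List.pairwise_iff_getElem]
    simp only [seg, List.getElem_map, List.getElem_range, List.length_map, List.length_range]
    exact ⟨fun h i j hij hj => h i j (by omega) hj hij, fun h i j _ hj hij => h i j hij hj⟩
  · rw [List.isChain_iff_getElem]
    simp [seg]

lemma exists_seg {l : List U} (hl : l ≠ []) : ∃ u : ℕ → U, l = seg u l.length := by
  obtain ⟨x, -⟩ := List.exists_mem_of_ne_nil l hl
  refine ⟨fun t => l.getD t x, ?_⟩
  apply List.ext_getElem
  · rw [length_seg]
  · intro t h1 h2
    simp [seg, h1]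

lemma IsSimplePath.reverse {l : List U} (h : IsSimplePath G l) : IsSimplePath G l.reverse := by
  refine ⟨by simpa using h.1, by simpa using h.2.1, ?_⟩
  rw [List.isChain_reverse]
  exact h.2.2.imp fun _ _ h => h.symm

lemma er_rv {u : ℕ → U} {n i t : ℕ} (hi : i ≤ n) (ht : t < n) :
    er (rv u (n + 1)) i t = rv (er u (n - i)) n t := by
  simp only [er, rv]
  split_ifs <;> first | omega | (congr 1; omega)

lemma mem_seg {u : ℕ → U} {n : ℕ} {x : U} : x ∈ seg u n ↔ ∃ i < n, u i = x := by
  simp [seg]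

lemma pathBoundary_member {l : List U} {h : IsSimplePath G l ∧ (l.length : ℕ∞) ≤ p + 1}
    {u : ℕ → U} {n : ℕ} (hu : l = seg u (n + 1)) {σ : ElemPath G p} :
    pathBoundary G p σ (member l h) ↔ ∃ i ≤ n, ∃ h', σ = member (seg (er u i) n) h' := by
  subst hu
  constructor
  · rintro ⟨a, b, rfl, hb, i, hi, hab⟩
    have hb' := Quotient.exact hb
    rcases hb' with hb' | hb'
    · rw [hb', length_seg] at hi
      have ha : a.1 = seg (er u i) n := by rw [hab, hb', eraseIdx_seg u (by omega)]
      have h' := a.2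
      rw [ha] at h'
      exact ⟨i, by omega, h', (member_eq_iff (h := a.2) (h' := h')).2 (Or.inl ha)⟩
    · rw [hb', List.length_reverse, length_seg] at hi
      have ha : a.1 = (seg (er u (n - i)) n).reverse := by
        rw [hab, hb', ← seg_rv, eraseIdx_seg _ (by omega), ← seg_rv]
        exact seg_congr fun t ht => er_rv (by omega) ht
      have h' : IsSimplePath G (seg (er u (n - i)) n) ∧
          ((seg (er u (n - i)) n).length : ℕ∞) ≤ p + 1 := by
        have := a.2
        rw [ha, List.length_reverse] at this
        refine ⟨?_, this.2⟩
        have := this.1.reverse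
        rwa [List.reverse_reverse] at this
      exact ⟨n - i, by omega, h', (member_eq_iff (h := a.2) (h' := h')).2 (Or.inr ha)⟩
  · rintro ⟨i, hi, h', rfl⟩
    exact ⟨⟨_, h'⟩, ⟨_, h⟩, rfl, rfl, i, by simp only [length_seg]; omega,
      (eraseIdx_seg u hi).symm⟩

lemma NP.isSimplePath {u : ℕ → U} {n : ℕ} (hn : 0 < n) (h : NP G u n) : IsSimplePath G (seg u n) :=
  isSimplePath_seg.2 ⟨hn, h.inj, h.adj⟩

/-- Deleting different vertices of a simple path gives different members. -/
lemma er_ne {u : ℕ → U} {n i j : ℕ} (hu : ∀ i j, i < j → j < n + 1 → u i ≠ u j) (hi : i ≤ n)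
    (hj : j ≤ n) (hij : i ≠ j) : ¬ (seg (er u i) n = seg (er u j) n ∨
      seg (er u i) n = (seg (er u j) n).reverse) := by
  intro h
  have h1 : ∀ x, x ∈ seg (er u i) n ↔ x ∈ seg (er u j) n := by
    intro x
    rcases h with h | h <;> rw [h]
    rw [List.mem_reverse]
  have h2 : u i ∈ seg (er u j) n := by
    rcases lt_or_gt_of_ne hij with hl | hl
    · exact mem_seg.2 ⟨i, by omega, by simp [er, hl]⟩
    · refine mem_seg.2 ⟨i - 1, by omega, ?_⟩
      simp only [er, show ¬ i - 1 < j by omega, if_false]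
      congr 1
      omega
  obtain ⟨t, ht, e⟩ := mem_seg.1 ((h1 _).2 h2)
  simp only [er] at e
  split_ifs at e with h3
  · exact hu t i h3 (by omega) e
  · exact hu i (t + 1) (by omega) (by omega) e.symm

variable [Fintype U] (c : ElemPath G p → C) (c₀ : C)

open scoped Classical in
/-- The boundary colours of a path, listed by the deleted vertex. -/
lemma boundaryColors_member {l : List U} {h : IsSimplePath G l ∧ (l.length : ℕ∞) ≤ p + 1}
    {u : ℕ → U} {n : ℕ} (hu : l = seg u (n + 1)) :
    boundaryColors (pathBoundary G p) c (member l h) = ∑ i ∈ Finset.range (n + 1),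
      if IsSimplePath G (seg (er u i) n) then {pathCol c c₀ (seg (er u i) n)} else 0 := by
  have := Fintype.ofFinite (ElemPath G p)
  have hlen : (n : ℕ∞) ≤ p + 1 := by
    have := h.2
    rw [hu, length_seg] at this
    exact le_trans (by exact_mod_cast Nat.le_succ n) this
  have hb : ∀ {i}, IsSimplePath G (seg (er u i) n) → IsSimplePath G (seg (er u i) n) ∧
      ((seg (er u i) n).length : ℕ∞) ≤ p + 1 := fun hi => ⟨hi, by rwa [length_seg]⟩
  rw [boundaryColors, colorsOf_eq_sum, ← Finset.sum_filter, ← Finset.sum_filter]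
  symm
  refine Finset.sum_bij (fun i hi => member (seg (er u i) n)
    (hb (Finset.mem_filter.1 hi).2)) ?_ ?_ ?_ ?_
  · intro i hi
    simp only [Finset.mem_filter, Finset.mem_range, Finset.mem_univ, true_and] at hi ⊢
    exact (pathBoundary_member hu).2 ⟨i, by omega, hb hi.2, rfl⟩
  · intro i hi j hj hij
    simp only [Finset.mem_filter, Finset.mem_range] at hi hj
    by_contra hne
    have h1 := h.1
    rw [hu, isSimplePath_seg] at h1
    exact er_ne h1.2.1 (by omega) (by omega) hne (member_eq_iff.1 hij)
  · intro σ hσ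
    simp only [Finset.mem_filter, Finset.mem_univ, true_and] at hσ
    obtain ⟨i, hi, h', rfl⟩ := (pathBoundary_member hu).1 hσ
    exact ⟨i, by simp only [Finset.mem_filter, Finset.mem_range]; exact ⟨by omega, h'.1⟩, rfl⟩
  · intro i hi
    rw [pathCol_eq c c₀ (hb (Finset.mem_filter.1 hi).2)]

omit [Fintype U] in
lemma isSimplePath_er {u : ℕ → U} {n i : ℕ} (hi : i ≤ n) (hn : 0 < n)
    (hu : IsSimplePath G (seg u (n + 1))) : IsSimplePath G (seg (er u i) n) ↔
      (i = 0 ∨ i = n ∨ G.Adj (u (i - 1)) (u (i + 1))) := by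
  rw [isSimplePath_seg] at hu
  obtain ⟨-, hinj, hadj⟩ := hu
  rw [isSimplePath_seg]
  constructor
  · rintro ⟨-, -, h⟩
    by_contra hc
    push Not at hc
    have := h (i - 1) (by omega)
    simp only [er, show i - 1 < i by omega, show ¬ i - 1 + 1 < i by omega, if_true,
      if_false, show i - 1 + 1 + 1 = i + 1 by omega] at this
    exact hc.2.2 this
  · intro h
    refine ⟨hn, fun a b hab hb => ?_, fun a ha => ?_⟩
    · simp only [er]
      split_ifs <;> exact hinj _ _ (by omega) (by omega)
    · simp only [er]
      split_ifs with h1 h2 h2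
      · exact hadj a (by omega)
      · rcases h with h | h | h
        · omega
        · omega
        · obtain rfl : i = a + 1 := by omega
          exact h
      · omega
      · exact hadj (a + 1) (by omega)

lemma boundaryColors_of_NP {l : List U} {h : IsSimplePath G l ∧ (l.length : ℕ∞) ≤ p + 1}
    {u : ℕ → U} {n : ℕ} (hn : 0 < n) (hu : l = seg u (n + 1)) (hnp : NP G u (n + 1)) :
    boundaryColors (pathBoundary G p) c (member l h) =
      {pathCol c c₀ (seg u n)} + {pathCol c c₀ (seg (sh u 1) n)} := by
  classical
  rw [boundaryColors_member c c₀ hu]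
  have hp : IsSimplePath G (seg u (n + 1)) := hu ▸ h.1
  have e0 : seg (er u 0) n = seg (sh u 1) n :=
    seg_congr fun t _ => by simp [er, sh, add_comm]
  have en : seg (er u n) n = seg u n := seg_congr fun t ht => by simp [er, ht]
  rw [← Finset.sum_filter]
  have : (Finset.range (n + 1)).filter (fun i => IsSimplePath G (seg (er u i) n)) = {n, 0} := by
    ext i
    simp only [Finset.mem_filter, Finset.mem_range, Finset.mem_insert, Finset.mem_singleton]
    constructor
    · rintro ⟨hi, h'⟩
      rcases (isSimplePath_er (by omega) hn hp).1 h' with h' | h' | h'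
      · exact Or.inr h'
      · exact Or.inl h'
      · by_contra hc
        push Not at hc
        have := hnp.nadj (i - 1) (by omega)
        rw [show i - 1 + 2 = i + 1 by omega] at this
        exact this h'
    · rintro (rfl | rfl)
      · exact ⟨by omega, (isSimplePath_er le_rfl hn hp).2 (Or.inr (Or.inl rfl))⟩
      · exact ⟨by omega, (isSimplePath_er (by omega) hn hp).2 (Or.inl rfl)⟩
  rw [this, Finset.sum_pair (by omega), e0, en]

/-- A path without short chords is recognized by having only two boundary members. -/
lemma NP_of_card {l : List U} {h : IsSimplePath G l ∧ (l.length : ℕ∞) ≤ p + 1}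
    {u : ℕ → U} {n : ℕ} (hn : 0 < n) (hu : l = seg u (n + 1))
    (hcard : (boundaryColors (pathBoundary G p) c (member l h)).card = 2) : NP G u (n + 1) := by
  classical
  have hp : IsSimplePath G (seg u (n + 1)) := hu ▸ h.1
  have hp' := isSimplePath_seg.1 hp
  refine ⟨hp'.2.1, hp'.2.2, fun i hi hadj => ?_⟩
  have := Fintype.ofFinite (ElemPath G p)
  have hmem : ∀ j, j ≤ n → IsSimplePath G (seg (er u j) n) →
      IsSimplePath G (seg (er u j) n) ∧ ((seg (er u j) n).length : ℕ∞) ≤ p + 1 := by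
    intro j _ hj
    refine ⟨hj, ?_⟩
    have := h.2
    rw [hu, length_seg] at this
    rw [length_seg]
    exact le_trans (by exact_mod_cast Nat.le_succ n) this
  rw [boundaryColors, card_colorsOf, ← Finset.card_filter] at hcard
  have s0 := hmem 0 (by omega) ((isSimplePath_er (by omega) hn hp).2 (Or.inl rfl))
  have sn := hmem n le_rfl ((isSimplePath_er le_rfl hn hp).2 (Or.inr (Or.inl rfl)))
  have si := hmem (i + 1) (by omega) ((isSimplePath_er (by omega) hn hp).2
    (Or.inr (Or.inr hadj)))
  have h3 : ({member _ s0, member _ sn, member _ si} : Finset (ElemPath G p)).card = 3 := by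
    refine Finset.card_eq_three.2 ⟨_, _, _, ?_, ?_, ?_, rfl⟩ <;>
      exact fun he => er_ne hp'.2.1 (by omega) (by omega) (by omega) (member_eq_iff.1 he)
  have hle : ({member _ s0, member _ sn, member _ si} : Finset (ElemPath G p)).card ≤ 2 := by
    rw [← hcard]
    refine Finset.card_le_card fun σ hσ => ?_
    simp only [Finset.mem_insert, Finset.mem_singleton] at hσ
    simp only [Finset.mem_filter, Finset.mem_univ, true_and]
    rcases hσ with rfl | rfl | rfl
    · exact (pathBoundary_member hu).2 ⟨_, by omega, s0, rfl⟩
    · exact (pathBoundary_member hu).2 ⟨_, by omega, sn, rfl⟩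
    · exact (pathBoundary_member hu).2 ⟨_, by omega, si, rfl⟩
  omega

end Members

/-! ### Stable colourings of the path complex -/

section Stable

lemma colorsOf_and_congr {M C : Type*} [Finite M] {P P' S : M → Prop} {c : M → C}
    (hS : ∀ x y, c x = c y → (S x ↔ S y)) (h : colorsOf P c = colorsOf P' c) :
    colorsOf (fun x => P x ∧ S x) c = colorsOf (fun x => P' x ∧ S x) c := by
  classical
  have := Fintype.ofFinite M
  have key : ∀ Q : M → Prop, colorsOf (fun x => Q x ∧ S x) c =
      (colorsOf Q c).filter fun a => ∃ x, c x = a ∧ S x := by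
    intro Q
    rw [colorsOf_eq, colorsOf_eq, Multiset.filter_map, ← Finset.filter_val, Finset.filter_filter]
    congr 2
    refine Finset.filter_congr fun x _ => and_congr_right fun _ => ?_
    exact ⟨fun hx => ⟨x, rfl, hx⟩, fun ⟨y, hy, hS'⟩ => (hS y x hy).1 hS'⟩
  rw [key, key, h]

/-- A colouring of a complex in which the colour of a member determines the colours of its boundary
and of its co-boundary. -/
structure IsEquitable {M C : Type*} [Finite M] (r : M → M → Prop) (c : M → C) : Prop where
  down : ∀ σ τ, c σ = c τ → boundaryColors r c σ = boundaryColors r c τ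
  up : ∀ σ τ, c σ = c τ → coboundaryColors r c σ = coboundaryColors r c τ

variable {U C : Type*} {G : SimpleGraph U} {p : ℕ∞}

lemma sym2_of_add {a b a' b' : C} (h : ({a} + {b} : Multiset C) = {a'} + {b'}) :
    s(a, b) = s(a', b') := by
  rw [Multiset.singleton_add, Multiset.singleton_add, Multiset.cons_eq_cons] at h
  rw [Sym2.eq_iff]
  rcases h with ⟨h1, h2⟩ | ⟨-, cs, h1, h2⟩
  · exact Or.inl ⟨h1, Multiset.singleton_inj.1 h2⟩
  · have hc : cs = 0 := by
      have := congrArg Multiset.card h1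
      simpa using this
    subst hc
    exact Or.inr ⟨(Multiset.singleton_inj.1 h2).symm, Multiset.singleton_inj.1 h1⟩

/-- The index of the new vertex of an extension. -/
lemma er_ext (v : ℕ → U) {n t : ℕ} (q : Bool × U) (ht : t < n) :
    er (ext v n q) (if q.1 then n else 0) t = v t := by
  obtain ⟨b, w⟩ := q
  cases b
  · simp [er, ext, lext]
  · simp [er, ext, ht, rext]

lemma seg_ext_ne {v : ℕ → U} {n : ℕ} (hn : 2 ≤ n) {q q' : Bool × U}
    (hq : NP G (ext v n q) (n + 1)) (hq' : NP G (ext v n q') (n + 1))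
    (h : seg (ext v n q) (n + 1) = seg (ext v n q') (n + 1) ∨
      seg (ext v n q) (n + 1) = (seg (ext v n q') (n + 1)).reverse) : q = q' := by
  have hne : ∀ q : Bool × U, NP G (ext v n q) (n + 1) → ∀ i < n, v i ≠ q.2 := by
    rintro ⟨b, w⟩ hq
    cases b
    · exact ((NP_lext_iff hn).1 hq).2.2.2
    · exact ((NP_rext_iff hn).1 hq).2.2.2
  have hv : NP G v n := by
    obtain ⟨b, w⟩ := q
    cases b
    · exact ((NP_lext_iff hn).1 hq).1
    · exact ((NP_rext_iff hn).1 hq).1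
  have hmem : ∀ (q : Bool × U) x, x ∈ seg (ext v n q) (n + 1) → x = q.2 ∨ ∃ i < n, v i = x := by
    rintro ⟨b, w⟩ x hx
    obtain ⟨i, hi, rfl⟩ := mem_seg.1 hx
    cases b
    · rcases i with _ | i
      · exact Or.inl rfl
      · exact Or.inr ⟨i, by omega, rfl⟩
    · change rext v n w i = w ∨ ∃ j < n, v j = rext v n w i
      by_cases h : i < n
      · exact Or.inr ⟨i, h, (rext_of_lt w h).symm⟩
      · exact Or.inl (if_neg h)
  have hself : q.2 ∈ seg (ext v n q) (n + 1) := by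
    obtain ⟨b, w⟩ := q
    cases b
    · exact mem_seg.2 ⟨0, by omega, rfl⟩
    · exact mem_seg.2 ⟨n, by omega, rext_self v n w⟩
  have h2 : q.2 = q'.2 := by
    have : q.2 ∈ seg (ext v n q') (n + 1) := by
      rcases h with h | h
      · rwa [← h]
      · rwa [h, List.mem_reverse] at hself
    exact (hmem q' _ this).resolve_right fun ⟨i, hi, he⟩ => hne q hq i hi he
  obtain ⟨b, w⟩ := q
  obtain ⟨b', w'⟩ := q'
  simp only at h2
  subst h2
  -- extensions at different ends by the same vertex differ
  have key : ¬ (seg (rext v n w) (n + 1) = seg (lext w v) (n + 1) ∨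
      seg (rext v n w) (n + 1) = (seg (lext w v) (n + 1)).reverse) := by
    rintro (h | h)
    · have h0 := seg_eq_iff.1 h 0 (by omega)
      rw [rext_of_lt w (by omega)] at h0
      exact hne _ hq 0 (by omega) h0
    · rw [← seg_rv] at h
      have h0 := seg_eq_iff.1 h 0 (by omega)
      rw [rext_of_lt w (by omega)] at h0
      have : rv (lext w v) (n + 1) 0 = v (n - 1) := by
        obtain ⟨m, rfl⟩ : ∃ m, n = m + 1 := ⟨n - 1, by omega⟩
        rfl
      rw [this] at h0
      exact hv.inj 0 (n - 1) (by omega) (by omega) h0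
  cases b <;> cases b'
  · rfl
  · refine absurd ?_ key
    rcases h with h | h
    · exact Or.inl h.symm
    · rw [← List.reverse_reverse (seg (rext v n w) (n + 1))]
      exact Or.inr (congrArg _ h.symm)
  · exact absurd h key
  · rfl

variable [Fintype U] (c : ElemPath G p → C) (c₀ : C)

/-- The co-boundary members with two boundary members are the extensions without short chords. -/
lemma coboundary_exts {k : ℕ} (hk : (k : ℕ∞) ≤ p) {v : ℕ → U} {n : ℕ} (hn : 2 ≤ n) (hnk : n ≤ k)
    (hv : NP G v n) (h : IsSimplePath G (seg v n) ∧ ((seg v n).length : ℕ∞) ≤ p + 1) :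
    colorsOf (fun δ => pathBoundary G p (member (seg v n) h) δ ∧
        (boundaryColors (pathBoundary G p) c δ).card = 2) c =
      (exts G v n).val.map fun q => pathCol c c₀ (seg (ext v n q) (n + 1)) := by
  classical
  have := Fintype.ofFinite (ElemPath G p)
  have hlen : ((n + 1 : ℕ) : ℕ∞) ≤ p + 1 := by
    push_cast
    exact add_le_add_left (le_trans (by exact_mod_cast hnk) hk) 1
  have hb : ∀ {q}, q ∈ exts G v n → IsSimplePath G (seg (ext v n q) (n + 1)) ∧
      ((seg (ext v n q) (n + 1)).length : ℕ∞) ≤ p + 1 := fun hq =>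
    ⟨(mem_exts.1 hq).isSimplePath (by omega), by rwa [length_seg]⟩
  rw [colorsOf_eq_sum, ← Finset.sum_filter]
  have hsum : ((exts G v n).val.map fun q => pathCol c c₀ (seg (ext v n q) (n + 1))) =
      ∑ q ∈ exts G v n, {pathCol c c₀ (seg (ext v n q) (n + 1))} := by
    rw [Finset.sum]
    exact (Multiset.sum_map_singleton _).symm.trans (by rw [Multiset.map_map]; rfl)
  rw [hsum]
  symm
  refine Finset.sum_bij (fun q hq => member _ (hb hq)) ?_ ?_ ?_ ?_
  · intro q hq
    simp only [Finset.mem_filter, Finset.mem_univ, true_and]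
    refine ⟨?_, ?_⟩
    · rw [pathBoundary_member rfl]
      have e : seg (er (ext v n q) (if q.1 then n else 0)) n = seg v n :=
        seg_congr fun t => er_ext v q
      refine ⟨if q.1 then n else 0, by split_ifs <;> omega, by rwa [e], ?_⟩
      exact member_eq_iff.2 (Or.inl e.symm)
    · rw [boundaryColors_of_NP c c₀ (by omega) rfl (mem_exts.1 hq)]
      simp
  · intro q hq q' hq' he
    exact seg_ext_ne hn (mem_exts.1 hq) (mem_exts.1 hq') (member_eq_iff.1 he)
  · intro δ hδ
    simp only [Finset.mem_filter, Finset.mem_univ, true_and] at hδ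
    obtain ⟨h1, h2⟩ := hδ
    obtain ⟨l, hl, rfl⟩ := exists_member δ
    obtain ⟨u, hu⟩ := exists_seg hl.1.1
    obtain ⟨m, hm⟩ : ∃ m, l.length = m + 1 :=
      ⟨l.length - 1, by have := List.length_pos_iff.2 hl.1.1; omega⟩
    rw [hm] at hu
    obtain ⟨i, hi, h', he⟩ := (pathBoundary_member hu).1 h1
    have hmn : m = n := by
      have h3 := member_eq_iff.1 he
      have h4 : (seg v n).length = (seg (er u i) m).length := by
        rcases h3 with h3 | h3 <;> simp [h3]
      simpa [length_seg] using h4.symm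
    subst hmn
    -- choose the direction of the extension so that it continues `v` in order
    obtain ⟨y, j, hy, hj, hjv⟩ : ∃ y j, (l = seg y (m + 1) ∨ l = (seg y (m + 1)).reverse) ∧ j ≤ m ∧
        ∀ t < m, er y j t = v t := by
      rcases member_eq_iff.1 he with h3 | h3
      · exact ⟨u, i, Or.inl hu, hi, fun t ht => (seg_eq_iff.1 h3 t ht).symm⟩
      · refine ⟨rv u (m + 1), m - i, Or.inr ?_, by omega, fun t ht => ?_⟩
        · rw [← seg_rv, hu]
          exact seg_congr fun t ht => (rv_rv ht).symm
        · rw [er_rv (by omega) ht, show m - (m - i) = i by omega]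
          rw [← seg_rv] at h3
          exact (seg_eq_iff.1 h3 t ht).symm
    have hly : IsSimplePath G (seg y (m + 1)) ∧ ((seg y (m + 1)).length : ℕ∞) ≤ p + 1 := by
      rw [length_seg]
      refine ⟨?_, hlen⟩
      rcases hy with hy | hy
      · rw [← hy]; exact hl.1
      · rw [← List.reverse_reverse (seg y (m + 1)), ← hy]
        exact hl.1.reverse
    have hδ' : member l hl = member _ hly := member_eq_iff.2 hy
    rw [hδ'] at h2 ⊢
    have hnp := NP_of_card c (by omega) rfl h2
    have hj' : j = 0 ∨ j = m := by
      by_contra hc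
      push Not at hc
      have a1 := hv.adj (j - 1) (by omega)
      have a2 := hnp.nadj (j - 1) (by omega)
      rw [← hjv _ (by omega), ← hjv _ (by omega)] at a1
      simp only [er, show j - 1 < j by omega, show ¬ j - 1 + 1 < j by omega, if_true,
        if_false] at a1
      exact a2 a1
    have hq : ∃ q, ∀ t < m + 1, ext v m q t = y t := by
      rcases hj' with rfl | rfl
      · refine ⟨(false, y 0), fun t ht => ?_⟩
        change lext (y 0) v t = y t
        rcases t with _ | t
        · rfl
        · change v t = _
          rw [← hjv t (by omega)]
          simp [er]
      · refine ⟨(true, y j), fun t ht => ?_⟩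
        change rext v j (y j) t = y t
        by_cases h : t < j
        · rw [rext_of_lt _ h, ← hjv t h]
          simp [er, h]
        · obtain rfl : t = j := by omega
          exact rext_self _ _ _
    obtain ⟨q, hq⟩ := hq
    exact ⟨q, mem_exts.2 (hnp.congr fun t ht => (hq t ht).symm),
      member_eq_iff.2 (Or.inl (seg_congr hq))⟩
  · intro q hq
    rw [pathCol_eq c c₀ (hb hq)]

variable {c}

/-- An equitable colouring of the path complex has the properties used in the analysis of words. -/
lemma IsEquitable.isPathColoring {k : ℕ} (hc : IsEquitable (pathBoundary G p) c)
    (hk : (k : ℕ∞) ≤ p) : IsPathColoring G k (pathCol c c₀) := by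
  have hlen : ∀ {n : ℕ}, n ≤ k + 1 → (n : ℕ∞) ≤ p + 1 := fun hn =>
    le_trans (by exact_mod_cast hn) (add_le_add_left hk 1)
  have hmem : ∀ {v : ℕ → U} {n : ℕ}, NP G v n → 0 < n → n ≤ k + 1 →
      IsSimplePath G (seg v n) ∧ ((seg v n).length : ℕ∞) ≤ p + 1 := fun hv h0 hn =>
    ⟨hv.isSimplePath h0, by rw [length_seg]; exact hlen hn⟩
  refine ⟨fun l => ?_, fun n v v' hn hnk hv hv' h => ?_, fun n v v' hn hnk hv hv' h => ?_⟩
  · by_cases h : IsSimplePath G l ∧ (l.length : ℕ∞) ≤ p + 1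
    · have h' : IsSimplePath G l.reverse ∧ (l.reverse.length : ℕ∞) ≤ p + 1 :=
        ⟨h.1.reverse, by rw [List.length_reverse]; exact h.2⟩
      rw [pathCol_eq c c₀ h, pathCol_eq c c₀ h', member_eq_iff.2 (Or.inr rfl)]
    · have h' : ¬ (IsSimplePath G l.reverse ∧ (l.reverse.length : ℕ∞) ≤ p + 1) := by
        intro h'
        rw [List.length_reverse] at h'
        exact h ⟨by have := h'.1.reverse; rwa [List.reverse_reverse] at this, h'.2⟩
      rw [pathCol, pathCol, dif_neg h, dif_neg h']
  · have m := hmem hv (by omega) (by omega)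
    have m' := hmem hv' (by omega) (by omega)
    rw [pathCol_eq c c₀ m, pathCol_eq c c₀ m'] at h
    have hd := hc.down _ _ h
    rw [boundaryColors_of_NP c c₀ (by omega) rfl hv,
      boundaryColors_of_NP c c₀ (by omega) rfl hv'] at hd
    exact sym2_of_add hd
  · have m := hmem hv (by omega) (by omega)
    have m' := hmem hv' (by omega) (by omega)
    rw [pathCol_eq c c₀ m, pathCol_eq c c₀ m'] at h
    rw [← coboundary_exts c c₀ hk hn hnk hv m, ← coboundary_exts c c₀ hk hn hnk hv' m']
    exact colorsOf_and_congr (fun x y hxy => by rw [hc.down x y hxy]) (hc.up _ _ h)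

end Stable

/-! ### Triangles -/

section Triangles

variable {U C : Type*} {G : SimpleGraph U} {p : ℕ∞} [Fintype U] {c : ElemPath G p → C} {c₀ : C}

/-- The boundary colours of a path along a triangle. -/
lemma boundaryColors_triangle {l : List U}
    {h : IsSimplePath G l ∧ (l.length : ℕ∞) ≤ p + 1} {u : ℕ → U} (hu : l = seg u 3)
    (hadj : G.Adj (u 0) (u 2)) : boundaryColors (pathBoundary G p) c (member l h) =
      {ed (pathCol c c₀) (u 0) (u 1)} + ({ed (pathCol c c₀) (u 1) (u 2)} +
        {ed (pathCol c c₀) (u 0) (u 2)}) := by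
  classical
  have hp : IsSimplePath G (seg u 3) := hu ▸ h.1
  rw [boundaryColors_member c c₀ hu, Finset.sum_range_succ, Finset.sum_range_succ,
    Finset.sum_range_one]
  rw [if_pos ((isSimplePath_er (by omega) (by omega) hp).2 (Or.inl rfl)),
    if_pos ((isSimplePath_er (by omega) (by omega) hp).2 (Or.inr (Or.inr hadj))),
    if_pos ((isSimplePath_er (by omega) (by omega) hp).2 (Or.inr (Or.inl rfl)))]
  have e0 : seg (er u 0) 2 = [u 1, u 2] := by simp [seg, er, List.range_succ]
  have e1 : seg (er u 1) 2 = [u 0, u 2] := by simp [seg, er, List.range_succ]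
  have e2 : seg (er u 2) 2 = [u 0, u 1] := by simp [seg, er, List.range_succ]
  rw [e0, e1, e2]
  simp only [ed]
  rw [add_comm]

/-- The path that runs through `v 0`, `v 1` and `z` so that deleting `z` gives the edge from
`v 0` to `v 1`; the index is the position of `z`. -/
def triPath (v : ℕ → U) (z : U) : Fin 3 → ℕ → U
  | 0, t => if t = 0 then z else v (t - 1)
  | 1, t => if t = 0 then v 0 else if t = 1 then z else v 1
  | 2, t => if t = 0 then v 0 else if t = 1 then v 1 else z

omit [Fintype U] in
lemma closes_two_iff {v : ℕ → U} {z : U} (hv : NP G v 2) :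
    Closes G v 2 z ↔ G.Adj (v 0) z ∧ G.Adj (v 1) z := by
  constructor
  · intro h
    exact ⟨(h.adj_new 0 (by omega)).2 (by omega), (h.adj_new 1 (by omega)).2 (by omega)⟩
  · rintro ⟨h0, h1⟩
    refine ⟨hv.inj, fun i j hi hj => ?_, fun i hi => ?_, fun i hi => ?_⟩
    · obtain rfl : i = 0 := by omega
      obtain rfl : j = 1 := by omega
      exact iff_of_true (hv.adj 0 (by omega)) rfl
    · interval_cases i
      exacts [h0.ne, h1.ne]
    · interval_cases i
      · exact iff_of_true h0 (by omega)
      · exact iff_of_true h1 (by omega)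

/-- The triangles on an edge with given edge colours are counted, three times each, by the
co-boundary members with these boundary colours. -/
lemma card_triangles {k : ℕ} (hpc : IsPathColoring G k (pathCol c c₀)) (hp : 2 ≤ p) {v : ℕ → U}
    (hv : NP G v 2) (h : IsSimplePath G (seg v 2) ∧ ((seg v 2).length : ℕ∞) ≤ p + 1)
    {χ : Multiset C} (hχ : χ.card = 3) :
    (colorsOf (fun δ => pathBoundary G p (member (seg v 2) h) δ ∧
      boundaryColors (pathBoundary G p) c δ = χ) c).card =
      3 * numClosing G (pathCol c c₀) v 2 fun χ' => χ' = χ := by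
  classical
  have := Fintype.ofFinite (ElemPath G p)
  have hcard : numClosing G (pathCol c c₀) v 2 (fun χ' => χ' = χ) =
      (Finset.univ.filter fun w => Closes G v 2 w ∧ closeCol (pathCol c c₀) v 2 w = χ).card := by
    rw [Finset.card_filter, numClosing]
    congr!
  have hlen : ((3 : ℕ) : ℕ∞) ≤ p + 1 := by
    have := add_le_add_left hp 1
    exact le_trans (by norm_num) this
  have hv01 := hv.adj 0 (by omega)
  have tri : ∀ z i, Closes G v 2 z → (IsSimplePath G (seg (triPath v z i) 3) ∧
      ((seg (triPath v z i) 3).length : ℕ∞) ≤ p + 1) ∧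
      G.Adj (triPath v z i 0) (triPath v z i 2) := by
    intro z i hz
    obtain ⟨h0, h1⟩ := (closes_two_iff hv).1 hz
    have e : ∀ u : ℕ → U, seg u 3 = [u 0, u 1, u 2] := fun u => by simp [seg, List.range_succ]
    rw [e]
    refine ⟨⟨?_, by simpa using hlen⟩, ?_⟩
    · have n0 := h0.ne
      have n1 := h1.ne
      have n2 := hv01.ne
      fin_cases i <;> simp [IsSimplePath, triPath, h0, h1, hv01, n0, n1, n2, h0.symm, h1.symm,
        n0.symm, n1.symm]
    · fin_cases i <;> simp [triPath]
      · exact h1.symm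
      · simpa using hv01
      · exact h0
  have hcol : ∀ z i, (hz : Closes G v 2 z) → boundaryColors (pathBoundary G p) c
      (member _ (tri z i hz).1) = closeCol (pathCol c c₀) v 2 z := by
    intro z i hz
    rw [boundaryColors_triangle (c₀ := c₀) rfl (tri z i hz).2]
    have c1 := ed_comm hpc (v 0) z
    have c2 := ed_comm hpc (v 1) z
    unfold closeCol E2
    rw [Finset.sum_range_one, win_two]
    fin_cases i
    · simp only [triPath]
      simp [c1, c2, add_comm, Multiset.cons_swap (ed (pathCol c c₀) z (v 1))]
    · simp only [triPath]
      simp [c1, c2, add_comm, Multiset.cons_swap (ed (pathCol c c₀) z (v 1))]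
    · simp only [triPath]
      simp
  have hmul : 3 * (Finset.univ.filter fun w => Closes G v 2 w ∧
      closeCol (pathCol c c₀) v 2 w = χ).card = ((Finset.univ.filter fun w => Closes G v 2 w ∧
      closeCol (pathCol c c₀) v 2 w = χ) ×ˢ (Finset.univ : Finset (Fin 3))).card := by
    rw [Finset.card_product, Finset.card_univ, Fintype.card_fin, mul_comm]
  rw [hcard, hmul, card_colorsOf, ← Finset.card_filter]
  symm
  refine Finset.card_bij (fun q hq => member _ (tri q.1 q.2
    (Finset.mem_filter.1 (Finset.mem_product.1 hq).1).2.1).1) ?_ ?_ ?_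
  · rintro ⟨z, i⟩ hq
    have hz := (Finset.mem_filter.1 (Finset.mem_product.1 hq).1).2
    simp only [Finset.mem_filter, Finset.mem_univ, true_and]
    refine ⟨?_, (hcol z i hz.1).trans hz.2⟩
    rw [pathBoundary_member rfl]
    have e : seg (er (triPath v z i) i) 2 = seg v 2 := by
      refine seg_congr fun t ht => ?_
      interval_cases t <;> fin_cases i <;> simp [er, triPath]
    exact ⟨i, by omega, by rwa [e], member_eq_iff.2 (Or.inl e.symm)⟩
  · rintro ⟨z, i⟩ hq ⟨z', i'⟩ hq' he
    have hz := ((closes_two_iff hv).1 (Finset.mem_filter.1 (Finset.mem_product.1 hq).1).2.1)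
    have hz' := ((closes_two_iff hv).1 (Finset.mem_filter.1 (Finset.mem_product.1 hq').1).2.1)
    have a0 := hz.1.ne
    have a1 := hz.2.ne
    have b0 := hz'.1.ne
    have b1 := hz'.2.ne
    have n2 := hv01.ne
    simp only [zero_add] at n2
    have e : ∀ u : ℕ → U, seg u 3 = [u 0, u 1, u 2] := fun u => by simp [seg, List.range_succ]
    have he' := member_eq_iff.1 he
    simp only [e] at he'
    clear he hq hq' hz hz'
    fin_cases i <;> fin_cases i' <;> simp [triPath] at he' ⊢ <;> grind
  · intro δ hδ
    simp only [Finset.mem_filter, Finset.mem_univ, true_and] at hδ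
    obtain ⟨h1, h2⟩ := hδ
    obtain ⟨l, hl, rfl⟩ := exists_member δ
    obtain ⟨u, hu⟩ := exists_seg hl.1.1
    obtain ⟨m, hm⟩ : ∃ m, l.length = m + 1 :=
      ⟨l.length - 1, by have := List.length_pos_iff.2 hl.1.1; omega⟩
    rw [hm] at hu
    obtain ⟨i, hi, h', he⟩ := (pathBoundary_member hu).1 h1
    have h3 := member_eq_iff.1 he
    have hm2 : m = 2 := by
      have h4 : (seg v 2).length = (seg (er u i) m).length := by
        rcases h3 with h3 | h3 <;> simp [h3]
      simpa [length_seg] using h4.symm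
    subst hm2
    have hadj : G.Adj (u 0) (u 2) := by
      by_contra hn
      have hsp := isSimplePath_seg.1 (hu ▸ hl.1)
      have hnp : NP G u 3 := ⟨hsp.2.1, hsp.2.2, fun j hj => by
        obtain rfl : j = 0 := by omega
        exact hn⟩
      have := boundaryColors_of_NP c c₀ (h := hl) (by omega) hu hnp
      rw [h2] at this
      have := congrArg Multiset.card this
      simp [hχ] at this
    have hsp := (isSimplePath_seg.1 (hu ▸ hl.1)).2.2
    have g0 := hsp 0 (by omega)
    have g1 := hsp 1 (by omega)
    simp only [zero_add, Nat.reduceAdd] at g0 g1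
    have hz : Closes G v 2 (u i) ∧ ∃ j, l = seg (triPath v (u i) j) 3 ∨
        l = (seg (triPath v (u i) j) 3).reverse := by
      have e3 : ∀ u : ℕ → U, seg u 3 = [u 0, u 1, u 2] := fun u => by simp [seg, List.range_succ]
      have e2 : ∀ u : ℕ → U, seg u 2 = [u 0, u 1] := fun u => by simp [seg, List.range_succ]
      rw [closes_two_iff hv, hu]
      simp only [e3, e2] at h3 ⊢
      rcases h3 with h3 | h3 <;> interval_cases i <;> simp [er] at h3 <;>
        simp only [h3.1, h3.2]
      · exact ⟨⟨g0.symm, hadj.symm⟩, 0, by simp [triPath, h3]⟩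
      · exact ⟨⟨g0, g1.symm⟩, 1, by simp [triPath, h3]⟩
      · exact ⟨⟨hadj, g1⟩, 2, by simp [triPath, h3]⟩
      · exact ⟨⟨hadj.symm, g0.symm⟩, 2, by simp [triPath, h3]⟩
      · exact ⟨⟨g1.symm, g0⟩, 1, by simp [triPath, h3]⟩
      · exact ⟨⟨g1, hadj⟩, 0, by simp [triPath, h3]⟩
    obtain ⟨hz, j, hj⟩ := hz
    have hmem : member l hl = member _ (tri (u i) j hz).1 := member_eq_iff.2 hj
    refine ⟨(u i, j), ?_, hmem.symm⟩
    simp only [Finset.mem_product, Finset.mem_filter, Finset.mem_univ, true_and, and_true]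
    exact ⟨hz, by rw [← hcol _ j hz, ← hmem, h2]⟩

/-- The colour of an edge determines the number of induced cycles of each size up to `k` through
the edge with given edge colours. -/
lemma numCycles_edge_eq {k : ℕ} (hc : IsEquitable (pathBoundary G p) c) (hk : (k : ℕ∞) ≤ p)
    {m : ℕ} (hm : 3 ≤ m) (hmk : m ≤ k) (χ : Multiset C) {v v' : ℕ → U} (hv : NP G v 2)
    (hv' : NP G v' 2) (h : pathCol c c₀ (seg v 2) = pathCol c c₀ (seg v' 2)) :
    numCycles G (pathCol c c₀) m χ v 2 = numCycles G (pathCol c c₀) m χ v' 2 := by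
  classical
  have hpc := hc.isPathColoring c₀ hk
  rcases Nat.lt_or_ge 3 m with hm4 | hm3
  · exact numCycles_eq hpc hmk χ le_rfl (by omega) hm4 hv hv' h
  · obtain rfl : m = 3 := by omega
    rw [numCycles_eq_numClosing hpc χ le_rfl hv, numCycles_eq_numClosing hpc χ le_rfl hv']
    by_cases hχ : χ.card = 3
    · have hp : (2 : ℕ∞) ≤ p := le_trans (by exact_mod_cast (by omega : 2 ≤ k)) hk
      have hlen : ((2 : ℕ) : ℕ∞) ≤ p + 1 := le_trans hp le_self_add
      have m1 : IsSimplePath G (seg v 2) ∧ ((seg v 2).length : ℕ∞) ≤ p + 1 :=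
        ⟨hv.isSimplePath (by omega), by rwa [length_seg]⟩
      have m2 : IsSimplePath G (seg v' 2) ∧ ((seg v' 2).length : ℕ∞) ≤ p + 1 :=
        ⟨hv'.isSimplePath (by omega), by rwa [length_seg]⟩
      have t1 := card_triangles hpc hp hv m1 hχ
      have t2 := card_triangles hpc hp hv' m2 hχ
      rw [pathCol_eq c c₀ m1, pathCol_eq c c₀ m2] at h
      rw [colorsOf_and_congr (fun x y hxy => by rw [hc.down x y hxy]) (hc.up _ _ h), t2] at t1
      omega
    · have hz : ∀ u : ℕ → U, numClosing G (pathCol c c₀) u 2 (fun χ' => χ' = χ) = 0 := by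
        intro u
        refine Finset.sum_eq_zero fun w _ => if_neg ?_
        rintro ⟨-, rfl⟩
        exact hχ (by simp [closeCol, E2])
      rw [hz, hz]

end Triangles

/-! ### The induced colouring of the cells -/

section Cells

lemma colorsOf_pair {ι C : Type*} [Finite ι] {P : ι → Prop} {a b : ι} (hab : a ≠ b)
    (h : ∀ x, P x ↔ x = a ∨ x = b) (c : ι → C) : colorsOf P c = {c a} + {c b} := by
  classical
  have := Fintype.ofFinite ι
  have hf : Finset.univ.filter P = {a, b} := by
    ext x
    simp [h]
  rw [colorsOf_eq_sum, ← Finset.sum_filter, hf, Finset.sum_pair hab]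

lemma colorsOf_false {ι C : Type*} [Finite ι] {P : ι → Prop} (h : ∀ x, ¬ P x) (c : ι → C) :
    colorsOf P c = 0 := by
  rw [Multiset.eq_zero_iff_forall_notMem]
  intro a ha
  obtain ⟨x, hx, -⟩ := (mem_colorsOf _ _ _).1 ha
  exact h x hx

variable {U C : Type*} {G : SimpleGraph U} {p : ℕ∞} [Fintype U] {k : ℕ}

/-- The colours of the cells obtained from a colouring of paths: vertices and edges keep their
colours as paths, and a 2-cell gets the colours of its edges. -/
noncomputable def cellCol (G : SimpleGraph U) (k : ℕ) (col : List U → C) :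
    Cell G k → C ⊕ C ⊕ Multiset C
  | .inl v => .inl (col [v])
  | .inr (.inl e) => .inr (.inl (edgeCol col e))
  | .inr (.inr s) => .inr (.inr (setCol G col s.1))

/-- The vertex `a`, followed by the vertex `b`. -/
def pairSeq (a b : U) : ℕ → U := fun t => if t = 0 then a else b

omit [Fintype U] in
lemma seg_pairSeq (a b : U) : seg (pairSeq a b) 2 = [a, b] := by
  simp [seg, pairSeq, List.range_succ]

omit [Fintype U] in
lemma NP_pairSeq {a b : U} (h : G.Adj a b) : NP G (pairSeq a b) 2 where
  inj i j hi hj := by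
    obtain rfl : i = 0 := by omega
    obtain rfl : j = 1 := by omega
    exact h.ne
  adj i hi := by
    obtain rfl : i = 0 := by omega
    exact h
  nadj i hi := by omega

lemma setCol_eq (col : List U → C) (s : Finset U) :
    setCol G col s = colorsOf (fun e : Sym2 U => e ∈ G.edgeSet ∧ ∀ x ∈ e, x ∈ s)
      (edgeCol col) := by
  classical
  rw [colorsOf_eq_sum]
  rfl

/-- A condition on the vertices. -/
lemma colorsOf_vertices {X : Type*} (f : Cell G k → X) {Q : Cell G k → Prop}
    (h : ∀ τ, Q τ → ∃ v, τ = .inl v) :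
    colorsOf Q f = colorsOf (fun v => Q (.inl v)) fun v => f (.inl v) :=
  colorsOf_comp Sum.inl_injective (fun τ hτ => by
    obtain ⟨v, rfl⟩ := h τ hτ
    exact ⟨v, rfl⟩) f

/-- A condition on the edges, as a condition on unordered pairs. -/
lemma colorsOf_edges (col : List U → C) {Q : Cell G k → Prop} {Q' : Sym2 U → Prop}
    (h : ∀ τ, Q τ → ∃ e, τ = .inr (.inl e)) (h' : ∀ e, Q (.inr (.inl e)) ↔ Q' e) :
    colorsOf Q (cellCol G k col) =
      (colorsOf (fun e => e ∈ G.edgeSet ∧ Q' e) (edgeCol col)).map fun a => .inr (.inl a) := by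
  rw [colorsOf_comp (φ := fun e : G.edgeSet => (Sum.inr (Sum.inl e) : Cell G k))
    (fun a b hab => Sum.inl_injective (Sum.inr_injective hab)) (fun τ hτ => by
    obtain ⟨v, rfl⟩ := h τ hτ
    exact ⟨v, rfl⟩), colorsOf_comp (φ := fun e : G.edgeSet => (e : Sym2 U))
    Subtype.val_injective (fun e he => ⟨⟨e, he.1⟩, rfl⟩), map_colorsOf]
  exact colorsOf_congr (fun e => by rw [h']; exact ⟨fun hq => ⟨e.2, hq⟩, fun hq => hq.2⟩)
    fun _ _ => rfl

/-- A condition on the 2-cells, as a condition on vertex sets. -/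
lemma colorsOf_cycles (col : List U → C) {Q : Cell G k → Prop} {Q' : Finset U → Prop}
    (h : ∀ τ, Q τ → ∃ s, τ = .inr (.inr s)) (h' : ∀ s, Q (.inr (.inr s)) ↔ Q' s.1) :
    colorsOf Q (cellCol G k col) =
      (colorsOf (fun s => (IsInducedCycle G s ∧ s.card ≤ k) ∧ Q' s) (setCol G col)).map
        fun a => .inr (.inr a) := by
  rw [colorsOf_comp (φ := fun s : {s : Finset U // IsInducedCycle G s ∧ s.card ≤ k} =>
      (Sum.inr (Sum.inr s) : Cell G k))
    (fun a b hab => Sum.inr_injective (Sum.inr_injective hab)) (fun τ hτ => by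
    obtain ⟨v, rfl⟩ := h τ hτ
    exact ⟨v, rfl⟩), colorsOf_comp
    (φ := fun s : {s : Finset U // IsInducedCycle G s ∧ s.card ≤ k} => s.1)
    Subtype.val_injective (fun e he => ⟨⟨e, he.1⟩, rfl⟩), map_colorsOf]
  exact colorsOf_congr (fun e => by rw [h']; exact ⟨fun hq => ⟨e.2, hq⟩, fun hq => hq.2⟩)
    fun _ _ => rfl

omit [Fintype U] in
/-- The vertices of an induced cycle in cyclic order, as a sequence. -/
lemma IsInducedCycle.exists_cyclic {s : Finset U} (hs : IsInducedCycle G s) :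
    ∃ y : ℕ → U, J G y s.card ∧ Cl G y s.card ∧ s = verts y s.card := by
  obtain ⟨e, -, hes, hadj⟩ := hs.exists_zmod rfl
  have h : G.Adj (e 0) (e 1) := (hadj 0 1).2 (Or.inr (by ring))
  obtain ⟨y, h1, h2, h3, -⟩ := hs.exists_reading le_rfl (NP_pairSeq h) (fun t _ => by
    unfold pairSeq
    split_ifs
    exacts [(hes _).2 ⟨0, rfl⟩, (hes _).2 ⟨1, rfl⟩])
  exact ⟨y, h1, h2, h3⟩

lemma IsInducedCycle.card_setCol {s : Finset U} (hs : IsInducedCycle G s) {col : List U → C}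
    (hpc : IsPathColoring G k col) : (setCol G col s).card = s.card := by
  obtain ⟨y, h1, h2, h3⟩ := hs.exists_cyclic
  have h4 := h1.setCol_verts hpc hs.1 h2
  rw [← h3] at h4
  have := hs.1
  rw [h4]
  simp only [cycCol, E2, Multiset.card_add, Multiset.card_sum, Multiset.card_singleton,
    Finset.sum_const, Finset.card_range, smul_eq_mul, mul_one]
  omega

variable {c : ElemPath G p → C} {c₀ : C}

/-- The co-boundary members of a vertex are the edges at this vertex. -/
lemma coboundaryColors_vertex (hp : 1 ≤ p) {v : U}
    (h : IsSimplePath G [v] ∧ (([v] : List U).length : ℕ∞) ≤ p + 1) :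
    coboundaryColors (pathBoundary G p) c (member [v] h) =
      colorsOf (fun w => G.Adj v w) (ed (pathCol c c₀) v) := by
  have hlen : ((2 : ℕ) : ℕ∞) ≤ p + 1 := le_trans (by norm_num) (add_le_add_left hp 1)
  have hm : ∀ w, G.Adj v w → IsSimplePath G [v, w] ∧ (([v, w] : List U).length : ℕ∞) ≤ p + 1 :=
    fun w hw => ⟨⟨by simp, by simpa using hw.ne, by simpa using hw⟩, hlen⟩
  rw [coboundaryColors, colorsOf_comp (φ := fun w : {w // G.Adj v w} => member _ (hm w w.2)),
    colorsOf_comp (φ := fun w : {w // G.Adj v w} => (w : U)) Subtype.val_injective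
      (fun w hw => ⟨⟨w, hw⟩, rfl⟩)]
  · refine colorsOf_congr (fun w => iff_of_true ?_ w.2) fun w _ =>
      (pathCol_eq c c₀ (hm w w.2)).symm
    rw [pathBoundary_member (seg_pairSeq v w).symm]
    have e : seg (er (pairSeq v (w : U)) 1) 1 = [v] := by simp [seg, er, pairSeq]
    exact ⟨1, le_rfl, by rwa [e], member_eq_iff.2 (Or.inl e.symm)⟩
  · intro w w' he
    have := w.2.ne
    have := w'.2.ne
    rcases member_eq_iff.1 he with h' | h'
    · exact Subtype.ext (by simpa using h')
    · simp at h'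
      exact absurd h'.1 w'.2.ne
  · intro δ hδ
    obtain ⟨l, hl, rfl⟩ := exists_member δ
    obtain ⟨u, hu⟩ := exists_seg hl.1.1
    obtain ⟨m, hm'⟩ : ∃ m, l.length = m + 1 :=
      ⟨l.length - 1, by have := List.length_pos_iff.2 hl.1.1; omega⟩
    rw [hm'] at hu
    obtain ⟨i, hi, h', he⟩ := (pathBoundary_member hu).1 hδ
    have h3 := member_eq_iff.1 he
    have hm1 : m = 1 := by
      have h4 : ([v] : List U).length = (seg (er u i) m).length := by
        rcases h3 with h3 | h3 <;> simp [h3]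
      simpa [length_seg] using h4.symm
    subst hm1
    have h5 : v = er u i 0 := by
      rcases h3 with h3 | h3 <;> simpa [seg] using h3
    have hadj := (isSimplePath_seg.1 (hu ▸ hl.1)).2.2 0 (by omega)
    have e : seg u 2 = [u 0, u 1] := by simp [seg, List.range_succ]
    interval_cases i
    · have h6 : v = u 1 := by simpa [er] using h5
      refine ⟨⟨u 0, by rw [h6]; exact hadj.symm⟩, member_eq_iff.2 (Or.inr ?_)⟩
      rw [hu, e]
      simp [h6]
    · have h6 : v = u 0 := by simpa [er] using h5
      refine ⟨⟨u 1, by rw [h6]; exact hadj⟩, member_eq_iff.2 (Or.inl ?_)⟩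
      rw [hu, e]
      simp [h6]

omit [Fintype U] in
lemma isSimplePath_singleton (v : U) :
    IsSimplePath G [v] ∧ (([v] : List U).length : ℕ∞) ≤ p + 1 :=
  ⟨⟨by simp, by simp, by simp⟩, by simp⟩

/-- The colour of an edge determines the edge colours of the 2-cells at this edge. -/
lemma colorsOf_cycles_at_edge (hc : IsEquitable (pathBoundary G p) c) (hk : (k : ℕ∞) ≤ p)
    {e e' : Sym2 U} (he : e ∈ G.edgeSet) (he' : e' ∈ G.edgeSet)
    (h : edgeCol (pathCol c c₀) e = edgeCol (pathCol c c₀) e') :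
    colorsOf (fun s => (IsInducedCycle G s ∧ s.card ≤ k) ∧ ∀ x ∈ e, x ∈ s)
        (setCol G (pathCol c c₀)) =
      colorsOf (fun s => (IsInducedCycle G s ∧ s.card ≤ k) ∧ ∀ x ∈ e', x ∈ s)
        (setCol G (pathCol c c₀)) := by
  classical
  have hpc := hc.isPathColoring c₀ hk
  induction e with | _ a b
  induction e' with | _ a' b'
  rw [edgeCol_mk hpc, edgeCol_mk hpc] at h
  ext χ
  rw [count_colorsOf, count_colorsOf]
  have key : ∀ a b, G.Adj a b → (∑ s : Finset U, if ((IsInducedCycle G s ∧ s.card ≤ k) ∧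
      ∀ x ∈ s(a, b), x ∈ s) ∧ setCol G (pathCol c c₀) s = χ then 1 else 0) =
      if 3 ≤ χ.card ∧ χ.card ≤ k then
        numCycles G (pathCol c c₀) χ.card χ (pairSeq a b) 2 else 0 := by
    intro a b hab
    by_cases hχ : 3 ≤ χ.card ∧ χ.card ≤ k
    · rw [if_pos hχ, numCycles]
      refine Finset.sum_congr rfl fun s _ => if_congr ?_ rfl rfl
      have hv : (∀ t < 2, pairSeq a b t ∈ s) ↔ ∀ x ∈ s(a, b), x ∈ s := by
        simp only [Sym2.mem_iff, forall_eq_or_imp, forall_eq]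
        exact ⟨fun h => ⟨h 0 (by omega), h 1 (by omega)⟩, fun h t ht => by
          interval_cases t
          exacts [h.1, h.2]⟩
      rw [hv]
      constructor
      · rintro ⟨⟨⟨h1, h2⟩, h3⟩, h4⟩
        exact ⟨⟨h1, by rw [← h4, h1.card_setCol hpc], h4⟩, h3⟩
      · rintro ⟨⟨h1, h2, h3⟩, h4⟩
        exact ⟨⟨⟨h1, by omega⟩, h4⟩, h3⟩
    · rw [if_neg hχ]
      refine Finset.sum_eq_zero fun s _ => if_neg ?_
      rintro ⟨⟨⟨h1, h2⟩, h3⟩, rfl⟩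
      rw [h1.card_setCol hpc] at hχ
      exact hχ ⟨h1.1, h2⟩
  rw [key a b he, key a' b' he']
  split_ifs with hχ
  · exact numCycles_edge_eq hc hk hχ.1 hχ.2 χ (NP_pairSeq he) (NP_pairSeq he')
      (by rw [seg_pairSeq, seg_pairSeq]; exact h)
  · rfl

/-- The colouring of the cells obtained from an equitable colouring of paths is equitable. -/
lemma cellCol_equitable (hc : IsEquitable (pathBoundary G p) c) (hk3 : 3 ≤ k)
    (hk : (k : ℕ∞) ≤ p) : IsEquitable (cellBoundary G k) (cellCol G k (pathCol c c₀)) := by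
  have hpc := hc.isPathColoring c₀ hk
  have hp : 1 ≤ p := le_trans (by exact_mod_cast (by omega : 1 ≤ k)) hk
  set col := pathCol c c₀ with hcol
  constructor
  · rintro (v | e | s) (v' | e' | s') h
    all_goals simp only [cellCol, Sum.inl.injEq, Sum.inr.injEq, reduceCtorEq] at h
    · rw [boundaryColors, boundaryColors, colorsOf_false, colorsOf_false]
      all_goals rintro (_ | _ | _) h' <;> exact h'
    · have key : ∀ a b : U, (hab : G.Adj a b) → boundaryColors (cellBoundary G k) (cellCol G k col)
          (.inr (.inl ⟨s(a, b), hab⟩)) = {.inl (col [a])} + {.inl (col [b])} := by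
        intro a b hab
        rw [boundaryColors, colorsOf_vertices]
        · exact colorsOf_pair hab.ne (fun x => Sym2.mem_iff) _
        · rintro (v | e | s) hτ
          exacts [⟨v, rfl⟩, hτ.elim, hτ.elim]
      obtain ⟨e, he⟩ := e
      obtain ⟨e', he'⟩ := e'
      induction e with | _ a b
      induction e' with | _ a' b'
      rw [key a b he, key a' b' he']
      rw [edgeCol_mk hpc, edgeCol_mk hpc] at h
      have hd := hpc.down 1 _ _ le_rfl (by omega) (NP_pairSeq he) (NP_pairSeq he')
        (by rw [seg_pairSeq, seg_pairSeq]; exact h)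
      have e1 : ∀ a b : U, seg (pairSeq a b) 1 = [a] := fun a b => by simp [seg, pairSeq]
      have e2 : ∀ a b : U, seg (sh (pairSeq a b) 1) 1 = [b] := fun a b => by
        simp [seg, pairSeq, sh]
      rw [e1, e1, e2, e2] at hd
      rcases Sym2.eq_iff.1 hd with ⟨h1, h2⟩ | ⟨h1, h2⟩
      · rw [h1, h2]
      · rw [h1, h2, add_comm]
    · have key : ∀ s, boundaryColors (cellBoundary G k) (cellCol G k col) (.inr (.inr s)) =
          (setCol G col s.1).map fun a => .inr (.inl a) := by
        intro s
        rw [boundaryColors, colorsOf_edges col (Q' := fun e => ∀ x ∈ e, x ∈ s.1), setCol_eq]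
        · rintro (v | e | s) hτ
          exacts [hτ.elim, ⟨e, rfl⟩, hτ.elim]
        · exact fun e => Iff.rfl
      rw [key, key, h]
  · rintro (v | e | s) (v' | e' | s') h
    all_goals simp only [cellCol, Sum.inl.injEq, Sum.inr.injEq, reduceCtorEq] at h
    · have key : ∀ v, coboundaryColors (cellBoundary G k) (cellCol G k col) (.inl v) =
          (colorsOf (fun w => G.Adj v w) (ed col v)).map fun a => .inr (.inl a) := by
        intro v
        rw [coboundaryColors, colorsOf_edges col (Q' := fun e => v ∈ e)]
        · rw [colorsOf_comp (φ := fun w => s(v, w)) (fun a b hab => Sym2.congr_right.1 hab)]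
          · congr 1
            refine colorsOf_congr (fun w => ?_) fun w _ => edgeCol_mk hpc v w
            simp
          · rintro e ⟨-, hv⟩
            obtain ⟨w, rfl⟩ := hv
            exact ⟨w, rfl⟩
        · rintro (v | e | s) hτ
          exacts [hτ.elim, ⟨e, rfl⟩, hτ.elim]
        · exact fun e => Iff.rfl
      rw [hcol, pathCol_eq c c₀ (isSimplePath_singleton v),
        pathCol_eq c c₀ (isSimplePath_singleton v')] at h
      have hu := hc.up _ _ h
      rw [coboundaryColors_vertex (c₀ := c₀) hp, coboundaryColors_vertex (c₀ := c₀) hp] at hu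
      rw [key, key, hcol, hu]
    · have key : ∀ e : G.edgeSet, coboundaryColors (cellBoundary G k) (cellCol G k col)
          (.inr (.inl e)) = (colorsOf (fun s => (IsInducedCycle G s ∧ s.card ≤ k) ∧
            ∀ x ∈ (e : Sym2 U), x ∈ s) (setCol G col)).map fun a => .inr (.inr a) := by
        intro e
        rw [coboundaryColors, colorsOf_cycles col (Q' := fun s => ∀ x ∈ (e : Sym2 U), x ∈ s)]
        · rintro (v | e | s) hτ
          exacts [hτ.elim, hτ.elim, ⟨s, rfl⟩]
        · exact fun e => Iff.rfl
      rw [key, key, colorsOf_cycles_at_edge hc hk e.2 e'.2 h]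
    · rw [coboundaryColors, coboundaryColors, colorsOf_false, colorsOf_false]
      all_goals rintro (_ | _ | _) h' <;> exact h'

end Cells

/-! ### Histograms on unions of connected components -/

section Histograms

lemma colorsOf_eq_of_factor {ι X Y : Type*} [Finite ι] {S Q Q' : ι → Prop} {f : ι → X} {d : ι → Y}
    (hd : ∀ x y, S x → S y → f x = f y → d x = d y) (hQ : ∀ x, Q x → S x) (hQ' : ∀ x, Q' x → S x)
    (h : colorsOf Q f = colorsOf Q' f) : colorsOf Q d = colorsOf Q' d := by
  obtain ⟨g, hg⟩ := exists_factor (f := fun x : {x // S x} => f x) (d := fun x => d x)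
    fun x y => hd x y x.2 y.2
  have key : ∀ R : ι → Prop, (∀ x, R x → S x) →
      (colorsOf R d).map some = (colorsOf R f).map g := by
    intro R hR
    rw [map_colorsOf, map_colorsOf]
    exact colorsOf_congr (fun _ => Iff.rfl) fun x hx => (hg ⟨x, hR x hx⟩).symm
  exact Multiset.map_injective (Option.some_injective Y) (by rw [key Q hQ, key Q' hQ', h])

lemma colorsOf_and_add {ι X : Type*} [Finite ι] (Q S : ι → Prop) (f : ι → X) :
    colorsOf Q f = colorsOf (fun x => Q x ∧ S x) f + colorsOf (fun x => Q x ∧ ¬ S x) f := by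
  classical
  have := Fintype.ofFinite ι
  rw [colorsOf_eq_sum, colorsOf_eq_sum, colorsOf_eq_sum, ← Finset.sum_add_distrib]
  refine Finset.sum_congr rfl fun x _ => ?_
  by_cases h : Q x <;> by_cases h' : S x <;> simp [h, h']

lemma sum_colorsOf {ι : Type*} [Fintype ι] (P : ι → Prop) [DecidablePred P] (f : ι → ℕ) :
    (colorsOf P f).sum = ∑ x, if P x then f x else 0 := by
  rw [colorsOf_eq, ← Finset.sum_filter, Finset.sum]

variable {U C : Type*} {G : SimpleGraph U} {p : ℕ∞} [Fintype U] {k : ℕ}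
  {c : ElemPath G p → C} {c₀ : C}

/-- In an equitable colouring, members of the same colour have the same dimension. -/
lemma IsEquitable.length_eq (hc : IsEquitable (pathBoundary G p) c) (n : ℕ) :
    ∀ {l l' : List U} {h : IsSimplePath G l ∧ (l.length : ℕ∞) ≤ p + 1}
      {h' : IsSimplePath G l' ∧ (l'.length : ℕ∞) ≤ p + 1}, l.length = n + 1 →
      c (member l h) = c (member l' h') → l'.length = n + 1 := by
  have low : ∀ {l : List U} (h : IsSimplePath G l ∧ (l.length : ℕ∞) ≤ p + 1) {m : ℕ},
      l.length = m + 2 → ∃ l₁ h₁, l₁.length = m + 1 ∧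
        pathBoundary G p (member l₁ h₁) (member l h) := by
    intro l h m hl
    obtain ⟨u, hu⟩ := exists_seg h.1.1
    rw [hl] at hu
    have h1 : IsSimplePath G (seg (er u 0) (m + 1)) :=
      (isSimplePath_er (Nat.zero_le _) (by omega) (hu ▸ h.1)).2 (Or.inl rfl)
    have h2 : ((seg (er u 0) (m + 1)).length : ℕ∞) ≤ p + 1 := by
      refine le_trans ?_ h.2
      rw [length_seg, hl]
      exact_mod_cast Nat.le_succ _
    exact ⟨_, ⟨h1, h2⟩, length_seg _ _, (pathBoundary_member hu).2 ⟨0, Nat.zero_le _, _, rfl⟩⟩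
  have up : ∀ {l : List U} (h : IsSimplePath G l ∧ (l.length : ℕ∞) ≤ p + 1) {τ : ElemPath G p},
      pathBoundary G p τ (member l h) → ∃ l₁ h₁, τ = member l₁ h₁ ∧ l.length = l₁.length + 1 := by
    intro l h τ hτ
    obtain ⟨u, hu⟩ := exists_seg h.1.1
    obtain ⟨m, hm⟩ : ∃ m, l.length = m + 1 :=
      ⟨l.length - 1, by have := List.length_pos_iff.2 h.1.1; omega⟩
    rw [hm] at hu
    obtain ⟨i, -, h', rfl⟩ := (pathBoundary_member hu).1 hτ
    exact ⟨_, h', rfl, by rw [hm, length_seg]⟩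
  have transfer : ∀ {l l' : List U} {h : IsSimplePath G l ∧ (l.length : ℕ∞) ≤ p + 1}
      {h' : IsSimplePath G l' ∧ (l'.length : ℕ∞) ≤ p + 1} {m : ℕ}, l.length = m + 2 →
      c (member l h) = c (member l' h') → ∃ l₁ h₁ l₁' h₁', l₁.length = m + 1 ∧
        c (member l₁ h₁) = c (member l₁' h₁') ∧ l'.length = l₁'.length + 1 := by
    intro l l' h h' m hl he
    obtain ⟨l₁, h₁, hl₁, hb⟩ := low h hl
    have hmem : c (member l₁ h₁) ∈ boundaryColors (pathBoundary G p) c (member l' h') := by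
      rw [← hc.down _ _ he]
      exact (mem_colorsOf _ _ _).2 ⟨_, hb, rfl⟩
    obtain ⟨τ, hτ, hcτ⟩ := (mem_colorsOf _ _ _).1 hmem
    obtain ⟨l₁', h₁', rfl, hl'⟩ := up h' hτ
    exact ⟨l₁, h₁, l₁', h₁', hl₁, hcτ.symm, hl'⟩
  induction n with
  | zero =>
    intro l l' h h' hl he
    by_contra hne
    have hpos := List.length_pos_iff.2 h'.1.1
    obtain ⟨m, hm⟩ : ∃ m, l'.length = m + 2 := ⟨l'.length - 2, by omega⟩
    obtain ⟨-, -, l₁, h₁, -, -, hl₁⟩ := transfer hm he.symm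
    have := List.length_pos_iff.2 h₁.1.1
    omega
  | succ n ih =>
    intro l l' h h' hl he
    obtain ⟨l₁, h₁, l₁', h₁', hl₁, he₁, hl'⟩ := transfer hl he
    rw [hl', ih hl₁ he₁]

/-- The members with `n` vertices. -/
def HasLength (n : ℕ) (σ : ElemPath G p) : Prop := ∃ l h, σ = member l h ∧ l.length = n

omit [Fintype U] in
lemma hasLength_member {l : List U} {h : IsSimplePath G l ∧ (l.length : ℕ∞) ≤ p + 1} {n : ℕ} :
    HasLength n (member l h) ↔ l.length = n := by
  constructor
  · rintro ⟨l', h', he, rfl⟩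
    rcases member_eq_iff.1 he with rfl | rfl <;> simp
  · exact fun hl => ⟨l, h, rfl, hl⟩

lemma IsEquitable.hasLength_iff (hc : IsEquitable (pathBoundary G p) c) {n : ℕ} :
    ∀ σ τ, c σ = c τ → (HasLength n σ ↔ HasLength n τ) := by
  intro σ τ he
  obtain ⟨l, h, rfl⟩ := exists_member σ
  obtain ⟨l', h', rfl⟩ := exists_member τ
  rw [hasLength_member, hasLength_member]
  have h1 := List.length_pos_iff.2 h.1.1
  have h2 := List.length_pos_iff.2 h'.1.1
  obtain _ | n := n
  · omega
  · exact ⟨fun hl => hc.length_eq n hl he, fun hl => hc.length_eq n hl he.symm⟩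

/-- The members of the path complex with all vertices in `A`. -/
def PathsIn (A : U → Prop) (σ : ElemPath G p) : Prop := ∃ l h, σ = member l h ∧ ∀ x ∈ l, A x

omit [Fintype U] in
lemma pathsIn_member {A : U → Prop} {l : List U}
    {h : IsSimplePath G l ∧ (l.length : ℕ∞) ≤ p + 1} :
    PathsIn A (member l h) ↔ ∀ x ∈ l, A x := by
  constructor
  · rintro ⟨l', h', he, hA⟩
    rcases member_eq_iff.1 he with rfl | rfl
    exacts [hA, fun x hx => hA x (List.mem_reverse.1 hx)]
  · exact fun hl => ⟨l, h, rfl, hl⟩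

/-- The cells with all vertices in `A`. -/
def CellsIn (A : U → Prop) : Cell G k → Prop
  | .inl v => A v
  | .inr (.inl e) => ∀ x ∈ (e : Sym2 U), A x
  | .inr (.inr s) => ∀ x ∈ s.1, A x

lemma colorsOf_pathsIn_vertices (A : U → Prop) :
    colorsOf (fun σ => PathsIn A σ ∧ HasLength 1 σ) c = colorsOf A fun v => pathCol c c₀ [v] := by
  rw [colorsOf_comp (φ := fun v => member [v] (isSimplePath_singleton v))]
  · refine colorsOf_congr (fun v => ?_) fun v _ => (pathCol_eq c c₀ _).symm
    simp [pathsIn_member, hasLength_member]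
  · intro v w h
    rcases member_eq_iff.1 h with h | h <;> simpa using h
  · rintro σ ⟨-, l, h, rfl, hl⟩
    obtain ⟨v, rfl⟩ := List.length_eq_one_iff.1 hl
    exact ⟨v, rfl⟩

lemma colorsOf_pathsIn_edges (hp : 1 ≤ p) (A : U → Prop) :
    colorsOf (fun σ => PathsIn A σ ∧ HasLength 2 σ) c =
      colorsOf (fun e => e ∈ G.edgeSet ∧ ∀ x ∈ e, A x) (edgeCol (pathCol c c₀)) := by
  have hout : ∀ e : Sym2 U, s(e.out.1, e.out.2) = e := fun e => Quot.out_eq e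
  have hm : ∀ e : G.edgeSet, IsSimplePath G [e.1.out.1, e.1.out.2] ∧
      (([e.1.out.1, e.1.out.2] : List U).length : ℕ∞) ≤ p + 1 := by
    intro e
    have hadj : G.Adj e.1.out.1 e.1.out.2 := by
      rw [← SimpleGraph.mem_edgeSet, hout]
      exact e.2
    exact ⟨⟨by simp, by simpa using hadj.ne, by simpa using hadj⟩,
      le_trans (by norm_num) (add_le_add_left hp 1)⟩
  rw [colorsOf_comp (φ := fun e : G.edgeSet => member _ (hm e)),
    colorsOf_comp (φ := fun e : G.edgeSet => (e : Sym2 U)) Subtype.val_injective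
      (fun e he => ⟨⟨e, he.1⟩, rfl⟩)]
  · refine colorsOf_congr (fun e => ?_) fun e _ => (pathCol_eq c c₀ (hm e)).symm
    rw [pathsIn_member, hasLength_member]
    have h2 : (∀ x ∈ (e : Sym2 U), A x) ↔ ∀ x ∈ [e.1.out.1, e.1.out.2], A x := by
      have hx : ∀ x, x ∈ (e : Sym2 U) ↔ x = e.1.out.1 ∨ x = e.1.out.2 := by
        intro x
        conv_lhs => rw [← hout e.1]
        exact Sym2.mem_iff
      simp [hx]
    rw [h2]
    exact ⟨fun h => ⟨e.2, h.1⟩, fun h => ⟨h.2, rfl⟩⟩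
  · intro e e' h
    apply Subtype.ext
    rw [← hout e.1, ← hout e'.1]
    rcases member_eq_iff.1 h with h | h
    · rw [List.cons.injEq, List.cons.injEq] at h
      rw [h.1, h.2.1]
    · simp only [List.reverse_cons, List.reverse_nil, List.nil_append, List.cons_append,
        List.cons.injEq, and_true] at h
      rw [h.1, h.2, Sym2.eq_swap]
  · rintro σ ⟨-, l, h, rfl, hl⟩
    obtain ⟨a, b, rfl⟩ := List.length_eq_two.1 hl
    have hab : G.Adj a b := by simpa using h.1.2.2
    refine ⟨⟨s(a, b), hab⟩, member_eq_iff.2 ?_⟩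
    rcases Sym2.eq_iff.1 (hout s(a, b)) with ⟨h1, h2⟩ | ⟨h1, h2⟩
    · exact Or.inl (by simp [h1, h2])
    · exact Or.inr (by simp [h1, h2])

omit [Fintype U] in
lemma IsInducedCycle.forall_of_mem {A : U → Prop} (hA : ∀ x y, G.Adj x y → (A x ↔ A y))
    {s : Finset U} (hs : IsInducedCycle G s) {a : U} (ha : a ∈ s) (hAa : A a) : ∀ x ∈ s, A x := by
  classical
  obtain ⟨y, h1, -, h3⟩ := hs.exists_cyclic
  have hm := hs.1
  have key : ∀ i < s.card, (A (y i) ↔ A (y 0)) := by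
    intro i
    induction i with
    | zero => exact fun _ => Iff.rfl
    | succ i ih =>
      intro hi
      rw [← ih (by omega)]
      exact (hA _ _ ((h1.adj_iff i (i + 1) (by omega) hi (by omega)).2 rfl)).symm
  have hmem : ∀ x, x ∈ s ↔ ∃ i < s.card, y i = x := by
    intro x
    conv_lhs => rw [h3]
    exact mem_verts
  obtain ⟨i, hi, rfl⟩ := (hmem a).1 ha
  intro x hx
  obtain ⟨j, hj, rfl⟩ := (hmem x).1 hx
  exact (key j hj).2 ((key i hi).1 hAa)

/-- The histogram of the 2-cells in a union of components is determined by that of the edges: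
counting the pairs of a 2-cell of colour `χ` and an edge of it, every such 2-cell occurs `card χ`
times, and the number of occurrences of an edge depends on the colour of the edge only. -/
lemma colorsOf_cycles_in (hc : IsEquitable (pathBoundary G p) c) (hk : (k : ℕ∞) ≤ p)
    {A A' : U → Prop} (hA : ∀ x y, G.Adj x y → (A x ↔ A y))
    (hA' : ∀ x y, G.Adj x y → (A' x ↔ A' y))
    (h : colorsOf (fun e => e ∈ G.edgeSet ∧ ∀ x ∈ e, A x) (edgeCol (pathCol c c₀)) =
      colorsOf (fun e => e ∈ G.edgeSet ∧ ∀ x ∈ e, A' x) (edgeCol (pathCol c c₀))) :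
    colorsOf (fun s => (IsInducedCycle G s ∧ s.card ≤ k) ∧ ∀ x ∈ s, A x)
        (setCol G (pathCol c c₀)) =
      colorsOf (fun s => (IsInducedCycle G s ∧ s.card ≤ k) ∧ ∀ x ∈ s, A' x)
        (setCol G (pathCol c c₀)) := by
  classical
  have hpc := hc.isPathColoring c₀ hk
  ext χ
  set N : Sym2 U → ℕ := fun e => (colorsOf (fun s => (IsInducedCycle G s ∧ s.card ≤ k) ∧
    ∀ x ∈ e, x ∈ s) (setCol G (pathCol c c₀))).count χ with hN
  have key : ∀ A : U → Prop, (∀ x y, G.Adj x y → (A x ↔ A y)) →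
      χ.card * (colorsOf (fun s => (IsInducedCycle G s ∧ s.card ≤ k) ∧ ∀ x ∈ s, A x)
        (setCol G (pathCol c c₀))).count χ =
      (colorsOf (fun e => e ∈ G.edgeSet ∧ ∀ x ∈ e, A x) N).sum := by
    intro A hA
    rw [sum_colorsOf, count_colorsOf, Finset.mul_sum]
    have h1 : ∀ e, (if e ∈ G.edgeSet ∧ ∀ x ∈ e, A x then N e else 0) = ∑ s : Finset U,
        if (((IsInducedCycle G s ∧ s.card ≤ k) ∧ ∀ x ∈ s, A x) ∧ setCol G (pathCol c c₀) s = χ) ∧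
          (e ∈ G.edgeSet ∧ ∀ x ∈ e, x ∈ s) then 1 else 0 := by
      intro e
      simp only [hN, count_colorsOf]
      split_ifs with he
      · refine Finset.sum_congr rfl fun s _ => if_congr ?_ rfl rfl
        constructor
        · rintro ⟨⟨h1, h2⟩, h3⟩
          obtain ⟨a, ha⟩ : ∃ a, a ∈ e := ⟨_, e.out_fst_mem⟩
          exact ⟨⟨⟨h1, h1.1.forall_of_mem hA (h2 a ha) (he.2 a ha)⟩, h3⟩, he.1, h2⟩
        · rintro ⟨⟨⟨h1, -⟩, h3⟩, -, h2⟩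
          exact ⟨⟨h1, h2⟩, h3⟩
      · refine (Finset.sum_eq_zero fun s _ => if_neg ?_).symm
        rintro ⟨⟨⟨-, h1⟩, -⟩, h2, h3⟩
        exact he ⟨h2, fun x hx => h1 x (h3 x hx)⟩
    rw [Finset.sum_congr rfl fun e _ => h1 e, Finset.sum_comm]
    refine Finset.sum_congr rfl fun s _ => ?_
    by_cases hs : ((IsInducedCycle G s ∧ s.card ≤ k) ∧ ∀ x ∈ s, A x) ∧
        setCol G (pathCol c c₀) s = χ
    · rw [if_pos hs, mul_one, ← hs.2, setCol_eq, card_colorsOf]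
      refine Finset.sum_congr rfl fun e _ => if_congr ?_ rfl rfl
      exact ⟨fun h => ⟨⟨hs.1, rfl⟩, h⟩, fun h => h.2⟩
    · rw [if_neg hs, mul_zero]
      exact (Finset.sum_eq_zero fun e _ => if_neg fun h => hs h.1).symm
  have heq : colorsOf (fun e => e ∈ G.edgeSet ∧ ∀ x ∈ e, A x) N =
      colorsOf (fun e => e ∈ G.edgeSet ∧ ∀ x ∈ e, A' x) N :=
    colorsOf_eq_of_factor (S := fun e => e ∈ G.edgeSet)
      (fun e e' he he' hee => by rw [hN]; simp only; rw [colorsOf_cycles_at_edge hc hk he he' hee])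
      (fun _ h => h.1) (fun _ h => h.1) h
  by_cases hχ : χ.card = 0
  · -- The empty multiset is not the colour of a 2-cell.
    have zero : ∀ A : U → Prop, (colorsOf (fun s => (IsInducedCycle G s ∧ s.card ≤ k) ∧
        ∀ x ∈ s, A x) (setCol G (pathCol c c₀))).count χ = 0 := by
      intro A
      rw [Multiset.count_eq_zero, mem_colorsOf]
      rintro ⟨s, ⟨⟨hs, -⟩, -⟩, rfl⟩
      rw [hs.card_setCol hpc] at hχ
      have := hs.1
      omega
    rw [zero, zero]
  · exact Nat.eq_of_mul_eq_mul_left (Nat.pos_of_ne_zero hχ) (by rw [key A hA, key A' hA', heq])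

/-- On two unions of components with the same histogram of paths, the histograms of cells agree. -/
lemma colorsOf_cellsIn (hc : IsEquitable (pathBoundary G p) c) (hk3 : 3 ≤ k) (hk : (k : ℕ∞) ≤ p)
    {A A' : U → Prop} (hA : ∀ x y, G.Adj x y → (A x ↔ A y))
    (hA' : ∀ x y, G.Adj x y → (A' x ↔ A' y))
    (h : colorsOf (PathsIn A) c = colorsOf (PathsIn A') c) :
    colorsOf (CellsIn A) (cellCol G k (pathCol c c₀)) =
      colorsOf (CellsIn A') (cellCol G k (pathCol c c₀)) := by
  have hp : 1 ≤ p := le_trans (by exact_mod_cast (by omega : 1 ≤ k)) hk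
  have hv := colorsOf_and_congr (hc.hasLength_iff (n := 1)) h
  have he := colorsOf_and_congr (hc.hasLength_iff (n := 2)) h
  rw [colorsOf_pathsIn_vertices (c₀ := c₀), colorsOf_pathsIn_vertices (c₀ := c₀)] at hv
  rw [colorsOf_pathsIn_edges (c₀ := c₀) hp, colorsOf_pathsIn_edges (c₀ := c₀) hp] at he
  have hs := colorsOf_cycles_in hc hk hA hA' he
  have key : ∀ A : U → Prop, colorsOf (CellsIn A) (cellCol G k (pathCol c c₀)) =
      (colorsOf A fun v => pathCol c c₀ [v]).map .inl +
      ((colorsOf (fun e => e ∈ G.edgeSet ∧ ∀ x ∈ e, A x) (edgeCol (pathCol c c₀))).map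
        (fun a => .inr (.inl a)) +
      (colorsOf (fun s => (IsInducedCycle G s ∧ s.card ≤ k) ∧ ∀ x ∈ s, A x)
        (setCol G (pathCol c c₀))).map fun a => .inr (.inr a)) := by
    intro A
    rw [colorsOf_and_add _ (fun τ => ∃ v, τ = .inl v),
      colorsOf_and_add (fun τ => CellsIn A τ ∧ ¬ ∃ v, τ = .inl v) (fun τ => ∃ e, τ = .inr (.inl e)),
      colorsOf_vertices _ (fun τ hτ => hτ.2),
      colorsOf_edges (Q' := fun e => ∀ x ∈ e, A x) _ (fun τ hτ => hτ.2)
        (fun e => by simp [CellsIn]),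
      colorsOf_cycles (Q' := fun s => ∀ x ∈ s, A x) _ ?_ (fun s => by simp [CellsIn])]
    · congr 1
      rw [map_colorsOf]
      exact colorsOf_congr (fun v => by simp [CellsIn]) fun v _ => rfl
    · rintro (v | e | s) hτ
      exacts [absurd ⟨v, rfl⟩ hτ.1.2, absurd ⟨e, rfl⟩ hτ.2, ⟨s, rfl⟩]
  rw [key, key, hv, he, hs]

end Histograms

/-! ### Restriction to a union of connected components -/

section Restriction

variable {V U : Type*} {G : SimpleGraph V} {K : SimpleGraph U} {p : ℕ∞} {k : ℕ}

lemma isSimplePath_map (f : G ↪g K) {l : List V} :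
    IsSimplePath K (l.map f) ↔ IsSimplePath G l := by
  simp only [IsSimplePath, ne_eq, List.map_eq_nil_iff, List.nodup_map_iff f.injective,
    List.isChain_map, f.map_adj_iff]

/-- The map of path complexes given by an embedding of graphs. -/
def mapPath (f : G ↪g K) (p : ℕ∞) : ElemPath G p → ElemPath K p :=
  Quotient.map (fun a => ⟨a.1.map f, (isSimplePath_map f).2 a.2.1, by simpa using a.2.2⟩) (by
    rintro a b (h | h)
    · exact Or.inl (congrArg (List.map f) h)
    · exact Or.inr ((congrArg (List.map f) h).trans List.map_reverse))

lemma mapPath_member (f : G ↪g K) {l : List V} (h : IsSimplePath G l ∧ (l.length : ℕ∞) ≤ p + 1) :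
    mapPath f p (member l h) =
      member (l.map f) ⟨(isSimplePath_map f).2 h.1, by simpa using h.2⟩ := rfl

lemma mapPath_injective (f : G ↪g K) : Function.Injective (mapPath f p) := by
  intro σ τ he
  obtain ⟨l, h, rfl⟩ := exists_member σ
  obtain ⟨l', h', rfl⟩ := exists_member τ
  rw [mapPath_member, mapPath_member, member_eq_iff, ← List.map_reverse] at he
  exact member_eq_iff.2 (he.imp (fun h => List.map_injective_iff.2 f.injective h)
    fun h => List.map_injective_iff.2 f.injective h)

lemma mem_range_mapPath (f : G ↪g K) {σ : ElemPath K p} :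
    σ ∈ Set.range (mapPath f p) ↔ PathsIn (· ∈ Set.range f) σ := by
  constructor
  · rintro ⟨τ, rfl⟩
    obtain ⟨l, h, rfl⟩ := exists_member τ
    rw [mapPath_member, pathsIn_member]
    intro x hx
    obtain ⟨y, -, rfl⟩ := List.mem_map.1 hx
    exact ⟨y, rfl⟩
  · rintro ⟨l, h, rfl, hl⟩
    obtain ⟨l', rfl⟩ : l ∈ Set.range (List.map f) := by
      rw [Set.range_list_map]
      exact hl
    exact ⟨member l' ⟨(isSimplePath_map f).1 h.1, by simpa using h.2⟩, rfl⟩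

lemma pathBoundary_member_iff {l : List U} {h : IsSimplePath K l ∧ (l.length : ℕ∞) ≤ p + 1}
    {σ : ElemPath K p} : pathBoundary K p σ (member l h) ↔
      ∃ i < l.length, ∃ h', σ = member (l.eraseIdx i) h' := by
  obtain ⟨u, hu⟩ := exists_seg h.1.1
  obtain ⟨m, hm⟩ : ∃ m, l.length = m + 1 :=
    ⟨l.length - 1, by have := List.length_pos_iff.2 h.1.1; omega⟩
  rw [hm] at hu ⊢
  rw [pathBoundary_member hu]
  constructor
  · rintro ⟨i, hi, h', he⟩
    have := eraseIdx_seg u hi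
    rw [← hu] at this
    simp only [← this] at h' he
    exact ⟨i, by omega, h', he⟩
  · rintro ⟨i, hi, h', he⟩
    have := eraseIdx_seg u (Nat.lt_succ_iff.1 hi)
    rw [← hu] at this
    simp only [this] at h' he
    exact ⟨i, by omega, h', he⟩

lemma IsSimplePath.forall_of_mem {A : U → Prop} (hA : ∀ x y, K.Adj x y → (A x ↔ A y))
    {l : List U} (hl : IsSimplePath K l) {a : U} (ha : a ∈ l) (hAa : A a) : ∀ x ∈ l, A x := by
  obtain ⟨u, hu⟩ := exists_seg hl.1
  generalize l.length = n at hu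
  subst hu
  have hadj := (isSimplePath_seg.1 hl).2.2
  have key : ∀ i < n, (A (u i) ↔ A (u 0)) := by
    intro i
    induction i with
    | zero => exact fun _ => Iff.rfl
    | succ i ih => exact fun hi => (hA _ _ (hadj i hi)).symm.trans (ih (by omega))
  obtain ⟨i, hi, rfl⟩ := mem_seg.1 ha
  intro x hx
  obtain ⟨j, hj, rfl⟩ := mem_seg.1 hx
  exact (key j hj).2 ((key i hi).1 hAa)

lemma pathBoundary_mapPath (f : G ↪g K) (σ τ : ElemPath G p) :
    pathBoundary K p (mapPath f p σ) (mapPath f p τ) ↔ pathBoundary G p σ τ := by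
  obtain ⟨l, h, rfl⟩ := exists_member τ
  rw [mapPath_member, pathBoundary_member_iff, pathBoundary_member_iff, List.length_map]
  refine exists_congr fun i => and_congr_right fun hi => ?_
  constructor
  · rintro ⟨h', he⟩
    simp only [List.eraseIdx_map] at h' he
    exact ⟨⟨(isSimplePath_map f).1 h'.1, by simpa using h'.2⟩, mapPath_injective f he⟩
  · rintro ⟨h', rfl⟩
    simp only [List.eraseIdx_map]
    exact ⟨⟨(isSimplePath_map f).2 h'.1, by simpa using h'.2⟩, rfl⟩

lemma mem_range_mapPath_of_boundary (f : G ↪g K) {σ τ : ElemPath K p}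
    (hf : ∀ x y, K.Adj x y → (x ∈ Set.range f ↔ y ∈ Set.range f)) (h : pathBoundary K p σ τ) :
    σ ∈ Set.range (mapPath f p) ↔ τ ∈ Set.range (mapPath f p) := by
  obtain ⟨l, hl, rfl⟩ := exists_member τ
  obtain ⟨i, hi, h', rfl⟩ := pathBoundary_member_iff.1 h
  rw [mem_range_mapPath, mem_range_mapPath, pathsIn_member, pathsIn_member]
  constructor
  · intro hA
    obtain ⟨x, hx⟩ := List.exists_mem_of_ne_nil _ h'.1.1
    exact hl.1.forall_of_mem hf (List.mem_of_mem_eraseIdx hx) (hA x hx)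
  · exact fun hA x hx => hA x (List.mem_of_mem_eraseIdx hx)

lemma refineBU_mapPath [Finite V] [Finite U] {C : Type*}
    (hash : C × Multiset C × Multiset (C × C) → C)
    (c₀ : C) (f : G ↪g K) (hf : ∀ x y, K.Adj x y → (x ∈ Set.range f ↔ y ∈ Set.range f)) (t : ℕ)
    (σ : ElemPath G p) : refineBU hash c₀ (pathBoundary K p) t (mapPath f p σ) =
      refineBU hash c₀ (pathBoundary G p) t σ :=
  refineBU_comp hash c₀ (mapPath_injective f) (pathBoundary_mapPath f)
    (fun _ _ h => (mem_range_mapPath_of_boundary f hf h).2 ⟨_, rfl⟩)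
    (fun _ _ h => (mem_range_mapPath_of_boundary f hf h).1 ⟨_, rfl⟩) t σ

lemma histogram_pwlColoring [Finite V] [Finite U] {C : Type*}
    (hash : C × Multiset C × Multiset (C × C) → C)
    (c₀ : C) (f : G ↪g K) (hf : ∀ x y, K.Adj x y → (x ∈ Set.range f ↔ y ∈ Set.range f)) (t : ℕ) :
    histogram (pwlColoring hash c₀ G p t) =
      colorsOf (PathsIn (· ∈ Set.range f)) (refineBU hash c₀ (pathBoundary K p) t) := by
  rw [colorsOf_comp (mapPath_injective f) (fun σ hσ => (mem_range_mapPath f).2 hσ)]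
  exact colorsOf_congr
    (fun σ => iff_of_true trivial ((mem_range_mapPath f).1 ⟨σ, rfl⟩))
    fun σ _ => (refineBU_mapPath hash c₀ f hf t σ).symm

lemma isInducedCycle_map (f : G ↪g K) {s : Finset V} :
    IsInducedCycle K (s.map f.toEmbedding) ↔ IsInducedCycle G s := by
  let g : ((s : Set V) : Type _) → ((s.map f.toEmbedding : Finset U) : Set U) := fun x =>
    ⟨f x, Finset.mem_map_of_mem f.toEmbedding x.2⟩
  have hg : Function.Bijective g := by
    constructor
    · intro x y h
      exact Subtype.ext (f.injective (congrArg Subtype.val h))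
    · rintro ⟨x, hx⟩
      obtain ⟨y, hy, rfl⟩ := Finset.mem_map.1 hx
      exact ⟨⟨y, hy⟩, rfl⟩
  let e : G.induce (s : Set V) ≃g K.induce ((s.map f.toEmbedding : Finset U) : Set U) :=
    ⟨Equiv.ofBijective g hg, fun {x y} => f.map_adj_iff⟩
  unfold IsInducedCycle
  rw [Finset.card_map]
  exact and_congr_right fun _ => ⟨fun ⟨φ⟩ => ⟨φ.trans e.symm⟩, fun ⟨φ⟩ => ⟨φ.trans e⟩⟩

/-- The map of cell complexes given by an embedding of graphs. -/
def mapCell (f : G ↪g K) (k : ℕ) : Cell G k → Cell K k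
  | .inl v => .inl (f v)
  | .inr (.inl e) => .inr (.inl (f.mapEdgeSet e))
  | .inr (.inr s) => .inr (.inr ⟨s.1.map f.toEmbedding, (isInducedCycle_map f).2 s.2.1, by
      rw [Finset.card_map]
      exact s.2.2⟩)

lemma mapCell_injective (f : G ↪g K) : Function.Injective (mapCell f k) := by
  rintro (v | e | s) (v' | e' | s') h
  all_goals simp only [mapCell, Sum.inl.injEq, Sum.inr.injEq, reduceCtorEq, Subtype.mk.injEq] at h
  · rw [f.injective h]
  · rw [f.mapEdgeSet.injective h]
  · rw [Subtype.ext (Finset.map_injective _ h)]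

lemma mem_range_mapCell [Fintype V] (f : G ↪g K) {σ : Cell K k} :
    σ ∈ Set.range (mapCell f k) ↔ CellsIn (· ∈ Set.range f) σ := by
  constructor
  · rintro ⟨v | e | s, rfl⟩
    · exact ⟨v, rfl⟩
    · intro x hx
      obtain ⟨y, -, rfl⟩ := Sym2.mem_map.1 hx
      exact ⟨y, rfl⟩
    · intro x hx
      obtain ⟨y, -, rfl⟩ := Finset.mem_map.1 hx
      exact ⟨y, rfl⟩
  · rcases σ with v | ⟨e, he⟩ | ⟨s, hs⟩
    · rintro ⟨w, rfl⟩
      exact ⟨.inl w, rfl⟩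
    · intro hA
      induction e with | _ a b
      obtain ⟨a, rfl⟩ := hA a (Sym2.mem_mk_left _ _)
      obtain ⟨b, rfl⟩ := hA b (Sym2.mem_mk_right _ _)
      exact ⟨.inr (.inl ⟨s(a, b), f.map_adj_iff.1 he⟩), rfl⟩
    · intro hA
      obtain ⟨t, -, rfl⟩ : ∃ t ⊆ Finset.univ, s = t.map f.toEmbedding := by
        rw [← Finset.subset_map_iff]
        intro x hx
        obtain ⟨y, rfl⟩ := hA x hx
        exact Finset.mem_map_of_mem f.toEmbedding (Finset.mem_univ y)
      exact ⟨.inr (.inr ⟨t, (isInducedCycle_map f).1 hs.1, by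
        rw [← Finset.card_map f.toEmbedding]
        exact hs.2⟩), rfl⟩

lemma cellBoundary_mapCell (f : G ↪g K) (σ τ : Cell G k) :
    cellBoundary K k (mapCell f k σ) (mapCell f k τ) ↔ cellBoundary G k σ τ := by
  rcases σ with v | e | s <;> rcases τ with v' | e' | s' <;> try exact Iff.rfl
  · change f v ∈ Sym2.map f e'.1 ↔ v ∈ e'.1
    rw [Sym2.mem_map]
    exact ⟨fun ⟨w, hw, h⟩ => f.injective h ▸ hw, fun h => ⟨v, h, rfl⟩⟩
  · change (∀ x ∈ Sym2.map f e.1, x ∈ s'.1.map f.toEmbedding) ↔ ∀ x ∈ e.1, x ∈ s'.1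
    constructor
    · intro h x hx
      exact (Finset.mem_map' f.toEmbedding).1 (h _ (Sym2.mem_map.2 ⟨x, hx, rfl⟩))
    · intro h x hx
      obtain ⟨y, hy, rfl⟩ := Sym2.mem_map.1 hx
      exact Finset.mem_map_of_mem f.toEmbedding (h y hy)

lemma cellsIn_of_boundary {A : U → Prop} (hA : ∀ x y, K.Adj x y → (A x ↔ A y)) {σ τ : Cell K k}
    (h : cellBoundary K k σ τ) : CellsIn A σ ↔ CellsIn A τ := by
  rcases σ with v | ⟨e, he⟩ | s <;> rcases τ with v' | ⟨e', he'⟩ | s' <;> try exact h.elim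
  · obtain ⟨w, rfl⟩ : ∃ w, e' = s(v, w) := h
    simp [CellsIn, hA v w he']
  · constructor
    · intro h'
      have hm : e.out.1 ∈ e := e.out_fst_mem
      exact s'.2.1.forall_of_mem hA (h _ hm) (h' _ hm)
    · exact fun h' x hx => h' x (h x hx)

lemma refineFull_mapCell [Fintype V] [Finite U] {D : Type*}
    (hash : D × Multiset D × Multiset D × Multiset (D × D) × Multiset (D × D) → D) (d₀ : D)
    (f : G ↪g K) (hf : ∀ x y, K.Adj x y → (x ∈ Set.range f ↔ y ∈ Set.range f)) (t : ℕ)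
    (σ : Cell G k) : refineFull hash d₀ (cellBoundary K k) t (mapCell f k σ) =
      refineFull hash d₀ (cellBoundary G k) t σ := by
  have key : ∀ {σ τ}, cellBoundary K k σ τ →
      (σ ∈ Set.range (mapCell f k) ↔ τ ∈ Set.range (mapCell f k)) := fun h => by
    rw [mem_range_mapCell, mem_range_mapCell, cellsIn_of_boundary hf h]
  exact refineFull_comp hash d₀ (mapCell_injective f) (cellBoundary_mapCell f)
    (fun _ _ h => (key h).2 ⟨_, rfl⟩) (fun _ _ h => (key h).1 ⟨_, rfl⟩) t σ

lemma histogram_cwlColoring [Fintype V] [Finite U] {D : Type*}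
    (hash : D × Multiset D × Multiset D × Multiset (D × D) × Multiset (D × D) → D) (d₀ : D)
    (f : G ↪g K) (hf : ∀ x y, K.Adj x y → (x ∈ Set.range f ↔ y ∈ Set.range f)) (t : ℕ) :
    histogram (cwlColoring hash d₀ G k t) =
      colorsOf (CellsIn (· ∈ Set.range f)) (refineFull hash d₀ (cellBoundary K k) t) := by
  rw [colorsOf_comp (mapCell_injective f) (fun σ hσ => (mem_range_mapCell f).2 hσ)]
  exact colorsOf_congr
    (fun σ => iff_of_true trivial ((mem_range_mapCell f).1 ⟨σ, rfl⟩))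
    fun σ _ => (refineFull_mapCell hash d₀ f hf t σ).symm

/-- A stable colouring of PWL is equitable. -/
lemma isEquitable_of_stable [Finite U] {C : Type*} {hash : C × Multiset C × Multiset (C × C) → C}
    (hh : Function.Injective hash) {c₀ : C} {T : ℕ}
    (hT : ∀ x y, refineBU hash c₀ (pathBoundary K p) T x = refineBU hash c₀ (pathBoundary K p) T y →
      refineBU hash c₀ (pathBoundary K p) (T + 1) x =
        refineBU hash c₀ (pathBoundary K p) (T + 1) y) :
    IsEquitable (pathBoundary K p) (refineBU hash c₀ (pathBoundary K p) T) := by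
  have h : ∀ x y, refineBU hash c₀ (pathBoundary K p) T x =
      refineBU hash c₀ (pathBoundary K p) T y → _ := fun x y he => hh (hT x y he)
  have hB : ∀ x y, refineBU hash c₀ (pathBoundary K p) T x =
      refineBU hash c₀ (pathBoundary K p) T y → _ := fun x y he =>
    congrArg (fun q => q.2.1) (h x y he)
  exact ⟨hB, fun x y he => coboundaryColors_eq_of_upperColors
    (fun a b hab => congrArg Multiset.card (hB a b hab)) (congrArg (fun q => q.2.2) (h x y he))⟩

end Restriction

end PathWL

theorem mainTheorem1 {V W : Type*} [Finite V] [Finite W]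
    (G : SimpleGraph V) (H : SimpleGraph W)
    (k : ℕ) (hk : 3 ≤ k) (p : ℕ∞) (hp : (k : ℕ∞) ≤ p)
    {C : Type*} (hashP : C × Multiset C × Multiset (C × C) → C)
    (hhashP : Function.Injective hashP) (c₀ : C)
    {D : Type*}
    (hashC : D × Multiset D × Multiset D × Multiset (D × D) × Multiset (D × D) → D)
    (hhashC : Function.Injective hashC) (d₀ : D)
    (hdist : PathWL.Distinguishes
      (PathWL.cwlColoring hashC d₀ G k) (PathWL.cwlColoring hashC d₀ H k)) :
    PathWL.Distinguishes
      (PathWL.pwlColoring hashP c₀ G p) (PathWL.pwlColoring hashP c₀ H p) := by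
  have := Fintype.ofFinite V
  have := Fintype.ofFinite W
  let K : SimpleGraph (V ⊕ W) := G ⊕g H
  let f : G ↪g K := SimpleGraph.Embedding.sumInl
  let f' : H ↪g K := SimpleGraph.Embedding.sumInr
  have hf : ∀ x y, K.Adj x y → (x ∈ Set.range f ↔ y ∈ Set.range f) := by
    rintro (x | x) (y | y) h
    exacts [iff_of_true ⟨x, rfl⟩ ⟨y, rfl⟩, absurd h Bool.false_ne_true, absurd h Bool.false_ne_true,
      iff_of_false (fun ⟨_, h⟩ => Sum.inl_ne_inr h) (fun ⟨_, h⟩ => Sum.inl_ne_inr h)]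
  have hf' : ∀ x y, K.Adj x y → (x ∈ Set.range f' ↔ y ∈ Set.range f') := by
    rintro (x | x) (y | y) h
    exacts [iff_of_false (fun ⟨_, h⟩ => Sum.inr_ne_inl h) (fun ⟨_, h⟩ => Sum.inr_ne_inl h),
      absurd h Bool.false_ne_true, absurd h Bool.false_ne_true, iff_of_true ⟨x, rfl⟩ ⟨y, rfl⟩]
  obtain ⟨T, hT⟩ := PathWL.exists_stable hhashP c₀ (PathWL.pathBoundary K p)
  have hc := PathWL.isEquitable_of_stable hhashP hT
  refine ⟨T, ?_, fun hhist => ?_⟩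
  · -- The parallel run on `G` and `H` is the restriction of the run on the disjoint union.
    have key : ∀ (t : ℕ) (x : PathWL.ElemPath G p ⊕ PathWL.ElemPath H p),
        Sum.elim (PathWL.pwlColoring hashP c₀ G p t) (PathWL.pwlColoring hashP c₀ H p t) x =
          PathWL.refineBU hashP c₀ (PathWL.pathBoundary K p) t
            (Sum.elim (PathWL.mapPath f p) (PathWL.mapPath f' p) x) := by
      rintro t (x | x)
      exacts [(PathWL.refineBU_mapPath hashP c₀ f hf t x).symm,
        (PathWL.refineBU_mapPath hashP c₀ f' hf' t x).symm]
    intro x y h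
    rw [key, key] at h ⊢
    exact hT _ _ h
  · rw [PathWL.histogram_pwlColoring hashP c₀ f hf, PathWL.histogram_pwlColoring hashP c₀ f' hf']
      at hhist
    have hcells := PathWL.colorsOf_cellsIn (c₀ := c₀) hc hk hp hf hf' hhist
    have heq := PathWL.cellCol_equitable (c₀ := c₀) hc hk hp
    obtain ⟨t, -, hne⟩ := hdist
    obtain ⟨g, hg⟩ := PathWL.refineFull_eq_of_equitable hashC d₀ heq.down heq.up t
    refine hne ?_
    rw [PathWL.histogram_cwlColoring hashC d₀ f hf, PathWL.histogram_cwlColoring hashC d₀ f' hf',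
      funext hg]
    exact (PathWL.map_colorsOf _ _ g).symm.trans
      ((congrArg (Multiset.map g) hcells).trans (PathWL.map_colorsOf _ _ g))
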